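/- **Theorem.** Let $\gamma,\lambda,\mu>0$ and $\omega\in\mathbb R$. Let $Q=H^1(\mathbb R^+)\oplus H^1(\mathbb R^-)$ (complex-valued functions, identified when equal almost everywhere). For $\psi\in Q$ let $\psi(0\pm)$ be its one-sided boundary values at the origin, let $\psi'$ be its weak derivative on $\mathbb R\setminus\{0\}$, and put $$S_\omega(\psi)=\tfrac12\|\psi'\|_2^2+\tfrac\omega2\|\psi\|_2^2-\tfrac1{2\gamma}|\psi(0+)-\psi(0-)|^2-\tfrac{\lambda}{2\mu+2}\|\psi\|_{2\mu+2}^{2\mu+2},$$ $$I_\omega(\psi)=\|\psi'\|_2^2+\omega\|\psi\|_2^2-\tfrac1{\gamma}|\psi(0+)-\psi(0-)|^2-\lambda\|\psi\|_{2\mu+2}^{2\mu+2}.$$ A *ground state* at frequency $\omega$ is a minimizer of $S_\omega$ on $\{\psi\in Q\setminus\{0\}: I_\omega(\psi)=0\}$. For $\omega>0$ and $x_0,x_1,x_2,\theta\in\mathbb R$ let $$\phi_\omega^{x_0}(x)=\lambda^{-\frac1{2\mu}}(\mu+1)^{\frac1{2\mu}}\omega^{\frac1{2\mu}}\operatorname{sech}^{\frac1\mu}\!\big[\mu\sqrt\omega\,(x-x_0)\big],\qquad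 \psi_\omega^{x_1,x_2,\theta}(x)=\begin{cases}-e^{i\theta}\phi_\omega^{x_1}(x),&x<0,\\ \phantom{-}e^{i\theta}\phi_\omega^{x_2}(x),&x>0.\end{cases}$$ Let $\omega_0=\frac4{\gamma^2}$ and $\omega^*=\frac{4(\mu+1)}{\gamma^2\mu}$. 1. If $\omega_0<\omega\le\omega^*$, then the set of ground states is exactly $\{\psi_\omega^{y,-y,\theta}:\theta\in\mathbb R\}$, where $$y=\frac1{2\mu\sqrt\omega}\log\frac{\gamma\sqrt\omega+2}{\gamma\sqrt\omega-2};$$ these functions are odd on $\mathbb R\setminus\{0\}$. 2. If $\omega>\omega^*$, then the system $$t_1^{2\mu}-t_1^{2\mu+2}=t_2^{2\mu}-t_2^{2\mu+2},\qquad t_1^{-1}+t_2^{-1}=\gamma\sqrt\omega$$ has exactly one solution $(t_1,t_2)$ with $0<t_1<t_2<1$. With this solution and $$y_i=\frac1{2\mu\sqrt\omega}\log\left|\frac{1+t_i}{1-t_i}\right|\qquad(i=1,2),$$ one has $0<y_1<y_2$, and the set of ground states is exactly $$\{\psi_\omega^{y_1,-y_2,\theta}:\theta\in\mathbb R\}\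 \cup\ \{\psi_\omega^{y_2,-y_1,\theta}:\theta\in\mathbb R\},$$ the two families being disjoint. Thus, up to a phase, there are exactly two ground states, and neither is symmetric. -/

import Mathlib

open MeasureTheory Set Filter Topology

noncomputable section

namespace DeltaPrimeNLS

/-- `g` is a weak derivative of `ψ` on the open set `U ⊆ ℝ`. -/
def IsWeakDerivOn (U : Set ℝ) (ψ g : ℝ → ℂ) : Prop :=
  ∀ η : ℝ → ℝ, ContDiff ℝ (⊤ : ℕ∞) η → HasCompactSupport η → tsupport η ⊆ U →
    ∫ x in U, deriv η x • ψ x = -∫ x in U, η x • g x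

/-- The Sobolev space `H¹(U)`: `ψ` is square integrable on `U` and has a square integrable
weak derivative there. -/
def MemH1 (U : Set ℝ) (ψ : ℝ → ℂ) : Prop :=
  MemLp ψ 2 (volume.restrict U) ∧
    ∃ g : ℝ → ℂ, MemLp g 2 (volume.restrict U) ∧ IsWeakDerivOn U ψ g

open Classical in
/-- The square integrable weak derivative of `ψ ∈ H¹(U)` (unique up to null sets, see
`IsWeakDerivOn.ae_eq`); zero if there is none. -/
def weakDeriv (U : Set ℝ) (ψ : ℝ → ℂ) : ℝ → ℂ :=
  if h : ∃ g : ℝ → ℂ, MemLp g 2 (volume.restrict U) ∧ IsWeakDerivOn U ψ g then h.choose else 0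

theorem IsWeakDerivOn.ae_eq {U : Set ℝ} (hU : IsOpen U) {ψ g₁ g₂ : ℝ → ℂ}
    (hg₁ : MemLp g₁ 2 (volume.restrict U)) (hg₂ : MemLp g₂ 2 (volume.restrict U))
    (h₁ : IsWeakDerivOn U ψ g₁) (h₂ : IsWeakDerivOn U ψ g₂) :
    g₁ =ᵐ[volume.restrict U] g₂ := by
  have hl : ∀ g : ℝ → ℂ, MemLp g 2 (volume.restrict U) → LocallyIntegrableOn g U volume := by
    intro g hg
    exact locallyIntegrableOn_of_locallyIntegrable_restrict
      (hg.locallyIntegrable (by norm_num))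
  have key := hU.ae_eq_zero_of_integral_contDiff_smul_eq_zero (μ := volume) (f := g₁ - g₂)
    ((hl g₁ hg₁).sub (hl g₂ hg₂)) (by
      intro η hη hc hs
      have hout : ∀ x ∉ U, η x = 0 := fun x hx =>
        image_eq_zero_of_notMem_tsupport fun h => hx (hs h)
      have hm : MemLp η 2 (volume.restrict U) :=
        (hη.continuous.memLp_of_hasCompactSupport hc).restrict U
      have e := (h₁ η hη hc hs).symm.trans (h₂ η hη hc hs)
      rw [neg_inj] at e
      rw [← setIntegral_eq_integral_of_forall_compl_eq_zero (s := U)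
        (fun x hx => by simp [hout x hx])]
      have hi : ∀ g : ℝ → ℂ, MemLp g 2 (volume.restrict U) →
          Integrable (fun x => η x • g x) (volume.restrict U) := fun g hg =>
        memLp_one_iff_integrable.1 (hg.smul hm)
      simp only [Pi.sub_apply, smul_sub]
      rw [integral_sub (hi g₁ hg₁) (hi g₂ hg₂), e, sub_self])
  rw [Filter.EventuallyEq, ae_restrict_iff' hU.measurableSet]
  filter_upwards [key] with x hx hxU
  exact sub_eq_zero.1 (hx hxU)

/-- The energy space `Q = H¹(ℝ⁺) ⊕ H¹(ℝ⁻)`; its elements are represented by functions on `ℝ`,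
two functions that agree almost everywhere being the same element. -/
def energySpace : Set (ℝ → ℂ) := {ψ | MemH1 (Ioi 0) ψ ∧ MemH1 (Iio 0) ψ}

/-- The boundary value `ψ(0+)`: the limit of `ψ x` as `x → 0` through `x > 0`, up to null sets
(for `ψ ∈ Q`, the value at `0` of the continuous representative on the right half-line). -/
def rightValue (ψ : ℝ → ℂ) : ℂ := limUnder (𝓝[>] (0 : ℝ) ⊓ ae volume) ψ

/-- The boundary value `ψ(0-)`. -/
def leftValue (ψ : ℝ → ℂ) : ℂ := limUnder (𝓝[<] (0 : ℝ) ⊓ ae volume) ψ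

/-- `‖ψ'‖²`, the derivative being taken away from the origin. -/
def derivNormSq (ψ : ℝ → ℂ) : ℝ :=
  (∫ x in Ioi (0 : ℝ), ‖weakDeriv (Ioi 0) ψ x‖ ^ 2) +
    ∫ x in Iio (0 : ℝ), ‖weakDeriv (Iio 0) ψ x‖ ^ 2

/-- The mass `M(ψ) = ‖ψ‖²`. -/
def mass (ψ : ℝ → ℂ) : ℝ := ∫ x, ‖ψ x‖ ^ 2

/-- `‖ψ‖_{2μ+2}^{2μ+2}`. -/
def powerNorm (μ : ℝ) (ψ : ℝ → ℂ) : ℝ := ∫ x, ‖ψ x‖ ^ (2 * μ + 2)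

/-- The quadratic form `F_γ` of the attractive `δ'` interaction of strength `γ`. -/
def formF (γ : ℝ) (ψ : ℝ → ℂ) : ℝ :=
  derivNormSq ψ - γ⁻¹ * ‖rightValue ψ - leftValue ψ‖ ^ 2

/-- The energy `E`. -/
def energy (γ lam μ : ℝ) (ψ : ℝ → ℂ) : ℝ :=
  1 / 2 * formF γ ψ - lam / (2 * μ + 2) * powerNorm μ ψ

/-- The action `S_ω = E + (ω/2) M`. -/
def action (γ lam μ ω : ℝ) (ψ : ℝ → ℂ) : ℝ :=
  energy γ lam μ ψ + ω / 2 * mass ψ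

/-- The Nehari functional `I_ω`. -/
def nehari (γ lam μ ω : ℝ) (ψ : ℝ → ℂ) : ℝ :=
  formF γ ψ + ω * mass ψ - lam * powerNorm μ ψ

/-- The nonzero elements of `Q` with `I_ω = 0`. -/
def nehariManifold (γ lam μ ω : ℝ) : Set (ℝ → ℂ) :=
  {ψ | ψ ∈ energySpace ∧ ¬ ψ =ᵐ[volume] 0 ∧ nehari γ lam μ ω ψ = 0}

/-- The ground states: the minimizers of the action on the Nehari manifold. -/
def groundStates (γ lam μ ω : ℝ) : Set (ℝ → ℂ) :=
  {ψ | ψ ∈ nehariManifold γ lam μ ω ∧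
    ∀ φ ∈ nehariManifold γ lam μ ω, action γ lam μ ω ψ ≤ action γ lam μ ω φ}

/-- The soliton `φ_ω^{x₀}` of the free equation. -/
def soliton (lam μ ω x₀ x : ℝ) : ℝ :=
  lam ^ (-(1 / (2 * μ))) * (μ + 1) ^ (1 / (2 * μ)) * ω ^ (1 / (2 * μ)) *
    (Real.cosh (μ * √ω * (x - x₀)))⁻¹ ^ (1 / μ)

/-- The function `ψ_ω^{x₁,x₂,θ}` (its value at the origin is irrelevant). -/
def boundState (lam μ ω x₁ x₂ θ x : ℝ) : ℂ :=
  if x < 0 then -(Complex.exp (θ * Complex.I) * soliton lam μ ω x₁ x)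
  else Complex.exp (θ * Complex.I) * soliton lam μ ω x₂ x

/-- The orbit under phase multiplication of `ψ_ω^{x₁,x₂,0}`, as a subset of `Q`: all functions
that agree almost everywhere with `ψ_ω^{x₁,x₂,θ}` for some `θ`. -/
def phaseOrbit (lam μ ω x₁ x₂ : ℝ) : Set (ℝ → ℂ) :=
  {ψ | ∃ θ : ℝ, ψ =ᵐ[volume] boundState lam μ ω x₁ x₂ θ}

/-- `(t₁, t₂)`, with `0 < t₁ < t₂ < 1`, solves the matching system. -/
def SolvesSystem (γ μ ω t₁ t₂ : ℝ) : Prop :=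
  0 < t₁ ∧ t₁ < t₂ ∧ t₂ < 1 ∧
    t₁ ^ (2 * μ) - t₁ ^ (2 * μ + 2) = t₂ ^ (2 * μ) - t₂ ^ (2 * μ + 2) ∧
    t₁⁻¹ + t₂⁻¹ = γ * √ω

/-- The bifurcation frequency `ω*`. -/
def omegaStar (γ μ : ℝ) : ℝ := 4 * (μ + 1) / (γ ^ 2 * μ)

/-- The point `y > 0` with `tanh (μ √ω y) = t`, for `t ∈ (0, 1)`. -/
def centre (μ ω t : ℝ) : ℝ := 1 / (2 * μ * √ω) * Real.log |(1 + t) / (1 - t)|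

end DeltaPrimeNLS

end

open DeltaPrimeNLS

/-!
For `ψ ∈ Q` with boundary moduli `a = |ψ(0+)|` and `b = |ψ(0-)|`, the jump term is smallest when
`|ψ(0+) - ψ(0-)| = a + b`, so everything reduces to the two half-lines. On a half-line one
completes the square in `|ψ'|² + ω|ψ|²` against the logarithmic slope that a soliton tail has when
exactly the remaining `L^(2μ+2)` mass lies ahead of it. This bounds the quadratic energy from below
by a boundary term plus a function of the total mass, with equality only for phase multiples of
soliton tails.

On the Nehari manifold the action is a multiple of `‖ψ‖_{2μ+2}^{2μ+2}`. Comparing the boundary terms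
with the jump term shows that this norm is at least the norm of a pair of soliton tails whose
slopes `√ω t₁`, `√ω t₂` satisfy `t₁⁻¹ + t₂⁻¹ = γ√ω`. With `t₁⁻¹ = A + d` and `t₂⁻¹ = A - d`, the
derivative in `d` of the norm of the pair has the sign of the logarithm of the ratio of
`t^(2μ) - t^(2μ+2)` at `t₁` and at `t₂`. For `ω ≤ ω*` it is positive on `d > 0`, so the symmetric
pair is optimal; for `ω > ω*` it has a single zero there, where it turns from negative to
positive.
-/

noncomputable section

namespace DeltaPrimeNLS

section AbsolutelyContinuous

variable {X Y E : Type*} [PseudoMetricSpace X] [PseudoMetricSpace Y] [NormedAddCommGroup E]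
  {a b : ℝ}

theorem absolutelyContinuousOnInterval_of_dist_le {f : ℝ → X} {F : ℝ → Y}
    (hF : AbsolutelyContinuousOnInterval F a b)
    (h : ∀ x ∈ uIcc a b, ∀ y ∈ uIcc a b, dist (f x) (f y) ≤ dist (F x) (F y)) :
    AbsolutelyContinuousOnInterval f a b := by
  rw [absolutelyContinuousOnInterval_iff] at hF ⊢
  intro ε hε
  obtain ⟨δ, hδ, hd⟩ := hF ε hε
  refine ⟨δ, hδ, fun I hI hI' => lt_of_le_of_lt ?_ (hd I hI hI')⟩
  exact Finset.sum_le_sum fun i hi => h _ (hI.1 i hi).1 _ (hI.1 i hi).2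

theorem absolutelyContinuousOnInterval_norm {f : ℝ → E}
    (hf : AbsolutelyContinuousOnInterval f a b) :
    AbsolutelyContinuousOnInterval (fun x => ‖f x‖) a b :=
  absolutelyContinuousOnInterval_of_dist_le hf fun x _ y _ => by
    rw [Real.dist_eq, dist_eq_norm]
    exact abs_norm_sub_norm_le _ _

variable [NormedSpace ℝ E]

theorem absolutelyContinuousOnInterval_of_hasDerivAt {F F' : ℝ → E} (hab : a ≤ b)
    (hF : ∀ x ∈ Icc a b, HasDerivAt F (F' x) x) (hc : ContinuousOn F' (Icc a b)) :
    AbsolutelyContinuousOnInterval F a b := by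
  obtain ⟨C, hC⟩ := isCompact_Icc.exists_bound_of_continuousOn hc
  have hL : LipschitzOnWith C.toNNReal F (uIcc a b) := by
    rw [uIcc_of_le hab]
    refine (convex_Icc a b).lipschitzOnWith_of_nnnorm_hasDerivWithin_le
      (fun x hx => (hF x hx).hasDerivWithinAt) fun x hx => ?_
    rw [← NNReal.coe_le_coe]
    exact (hC x hx).trans (Real.le_coe_toNNReal C)
  exact hL.absolutelyContinuousOnInterval

theorem absolutelyContinuousOnInterval_integral {g : ℝ → E} {c : ℝ}
    (hg : IntervalIntegrable g volume a b) (hc : c ∈ uIcc a b) :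
    AbsolutelyContinuousOnInterval (fun x => ∫ t in c..x, g t) a b := by
  refine absolutelyContinuousOnInterval_of_dist_le
    (hg.norm.absolutelyContinuousOnInterval_intervalIntegral hc) fun x hx y hy => ?_
  have hcx := hg.mono_set (uIcc_subset_uIcc hc hx)
  have hcy := hg.mono_set (uIcc_subset_uIcc hc hy)
  rw [dist_eq_norm, Real.dist_eq, intervalIntegral.integral_interval_sub_left hcx hcy,
    intervalIntegral.integral_interval_sub_left hcx.norm hcy.norm]
  exact intervalIntegral.norm_integral_le_abs_integral_norm

theorem integral_eq_sub_of_ae_hasDerivAt [CompleteSpace E] {F F' : ℝ → E}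
    (hF : AbsolutelyContinuousOnInterval F a b) (hF' : IntervalIntegrable F' volume a b)
    (h : ∀ᵐ x, x ∈ uIcc a b → HasDerivAt F (F' x) x) :
    ∫ x in a..b, F' x = F b - F a := by
  have hac : AbsolutelyContinuousOnInterval (F - fun x => ∫ t in a..x, F' t) a b :=
    hF.sub (absolutelyContinuousOnInterval_integral hF' left_mem_uIcc)
  have hzero : ∀ᵐ x, x ∈ uIcc a b → HasDerivAt (F - fun x => ∫ t in a..x, F' t) 0 x := by
    filter_upwards [h, hF'.ae_hasDerivAt_integral] with x hx hx' hxI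
    simpa using (hx hxI).sub (hx' hxI a left_mem_uIcc)
  obtain ⟨C, hC⟩ := hac.const_of_ae_hasDerivAt_zero hzero
  have ha : F a = C := by simpa using hC a left_mem_uIcc
  have hb : F b - ∫ t in a..b, F' t = C := by simpa using hC b right_mem_uIcc
  rw [← ha] at hb
  rw [← hb]
  abel

end AbsolutelyContinuous

/-- `f` is a primitive on `[0, ∞)` of the square integrable function `g`. -/
structure HalfLinePrimitive {E : Type*} [NormedAddCommGroup E] [NormedSpace ℝ E]
    (f g : ℝ → E) : Prop where
  continuous : Continuous f
  memLp_deriv : MemLp g 2 (volume.restrict (Ioi 0))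
  eq_add_integral : ∀ x, 0 ≤ x → f x = f 0 + ∫ t in (0 : ℝ)..x, g t

/-- `f` is a continuous representative of an element of `H¹(0, ∞)` with derivative `g`. -/
structure HalfLineH1 {E : Type*} [NormedAddCommGroup E] [NormedSpace ℝ E]
    (f g : ℝ → E) : Prop extends HalfLinePrimitive f g where
  memLp : MemLp f 2 (volume.restrict (Ioi 0))

namespace HalfLinePrimitive

section

variable {E : Type*} [NormedAddCommGroup E] [NormedSpace ℝ E] {f g : ℝ → E} {X : ℝ}

theorem intervalIntegrable (h : HalfLinePrimitive f g) (hX : 0 ≤ X) :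
    IntervalIntegrable g volume 0 X := by
  rw [intervalIntegrable_iff_integrableOn_Ioc_of_le hX]
  exact (h.memLp_deriv.mono_measure (Measure.restrict_mono Ioc_subset_Ioi_self le_rfl)).integrable
    one_le_two

theorem absolutelyContinuous (h : HalfLinePrimitive f g) (hX : 0 ≤ X) :
    AbsolutelyContinuousOnInterval f 0 X := by
  refine absolutelyContinuousOnInterval_of_dist_le
    (absolutelyContinuousOnInterval_integral (h.intervalIntegrable hX) left_mem_uIcc)
    fun x hx y hy => ?_
  rw [uIcc_of_le hX] at hx hy
  rw [h.eq_add_integral x hx.1, h.eq_add_integral y hy.1, dist_add_left]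

theorem ae_hasDerivAt [CompleteSpace E] (h : HalfLinePrimitive f g) :
    ∀ᵐ x, 0 < x → HasDerivAt f (g x) x := by
  have hint : ∀ n : ℕ, ∀ᵐ x : ℝ, x ∈ uIcc (0 : ℝ) n → ∀ c ∈ uIcc (0 : ℝ) n,
      HasDerivAt (fun x => ∫ t in c..x, g t) (g x) x := fun n =>
    (h.intervalIntegrable n.cast_nonneg).ae_hasDerivAt_integral
  filter_upwards [ae_all_iff.2 hint] with x hx hx0
  obtain ⟨n, hn⟩ := exists_nat_gt x
  have hxn : x ∈ uIcc (0 : ℝ) n := by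
    rw [uIcc_of_le n.cast_nonneg]
    exact ⟨hx0.le, hn.le⟩
  refine ((hx n hxn 0 left_mem_uIcc).const_add (f 0)).congr_of_eventuallyEq ?_
  filter_upwards [lt_mem_nhds hx0] with y hy
  exact h.eq_add_integral y hy.le

theorem ae_hasDerivAt_of_mem_uIcc [CompleteSpace E] (h : HalfLinePrimitive f g) (hX : 0 ≤ X) :
    ∀ᵐ x, x ∈ uIcc 0 X → HasDerivAt f (g x) x := by
  filter_upwards [h.ae_hasDerivAt, Measure.ae_ne volume (0 : ℝ)] with x hx hx0 hxI
  rw [uIcc_of_le hX] at hxI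
  exact hx (hxI.1.lt_of_ne' hx0)

theorem integral_deriv_smul_add_smul [CompleteSpace E] (h : HalfLinePrimitive f g) {η : ℝ → ℝ}
    (hη : ContDiff ℝ 1 η) (hX : 0 ≤ X) :
    ∫ x in (0 : ℝ)..X, (deriv η x • f x + η x • g x) = η X • f X - η 0 • f 0 := by
  have hηd : ∀ x, HasDerivAt η (deriv η x) x := fun x =>
    (hη.differentiable one_ne_zero x).hasDerivAt
  have hηc : Continuous (deriv η) := hη.continuous_deriv le_rfl
  refine integral_eq_sub_of_ae_hasDerivAt (F := η • f)
    (hη.contDiffOn.absolutelyContinuousOnInterval.smul (h.absolutelyContinuous hX))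
    (((hηc.smul h.continuous).intervalIntegrable 0 X).add
      ((h.intervalIntegrable hX).continuousOn_smul hη.continuous.continuousOn)) ?_
  filter_upwards [h.ae_hasDerivAt_of_mem_uIcc hX] with x hx hxI
  simpa only [add_comm] using (hηd x).smul (hx hxI)

end

theorem isWeakDerivOn {f g : ℝ → ℂ} (h : HalfLinePrimitive f g) : IsWeakDerivOn (Ioi 0) f g := by
  intro η hη hc hs
  have hη1 : ContDiff ℝ 1 η := hη.of_le (by exact_mod_cast le_top)
  have hf : Integrable (fun x => deriv η x • f x) (volume.restrict (Ioi 0)) :=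
    (h.continuous.locallyIntegrable (μ := volume.restrict (Ioi (0 : ℝ)))
      ).integrable_smul_left_of_hasCompactSupport (hη1.continuous_deriv le_rfl) hc.deriv
  have hg : Integrable (fun x => η x • g x) (volume.restrict (Ioi 0)) :=
    (h.memLp_deriv.locallyIntegrable one_le_two).integrable_smul_left_of_hasCompactSupport
      hη.continuous hc
  have hη0 : η 0 = 0 := image_eq_zero_of_notMem_tsupport fun h0 => lt_irrefl (0 : ℝ) (hs h0)
  have hηX : ∀ᶠ X in atTop, η X = 0 :=
    (hasCompactSupport_iff_eventuallyEq.1 hc).filter_mono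
      (atTop_le_cocompact.trans (coclosedCompact_eq_cocompact (X := ℝ)).ge)
  have hlim : Tendsto (fun X => ∫ x in (0 : ℝ)..X, (deriv η x • f x + η x • g x)) atTop (𝓝 0) := by
    refine tendsto_const_nhds.congr' ?_
    filter_upwards [hηX, eventually_ge_atTop 0] with X hX hX0
    rw [h.integral_deriv_smul_add_smul hη1 hX0, hX, hη0, zero_smul, zero_smul, sub_zero]
  have hsum := tendsto_nhds_unique
    (intervalIntegral_tendsto_integral_Ioi 0 (hf.add hg) tendsto_id) hlim
  simp only [Pi.add_apply] at hsum
  rw [integral_add hf hg] at hsum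
  exact eq_neg_of_add_eq_zero_left hsum

end HalfLinePrimitive

section WeakDerivative

theorem exists_deriv_eq_of_integral_eq_zero {U : Set ℝ} (hU : U.OrdConnected) {w : ℝ → ℝ}
    (hw : ContDiff ℝ (⊤ : ℕ∞) w) (hc : HasCompactSupport w) (hs : tsupport w ⊆ U)
    (hw0 : ∫ x, w x = 0) :
    ∃ η : ℝ → ℝ, ContDiff ℝ (⊤ : ℕ∞) η ∧ HasCompactSupport η ∧ tsupport η ⊆ U ∧ deriv η = w := by
  rcases (tsupport w).eq_empty_or_nonempty with hemp | hne
  · rw [tsupport_eq_empty_iff] at hemp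
    refine ⟨0, contDiff_const, HasCompactSupport.zero, ?_, ?_⟩ <;> simp [hemp, tsupport]
  obtain ⟨a, ha⟩ := hc.isCompact.exists_isLeast hne
  obtain ⟨b, hb⟩ := hc.isCompact.exists_isGreatest hne
  have hout : ∀ x, x ∉ Icc a b → w x = 0 := fun x hx =>
    image_eq_zero_of_notMem_tsupport fun h => hx ⟨ha.2 h, hb.2 h⟩
  have hwi : Integrable w := hw.continuous.integrable_of_hasCompactSupport hc
  set η : ℝ → ℝ := fun x => ∫ t in Iic x, w t
  have hηa : η = fun x => η a + ∫ t in a..x, w t := funext fun x => by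
    rw [← intervalIntegral.integral_Iic_sub_Iic hwi.integrableOn hwi.integrableOn]
    exact (add_sub_cancel _ _).symm
  have hηd : ∀ x, HasDerivAt η (w x) x := fun x => by
    rw [hηa]
    exact (hw.continuous.integral_hasStrictDerivAt a x).hasDerivAt.const_add _
  have hηe : deriv η = w := funext fun x => (hηd x).deriv
  have hη0 : ∀ x ∉ Icc a b, η x = 0 := by
    intro x hx
    rcases lt_or_ge x a with hxa | hxa
    · exact setIntegral_eq_zero_of_forall_eq_zero fun t ht =>
        hout t fun h => (ht.trans_lt hxa).not_ge h.1
    · have hbx : b < x := not_le.1 fun h => hx ⟨hxa, h⟩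
      rw [← hw0]
      exact setIntegral_eq_integral_of_forall_compl_eq_zero fun t ht =>
        hout t fun h => ht (h.2.trans hbx.le)
  have hηt : tsupport η ⊆ Icc a b :=
    closure_minimal (fun x hx => by_contra fun h => hx (hη0 x h)) isClosed_Icc
  exact ⟨η, contDiff_infty_iff_deriv.2 ⟨fun x => (hηd x).differentiableAt, hηe ▸ hw⟩,
    isCompact_Icc.of_isClosed_subset (isClosed_tsupport η) hηt,
    hηt.trans (hU.out (hs ha.1) (hs hb.1)), hηe⟩

theorem exists_contDiff_integral_eq_one {U : Set ℝ} (hU : IsOpen U) (hne : U.Nonempty) :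
    ∃ θ : ℝ → ℝ, ContDiff ℝ (⊤ : ℕ∞) θ ∧ HasCompactSupport θ ∧ tsupport θ ⊆ U ∧
      ∫ x, θ x = 1 := by
  obtain ⟨p, hp⟩ := hne
  obtain ⟨ε, hε, hball⟩ := Metric.nhds_basis_closedBall.mem_iff.1 (hU.mem_nhds hp)
  let β : ContDiffBump p := ⟨ε / 2, ε, half_pos hε, half_lt_self hε⟩
  exact ⟨β.normed volume, β.contDiff_normed, β.hasCompactSupport_normed,
    β.tsupport_normed_eq.trans_subset hball, β.integral_normed⟩

variable {E : Type*} [NormedAddCommGroup E] [NormedSpace ℝ E]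

theorem integral_smul_eq_of_integral_deriv_smul_eq_zero {U : Set ℝ} (hU : U.OrdConnected)
    {h : ℝ → E} (hh : LocallyIntegrable h (volume.restrict U))
    (hz : ∀ η : ℝ → ℝ, ContDiff ℝ (⊤ : ℕ∞) η → HasCompactSupport η → tsupport η ⊆ U →
      ∫ x in U, deriv η x • h x = 0)
    {θ : ℝ → ℝ} (hθ : ContDiff ℝ (⊤ : ℕ∞) θ) (hθc : HasCompactSupport θ) (hθs : tsupport θ ⊆ U)
    (hθ1 : ∫ x, θ x = 1)
    {χ : ℝ → ℝ} (hχ : ContDiff ℝ (⊤ : ℕ∞) χ) (hχc : HasCompactSupport χ) (hχs : tsupport χ ⊆ U) :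
    ∫ x in U, χ x • h x = (∫ x, χ x) • ∫ x in U, θ x • h x := by
  have hIθ : ContDiff ℝ (⊤ : ℕ∞) fun x => (∫ x, χ x) * θ x := contDiff_const.mul hθ
  -- `χ - (∫ χ) θ` has integral zero, so it is the derivative of a test function.
  obtain ⟨η, hη, hηc, hηs, hηd⟩ := exists_deriv_eq_of_integral_eq_zero hU
    (w := χ - fun x => (∫ x, χ x) * θ x) (hχ.sub hIθ) (hχc.sub hθc.mul_left)
    ((tsupport_sub _ _).trans
      (union_subset hχs ((closure_mono (Function.support_mul_subset_right _ _)).trans hθs))) (by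
      simp only [Pi.sub_apply]
      rw [integral_sub (hχ.continuous.integrable_of_hasCompactSupport hχc)
        (hIθ.continuous.integrable_of_hasCompactSupport hθc.mul_left), integral_const_mul, hθ1,
        mul_one, sub_self])
  have hiχ : Integrable (fun x => χ x • h x) (volume.restrict U) :=
    hh.integrable_smul_left_of_hasCompactSupport hχ.continuous hχc
  have hiθ : Integrable (fun x => (∫ x, χ x) • θ x • h x) (volume.restrict U) :=
    (hh.integrable_smul_left_of_hasCompactSupport hθ.continuous hθc).smul _
  have h0 := hz η hη hηc hηs
  simp only [hηd, Pi.sub_apply, sub_smul, mul_smul] at h0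
  rw [integral_sub hiχ hiθ, integral_smul] at h0
  exact sub_eq_zero.1 h0

theorem ae_eq_const_of_integral_deriv_smul_eq_zero [CompleteSpace E] {U : Set ℝ} (hUo : IsOpen U)
    (hU : U.OrdConnected) {h : ℝ → E} (hh : LocallyIntegrable h (volume.restrict U))
    (hz : ∀ η : ℝ → ℝ, ContDiff ℝ (⊤ : ℕ∞) η → HasCompactSupport η → tsupport η ⊆ U →
      ∫ x in U, deriv η x • h x = 0) :
    ∃ c : E, h =ᵐ[volume.restrict U] fun _ => c := by
  rcases U.eq_empty_or_nonempty with rfl | hne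
  · exact ⟨0, by simp [Filter.EventuallyEq]⟩
  obtain ⟨θ, hθ, hθc, hθs, hθ1⟩ := exists_contDiff_integral_eq_one hUo hne
  set c : E := ∫ x in U, θ x • h x
  refine ⟨c, (ae_restrict_iff' hUo.measurableSet).2 ?_⟩
  have hloc : LocallyIntegrableOn (fun x => h x - c) U volume :=
    locallyIntegrableOn_of_locallyIntegrable_restrict (hh.sub (locallyIntegrable_const c))
  have hker : ∀ χ : ℝ → ℝ, ContDiff ℝ (⊤ : ℕ∞) χ → HasCompactSupport χ → tsupport χ ⊆ U →
      ∫ x, χ x • (h x - c) = 0 := by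
    intro χ hχ hχc hχs
    have hχ0 : ∀ x ∉ U, χ x = 0 := fun x hx =>
      image_eq_zero_of_notMem_tsupport fun h => hx (hχs h)
    have hχi : Integrable χ := hχ.continuous.integrable_of_hasCompactSupport hχc
    rw [← setIntegral_eq_integral_of_forall_compl_eq_zero (s := U)
      fun x hx => by rw [hχ0 x hx, zero_smul]]
    simp only [smul_sub]
    rw [integral_sub (hh.integrable_smul_left_of_hasCompactSupport hχ.continuous hχc)
      (hχi.smul_const c).integrableOn,
      integral_smul_eq_of_integral_deriv_smul_eq_zero hU hh hz hθ hθc hθs hθ1 hχ hχc hχs,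
      integral_smul_const, setIntegral_eq_integral_of_forall_compl_eq_zero hχ0, sub_self]
  filter_upwards [hUo.ae_eq_zero_of_integral_contDiff_smul_eq_zero hloc hker] with x hx hxU
    using sub_eq_zero.1 (hx hxU)

end WeakDerivative

section Representatives

theorem IsWeakDerivOn.congr {U : Set ℝ} {ψ φ g : ℝ → ℂ} (h : IsWeakDerivOn U ψ g)
    (he : ψ =ᵐ[volume.restrict U] φ) : IsWeakDerivOn U φ g := by
  intro η hη hc hs
  rw [← h η hη hc hs]
  exact integral_congr_ae (by filter_upwards [he] with x hx; rw [hx])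

theorem weakDeriv_spec {U : Set ℝ} {ψ : ℝ → ℂ} (h : MemH1 U ψ) :
    MemLp (weakDeriv U ψ) 2 (volume.restrict U) ∧ IsWeakDerivOn U ψ (weakDeriv U ψ) := by
  rw [weakDeriv, dif_pos h.2]
  exact h.2.choose_spec

theorem exists_halfLinePrimitive {E : Type*} [NormedAddCommGroup E] [NormedSpace ℝ E] {g : ℝ → E}
    (hg : MemLp g 2 (volume.restrict (Ioi 0))) : ∃ G, HalfLinePrimitive G g := by
  have hloc : LocallyIntegrable ((Ioi 0).indicator g) volume :=
    ((memLp_indicator_iff_restrict measurableSet_Ioi).2 hg).locallyIntegrable one_le_two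
  refine ⟨fun x => ∫ t in (0 : ℝ)..x, (Ioi 0).indicator g t,
    intervalIntegral.continuous_primitive (fun a b => ?_) 0, hg, fun x hx => ?_⟩
  · exact (hloc.integrableOn_isCompact isCompact_uIcc).intervalIntegrable
  · rw [intervalIntegral.integral_same, zero_add]
    refine intervalIntegral.integral_congr_ae (Eventually.of_forall fun t ht => ?_)
    rw [uIoc_of_le hx] at ht
    exact indicator_of_mem ht.1 g

theorem MemH1.exists_halfLineH1 {ψ : ℝ → ℂ} (hψ : MemH1 (Ioi 0) ψ) :
    ∃ f g, HalfLineH1 f g ∧ ψ =ᵐ[volume.restrict (Ioi 0)] f := by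
  obtain ⟨hψ2, g, hg, hw⟩ := hψ
  obtain ⟨G, hG⟩ := exists_halfLinePrimitive hg
  have hψl : LocallyIntegrable ψ (volume.restrict (Ioi 0)) := hψ2.locallyIntegrable one_le_two
  have hGl : LocallyIntegrable G (volume.restrict (Ioi 0)) := hG.continuous.locallyIntegrable
  obtain ⟨c, hc⟩ := ae_eq_const_of_integral_deriv_smul_eq_zero isOpen_Ioi ordConnected_Ioi
    (hψl.sub hGl) fun η hη hηc hηs => by
      have hη' : Continuous (deriv η) :=
        (hη.of_le (by exact_mod_cast le_top) : ContDiff ℝ 1 η).continuous_deriv le_rfl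
      simp only [Pi.sub_apply, smul_sub]
      rw [integral_sub (hψl.integrable_smul_left_of_hasCompactSupport hη' hηc.deriv)
        (hGl.integrable_smul_left_of_hasCompactSupport hη' hηc.deriv),
        hw η hη hηc hηs, hG.isWeakDerivOn η hη hηc hηs, sub_self]
  have he : ψ =ᵐ[volume.restrict (Ioi 0)] fun x => G x + c := by
    filter_upwards [hc] with x hx
    rw [← hx, Pi.sub_apply, add_sub_cancel]
  refine ⟨fun x => G x + c, g, ⟨⟨hG.continuous.add continuous_const, hg, fun x hx => ?_⟩,
    (memLp_congr_ae he).1 hψ2⟩, he⟩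
  rw [hG.eq_add_integral x hx]
  ring

theorem HalfLineH1.memH1 {ψ f g : ℝ → ℂ} (h : HalfLineH1 f g)
    (he : ψ =ᵐ[volume.restrict (Ioi 0)] f) : MemH1 (Ioi 0) ψ :=
  ⟨(memLp_congr_ae he).2 h.memLp, g, h.memLp_deriv, h.isWeakDerivOn.congr he.symm⟩

theorem HalfLineH1.weakDeriv_ae_eq {ψ f g : ℝ → ℂ} (h : HalfLineH1 f g)
    (he : ψ =ᵐ[volume.restrict (Ioi 0)] f) :
    weakDeriv (Ioi 0) ψ =ᵐ[volume.restrict (Ioi 0)] g :=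
  have ⟨hL2, hweak⟩ := weakDeriv_spec (h.memH1 he)
  IsWeakDerivOn.ae_eq isOpen_Ioi hL2 h.memLp_deriv hweak (h.isWeakDerivOn.congr he.symm)

end Representatives

section Reflection

theorem setIntegral_comp_neg {E : Type*} [NormedAddCommGroup E] [NormedSpace ℝ E]
    (U : Set ℝ) (F : ℝ → E) : ∫ x in -U, F (-x) = ∫ x in U, F x :=
  (Measure.measurePreserving_neg (volume : Measure ℝ)).setIntegral_preimage_emb
    (Homeomorph.neg ℝ).measurableEmbedding F U

theorem measurePreserving_neg_restrict (U : Set ℝ) :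
    MeasurePreserving (fun x : ℝ => -x) (volume.restrict (-U)) (volume.restrict U) :=
  (Measure.measurePreserving_neg (volume : Measure ℝ)).restrict_preimage_emb
    (Homeomorph.neg ℝ).measurableEmbedding U

theorem IsWeakDerivOn.comp_neg {U : Set ℝ} {ψ g : ℝ → ℂ} (h : IsWeakDerivOn U ψ g) :
    IsWeakDerivOn (-U) (fun x => ψ (-x)) (fun x => -g (-x)) := by
  intro η hη hηc hηs
  have hs : tsupport (fun x => η (-x)) = -tsupport η :=
    tsupport_comp_eq_preimage η (Homeomorph.neg ℝ)
  have h' := h (fun x => η (-x)) (hη.comp contDiff_neg)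
    (hηc.comp_homeomorph (Homeomorph.neg ℝ)) (hs.trans_subset (neg_subset.2 hηs))
  rw [← setIntegral_comp_neg U, ← setIntegral_comp_neg U] at h'
  simp only [deriv_comp_neg, neg_neg, neg_smul, integral_neg, smul_neg] at h' ⊢
  exact neg_inj.1 h'

theorem MemH1.comp_neg {U : Set ℝ} {ψ : ℝ → ℂ} (h : MemH1 U ψ) :
    MemH1 (-U) (fun x => ψ (-x)) := by
  obtain ⟨hψ, g, hg, hw⟩ := h
  exact ⟨hψ.comp_measurePreserving (measurePreserving_neg_restrict U), fun x => -g (-x),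
    (hg.comp_measurePreserving (measurePreserving_neg_restrict U)).neg, hw.comp_neg⟩

theorem neg_Iio_zero : -Iio (0 : ℝ) = Ioi 0 := by simp

theorem neg_Ioi_zero : -Ioi (0 : ℝ) = Iio 0 := by simp

theorem memH1_Iio_iff {ψ : ℝ → ℂ} :
    MemH1 (Iio 0) ψ ↔ MemH1 (Ioi 0) (fun x => ψ (-x)) := by
  constructor <;> intro h
  · simpa only [neg_Iio_zero] using h.comp_neg
  · simpa only [neg_Ioi_zero, neg_neg] using h.comp_neg

theorem integral_sq_weakDeriv_Iio {ψ : ℝ → ℂ} (h : MemH1 (Iio 0) ψ) :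
    ∫ x in Iio (0 : ℝ), ‖weakDeriv (Iio 0) ψ x‖ ^ 2 =
      ∫ x in Ioi (0 : ℝ), ‖weakDeriv (Ioi 0) (fun x => ψ (-x)) x‖ ^ 2 := by
  obtain ⟨hL2, hweak⟩ := weakDeriv_spec h
  obtain ⟨hL2', hweak'⟩ := weakDeriv_spec (memH1_Iio_iff.1 h)
  replace hL2 := hL2.comp_measurePreserving (measurePreserving_neg_restrict (Iio 0))
  replace hweak := hweak.comp_neg
  rw [neg_Iio_zero] at hL2 hweak
  rw [← setIntegral_comp_neg (Iio 0), neg_Iio_zero]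
  refine integral_congr_ae ?_
  filter_upwards [IsWeakDerivOn.ae_eq isOpen_Ioi hL2.neg hL2' hweak hweak'] with x hx
  rw [← hx, Pi.neg_apply, norm_neg, Function.comp_apply]

theorem ae_eq_Iio_of_comp_neg {ψ f : ℝ → ℂ}
    (he : (fun x => ψ (-x)) =ᵐ[volume.restrict (Ioi 0)] f) :
    ψ =ᵐ[volume.restrict (Iio 0)] fun x => f (-x) := by
  have h := (measurePreserving_neg_restrict (Ioi 0)).quasiMeasurePreserving.ae_eq_comp he
  rw [neg_Ioi_zero] at h
  simpa only [Function.comp_def, neg_neg] using h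

end Reflection

section BoundaryValues

theorem nhdsWithin_inf_ae_neBot {U : Set ℝ} (hU : IsOpen U) {a : ℝ} (ha : a ∈ closure U) :
    (𝓝[U] a ⊓ ae (volume : Measure ℝ)).NeBot := by
  refine inf_neBot_iff.2 fun {s} hs {t} ht => ?_
  obtain ⟨V, hV, haV, hVs⟩ := mem_nhdsWithin.1 hs
  have hpos : 0 < volume (V ∩ U) :=
    (hV.inter hU).measure_pos volume (mem_closure_iff.1 ha V hV haV)
  have hnull : volume (V ∩ U) = volume (V ∩ U ∩ t) := (measure_inter_conull ht).symm
  exact (nonempty_of_measure_ne_zero (hnull ▸ hpos).ne').mono (inter_subset_inter_left t hVs)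

theorem limUnder_nhdsWithin_inf_ae_eq {X : Type*} [TopologicalSpace X] [T2Space X] [Nonempty X]
    {U : Set ℝ} (hU : IsOpen U) {a : ℝ} (ha : a ∈ closure U) {ψ f : ℝ → X}
    (hf : ContinuousAt f a) (he : ψ =ᵐ[volume.restrict U] f) :
    limUnder (𝓝[U] a ⊓ ae volume) ψ = f a := by
  have := nhdsWithin_inf_ae_neBot hU ha
  have hlim : Tendsto f (𝓝[U] a ⊓ ae volume) (𝓝 (f a)) :=
    hf.mono_left (inf_le_left.trans nhdsWithin_le_nhds)
  refine (hlim.congr' ?_).limUnder_eq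
  rw [Filter.EventuallyEq, ae_restrict_iff' hU.measurableSet] at he
  filter_upwards [mem_inf_of_right he, mem_inf_of_left self_mem_nhdsWithin] with x hx hxU
  exact (hx hxU).symm

theorem rightValue_eq {ψ f : ℝ → ℂ} (hf : Continuous f)
    (he : ψ =ᵐ[volume.restrict (Ioi 0)] f) : rightValue ψ = f 0 :=
  limUnder_nhdsWithin_inf_ae_eq isOpen_Ioi (by simp) hf.continuousAt he

theorem leftValue_eq {ψ f : ℝ → ℂ} (hf : Continuous f)
    (he : (fun x => ψ (-x)) =ᵐ[volume.restrict (Ioi 0)] f) : leftValue ψ = f 0 := by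
  have hlim := limUnder_nhdsWithin_inf_ae_eq (a := 0) isOpen_Iio (by simp)
    (hf.comp continuous_neg).continuousAt (ae_eq_Iio_of_comp_neg he)
  rwa [Function.comp_apply, neg_zero] at hlim

end BoundaryValues

section Trace

variable {E : Type*} [NormedAddCommGroup E] [InnerProductSpace ℝ E] {f g : ℝ → E} {X Y : ℝ}

theorem integrable_inner_of_memLp_two {α : Type*} [MeasurableSpace α] {ν : Measure α}
    {u v : α → E} (hu : MemLp u 2 ν) (hv : MemLp v 2 ν) :
    Integrable (fun x => inner ℝ (u x) (v x)) ν :=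
  (hu.norm.integrable_mul hv.norm).mono' (hu.1.inner hv.1)
    (Eventually.of_forall fun x => norm_inner_le_norm (u x) (v x))

theorem HalfLinePrimitive.absolutelyContinuous_norm_sq (h : HalfLinePrimitive f g) (hX : 0 ≤ X) :
    AbsolutelyContinuousOnInterval (fun x => ‖f x‖ ^ 2) 0 X := by
  have hn := absolutelyContinuousOnInterval_norm (h.absolutelyContinuous hX)
  simpa only [sq] using hn.fun_mul hn

theorem HalfLinePrimitive.integrableOn_sq_deriv (h : HalfLinePrimitive f g) :
    IntegrableOn (fun x => ‖g x‖ ^ 2) (Ioi 0) :=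
  h.memLp_deriv.integrable_norm_pow two_ne_zero

theorem HalfLineH1.integrableOn_sq (h : HalfLineH1 f g) :
    IntegrableOn (fun x => ‖f x‖ ^ 2) (Ioi 0) :=
  h.memLp.integrable_norm_pow two_ne_zero

theorem HalfLineH1.integrableOn_inner (h : HalfLineH1 f g) :
    IntegrableOn (fun x => 2 * inner ℝ (f x) (g x)) (Ioi 0) :=
  (integrable_inner_of_memLp_two h.memLp h.memLp_deriv).const_mul 2

variable [CompleteSpace E]

theorem HalfLineH1.integral_inner (h : HalfLineH1 f g) (hX : 0 ≤ X) :
    ∫ x in (0 : ℝ)..X, 2 * inner ℝ (f x) (g x) = ‖f X‖ ^ 2 - ‖f 0‖ ^ 2 := by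
  refine integral_eq_sub_of_ae_hasDerivAt (h.absolutelyContinuous_norm_sq hX) ?_ ?_
  · rw [intervalIntegrable_iff_integrableOn_Ioc_of_le hX]
    exact h.integrableOn_inner.mono_set Ioc_subset_Ioi_self
  · filter_upwards [h.ae_hasDerivAt_of_mem_uIcc hX] with x hx hxI using (hx hxI).norm_sq

theorem HalfLineH1.tendsto_norm_sq (h : HalfLineH1 f g) :
    Tendsto (fun x => ‖f x‖ ^ 2) atTop (𝓝 0) := by
  have hlim : Tendsto (fun x => ‖f x‖ ^ 2) atTop
      (𝓝 (‖f 0‖ ^ 2 + ∫ x in Ioi 0, 2 * inner ℝ (f x) (g x))) := by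
    refine ((intervalIntegral_tendsto_integral_Ioi 0 h.integrableOn_inner
      tendsto_id).const_add _).congr' ?_
    filter_upwards [eventually_ge_atTop 0] with X hX
    rw [id, h.integral_inner hX, add_sub_cancel]
  have hint : IntegrableAtFilter (fun x => ‖f x‖ ^ 2) atTop :=
    ⟨Ioi 0, Ioi_mem_atTop 0, h.integrableOn_sq⟩
  rwa [hint.eq_zero_of_tendsto (fun s hs => ?_) hlim] at hlim
  obtain ⟨a, ha⟩ := mem_atTop_sets.1 hs
  exact measure_mono_top (fun x hx => ha x (le_of_lt hx)) (Real.volume_Ioi (a := a))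

theorem HalfLineH1.integral_Ioi_inner (h : HalfLineH1 f g) (hX : 0 ≤ X) :
    ∫ x in Ioi X, 2 * inner ℝ (f x) (g x) = -‖f X‖ ^ 2 := by
  have hlim : Tendsto (fun Y => ∫ x in (0 : ℝ)..Y, 2 * inner ℝ (f x) (g x)) atTop
      (𝓝 (0 - ‖f 0‖ ^ 2)) := by
    refine (h.tendsto_norm_sq.sub_const _).congr' ?_
    filter_upwards [eventually_ge_atTop 0] with Y hY using (h.integral_inner hY).symm
  have hzero := tendsto_nhds_unique
    (intervalIntegral_tendsto_integral_Ioi 0 h.integrableOn_inner tendsto_id) hlim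
  have hsub := intervalIntegral.integral_Ioi_sub_Ioi h.integrableOn_inner hX
  rw [h.integral_inner hX, hzero] at hsub
  linarith

theorem HalfLineH1.mul_norm_sq_le (h : HalfLineH1 f g) (k : ℝ) (hX : 0 ≤ X) :
    k * ‖f X‖ ^ 2 ≤ ∫ x in Ioi X, (‖g x‖ ^ 2 + k ^ 2 * ‖f x‖ ^ 2) := by
  have hI : IntegrableOn (fun x => 2 * inner ℝ (f x) (g x)) (Ioi X) :=
    h.integrableOn_inner.mono_set (Ioi_subset_Ioi hX)
  have hJ : IntegrableOn (fun x => ‖g x‖ ^ 2 + k ^ 2 * ‖f x‖ ^ 2) (Ioi X) :=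
    (h.integrableOn_sq_deriv.add (h.integrableOn_sq.const_mul _)).mono_set (Ioi_subset_Ioi hX)
  have hle : ∫ x in Ioi X, -k * (2 * inner ℝ (f x) (g x)) ≤
      ∫ x in Ioi X, (‖g x‖ ^ 2 + k ^ 2 * ‖f x‖ ^ 2) := by
    refine integral_mono (hI.const_mul _) hJ fun x => ?_
    have hsq := sq_nonneg ‖g x + k • f x‖
    rw [norm_add_sq_real, inner_smul_right, norm_smul, mul_pow, Real.norm_eq_abs, sq_abs,
      real_inner_comm] at hsq
    dsimp only
    linarith
  rwa [integral_const_mul, h.integral_Ioi_inner hX, neg_mul_neg] at hle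

theorem HalfLineH1.integrableOn_rpow (h : HalfLineH1 f g) {q : ℝ} (hq : 2 ≤ q) :
    IntegrableOn (fun x => ‖f x‖ ^ q) (Ioi 0) := by
  set C := ∫ x in Ioi (0 : ℝ), (‖g x‖ ^ 2 + 1 ^ 2 * ‖f x‖ ^ 2)
  have hC : ∀ x ∈ Ioi (0 : ℝ), ‖f x‖ ^ 2 ≤ C := fun x hx => by
    rw [← one_mul (‖f x‖ ^ 2)]
    exact (h.mul_norm_sq_le 1 (le_of_lt hx)).trans <|
      setIntegral_mono_set (h.integrableOn_sq_deriv.add (h.integrableOn_sq.const_mul _))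
        (Eventually.of_forall fun y => by positivity) (Ioi_subset_Ioi (le_of_lt hx)).eventuallyLE
  have hm : AEStronglyMeasurable (fun x => ‖f x‖ ^ q) (volume.restrict (Ioi 0)) :=
    (h.continuous.norm.rpow_const fun x => Or.inr (by linarith)).aestronglyMeasurable
  refine (h.integrableOn_sq.const_mul (C ^ (q / 2 - 1))).mono' hm ?_
  filter_upwards [ae_restrict_mem measurableSet_Ioi] with x hx
  rw [Real.norm_of_nonneg (by positivity)]
  calc ‖f x‖ ^ q = (‖f x‖ ^ 2) ^ (q / 2 - 1) * ‖f x‖ ^ 2 := by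
        rw [← Real.rpow_natCast, ← Real.rpow_mul (norm_nonneg _),
          ← Real.rpow_add_of_nonneg (norm_nonneg _) (by push_cast; linarith) (by norm_num)]
        congr 1
        push_cast
        ring
    _ ≤ C ^ (q / 2 - 1) * ‖f x‖ ^ 2 := by
        gcongr
        · linarith
        · exact hC x hx

end Trace

/-- `ψ` is represented on `(0, ∞)` by `f₁` and, after reflection, on `(-∞, 0)` by `f₂`, with
derivatives `g₁` and `g₂`. -/
structure EnergyRep (ψ f₁ g₁ f₂ g₂ : ℝ → ℂ) : Prop where
  right : HalfLineH1 f₁ g₁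
  left : HalfLineH1 f₂ g₂
  right_ae : ψ =ᵐ[volume.restrict (Ioi 0)] f₁
  left_ae : (fun x => ψ (-x)) =ᵐ[volume.restrict (Ioi 0)] f₂

theorem exists_energyRep {ψ : ℝ → ℂ} (h : ψ ∈ energySpace) :
    ∃ f₁ g₁ f₂ g₂, EnergyRep ψ f₁ g₁ f₂ g₂ := by
  obtain ⟨f₁, g₁, h₁, he₁⟩ := h.1.exists_halfLineH1
  obtain ⟨f₂, g₂, h₂, he₂⟩ := (memH1_Iio_iff.1 h.2).exists_halfLineH1
  exact ⟨f₁, g₁, f₂, g₂, h₁, h₂, he₁, he₂⟩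

namespace EnergyRep

variable {ψ f₁ g₁ f₂ g₂ : ℝ → ℂ}

theorem mem_energySpace (h : EnergyRep ψ f₁ g₁ f₂ g₂) : ψ ∈ energySpace :=
  ⟨h.right.memH1 h.right_ae, memH1_Iio_iff.2 (h.left.memH1 h.left_ae)⟩

theorem derivNormSq_eq (h : EnergyRep ψ f₁ g₁ f₂ g₂) :
    derivNormSq ψ = (∫ x in Ioi (0 : ℝ), ‖g₁ x‖ ^ 2) + ∫ x in Ioi (0 : ℝ), ‖g₂ x‖ ^ 2 := by
  rw [derivNormSq, integral_sq_weakDeriv_Iio h.mem_energySpace.2]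
  congr 1 <;> refine integral_congr_ae ?_
  · filter_upwards [h.right.weakDeriv_ae_eq h.right_ae] with x hx
    rw [hx]
  · filter_upwards [h.left.weakDeriv_ae_eq h.left_ae] with x hx
    rw [hx]

theorem comp_ae_eq_Iio {β : Type*} (h : EnergyRep ψ f₁ g₁ f₂ g₂) (Φ : ℂ → β) :
    (fun x => Φ (ψ x)) =ᵐ[volume.restrict (Iio 0)] fun x => Φ (f₂ (-x)) :=
  (ae_eq_Iio_of_comp_neg h.left_ae).fun_comp Φ

theorem integrable_comp (h : EnergyRep ψ f₁ g₁ f₂ g₂) (Φ : ℂ → ℝ)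
    (hΦ₁ : IntegrableOn (fun x => Φ (f₁ x)) (Ioi 0))
    (hΦ₂ : IntegrableOn (fun x => Φ (f₂ x)) (Ioi 0)) : Integrable fun x => Φ (ψ x) := by
  have hi₁ : IntegrableOn (fun x => Φ (ψ x)) (Ioi 0) := hΦ₁.congr (h.right_ae.fun_comp Φ).symm
  have hi₂ : IntegrableOn (fun x => Φ (ψ x)) (Iio 0) := by
    have := (measurePreserving_neg_restrict (Ioi 0)).integrable_comp_of_integrable hΦ₂
    rw [neg_Ioi_zero] at this
    exact this.congr (h.comp_ae_eq_Iio Φ).symm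
  rw [← integrableOn_univ, ← Iic_union_Ioi (a := 0)]
  exact ((integrableOn_Iic_iff_integrableOn_Iio (by simp)).2 hi₂).union hi₁

theorem integral_comp_eq (h : EnergyRep ψ f₁ g₁ f₂ g₂) (Φ : ℂ → ℝ)
    (hΦ₁ : IntegrableOn (fun x => Φ (f₁ x)) (Ioi 0))
    (hΦ₂ : IntegrableOn (fun x => Φ (f₂ x)) (Ioi 0)) :
    ∫ x, Φ (ψ x) = (∫ x in Ioi (0 : ℝ), Φ (f₁ x)) + ∫ x in Ioi (0 : ℝ), Φ (f₂ x) := by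
  have hi := h.integrable_comp Φ hΦ₁ hΦ₂
  have he : (fun x => Φ (ψ x)) =ᵐ[volume.restrict (Ioi 0)] fun x => Φ (f₁ x) :=
    h.right_ae.fun_comp Φ
  rw [← intervalIntegral.integral_Iic_add_Ioi (b := 0) hi.integrableOn hi.integrableOn,
    integral_Iic_eq_integral_Iio, integral_congr_ae he,
    integral_congr_ae (h.comp_ae_eq_Iio Φ), ← neg_Ioi_zero,
    setIntegral_comp_neg (Ioi 0) fun x => Φ (f₂ x), add_comm]

theorem mass_eq (h : EnergyRep ψ f₁ g₁ f₂ g₂) :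
    mass ψ = (∫ x in Ioi (0 : ℝ), ‖f₁ x‖ ^ 2) + ∫ x in Ioi (0 : ℝ), ‖f₂ x‖ ^ 2 :=
  h.integral_comp_eq (fun z => ‖z‖ ^ 2) h.right.integrableOn_sq h.left.integrableOn_sq

theorem powerNorm_eq (h : EnergyRep ψ f₁ g₁ f₂ g₂) {μ : ℝ} (hμ : 0 ≤ μ) :
    powerNorm μ ψ = (∫ x in Ioi (0 : ℝ), ‖f₁ x‖ ^ (2 * μ + 2)) +
      ∫ x in Ioi (0 : ℝ), ‖f₂ x‖ ^ (2 * μ + 2) :=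
  h.integral_comp_eq (fun z => ‖z‖ ^ (2 * μ + 2)) (h.right.integrableOn_rpow (by linarith))
    (h.left.integrableOn_rpow (by linarith))

theorem powerNorm_eq_zero_iff (h : EnergyRep ψ f₁ g₁ f₂ g₂) {μ : ℝ} (hμ : 0 ≤ μ) :
    powerNorm μ ψ = 0 ↔ ψ =ᵐ[volume] 0 := by
  have hi := h.integrable_comp (fun z => ‖z‖ ^ (2 * μ + 2))
    (h.right.integrableOn_rpow (by linarith)) (h.left.integrableOn_rpow (by linarith))
  rw [powerNorm, integral_eq_zero_iff_of_nonneg (fun x => by positivity) hi]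
  refine eventually_congr (Eventually.of_forall fun x => ?_)
  simp only [Pi.zero_apply]
  rw [Real.rpow_eq_zero (norm_nonneg _) (by positivity), norm_eq_zero]

theorem nehari_eq (h : EnergyRep ψ f₁ g₁ f₂ g₂) (γ lam μ : ℝ) {ω : ℝ} (hω : 0 ≤ ω) :
    nehari γ lam μ ω ψ =
      (∫ x in Ioi (0 : ℝ), (‖g₁ x‖ ^ 2 + √ω ^ 2 * ‖f₁ x‖ ^ 2)) +
        (∫ x in Ioi (0 : ℝ), (‖g₂ x‖ ^ 2 + √ω ^ 2 * ‖f₂ x‖ ^ 2)) -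
      γ⁻¹ * ‖f₁ 0 - f₂ 0‖ ^ 2 - lam * powerNorm μ ψ := by
  have hsplit {f g : ℝ → ℂ} (h : HalfLineH1 f g) :
      ∫ x in Ioi (0 : ℝ), (‖g x‖ ^ 2 + √ω ^ 2 * ‖f x‖ ^ 2) =
        (∫ x in Ioi (0 : ℝ), ‖g x‖ ^ 2) + ω * ∫ x in Ioi (0 : ℝ), ‖f x‖ ^ 2 := by
    rw [integral_add h.integrableOn_sq_deriv (h.integrableOn_sq.const_mul _), integral_const_mul,
      Real.sq_sqrt hω]
  rw [nehari, formF, h.derivNormSq_eq, h.mass_eq, rightValue_eq h.right.continuous h.right_ae,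
    leftValue_eq h.left.continuous h.left_ae, hsplit h.right, hsplit h.left]
  ring

end EnergyRep

theorem action_eq_of_nehari_eq_zero {γ lam μ ω : ℝ} (hμ : 0 < μ) {ψ : ℝ → ℂ}
    (h : nehari γ lam μ ω ψ = 0) :
    action γ lam μ ω ψ = lam * μ / (2 * μ + 2) * powerNorm μ ψ := by
  have hF : formF γ ψ = lam * powerNorm μ ψ - ω * mass ψ := by
    rw [nehari] at h
    linarith
  rw [action, energy, hF]
  field_simp
  ring

section TailMass

/-- Density of the power norm of a soliton tail with respect to the logarithmic slope `σ`. -/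
def tailDensity (B k μ σ : ℝ) : ℝ := B / (μ * k) * (B * (1 - σ ^ 2)) ^ (1 / μ)

/-- The power norm of the soliton tail on a half-line, as a function of the (normalized) logarithmic
slope `s` at the end point. -/
def tailMass (B k μ s : ℝ) : ℝ := ∫ σ in s..1, tailDensity B k μ σ

/-- The inverse of `tailMass` on `[-1, 1]`: the logarithmic slope of the soliton tail with power
norm `v`. -/
def tailMassInv (B k μ v : ℝ) : ℝ := Function.invFunOn (tailMass B k μ) (Icc (-1) 1) v

variable {B k μ s : ℝ}

theorem one_sub_sq_pos (hs : s ∈ Ioo (-1 : ℝ) 1) : 0 < 1 - s ^ 2 :=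
  sub_pos.2 ((sq_lt_one_iff_abs_lt_one s).2 (abs_lt.2 hs))

theorem continuous_tailDensity (hμ : 0 < μ) : Continuous (tailDensity B k μ) :=
  have : 0 ≤ 1 / μ := by positivity
  continuous_const.mul (Continuous.rpow_const (by fun_prop) fun _ => Or.inr this)

theorem tailDensity_pos (hB : 0 < B) (hk : 0 < k) (hμ : 0 < μ) (hs : s ∈ Ioo (-1 : ℝ) 1) :
    0 < tailDensity B k μ s := by
  have := one_sub_sq_pos hs
  unfold tailDensity
  positivity

theorem hasStrictDerivAt_tailMass (hμ : 0 < μ) (s : ℝ) :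
    HasStrictDerivAt (tailMass B k μ) (-tailDensity B k μ s) s :=
  intervalIntegral.integral_hasStrictDerivAt_left
    ((continuous_tailDensity hμ).intervalIntegrable _ _)
    ((continuous_tailDensity hμ).stronglyMeasurableAtFilter _ _)
    (continuous_tailDensity hμ).continuousAt

theorem continuous_tailMass (hμ : 0 < μ) : Continuous (tailMass B k μ) :=
  continuous_iff_continuousAt.2 fun s => (hasStrictDerivAt_tailMass hμ s).hasDerivAt.continuousAt

theorem tailMass_one : tailMass B k μ 1 = 0 := intervalIntegral.integral_same

theorem strictAntiOn_tailMass (hB : 0 < B) (hk : 0 < k) (hμ : 0 < μ) :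
    StrictAntiOn (tailMass B k μ) (Icc (-1) 1) := by
  refine strictAntiOn_of_deriv_neg (convex_Icc _ _) (continuous_tailMass hμ).continuousOn ?_
  intro s hs
  rw [interior_Icc] at hs
  rw [(hasStrictDerivAt_tailMass hμ s).hasDerivAt.deriv, neg_lt_zero]
  exact tailDensity_pos hB hk hμ hs

theorem tailMass_pos (hB : 0 < B) (hk : 0 < k) (hμ : 0 < μ) (hs : s ∈ Ico (-1 : ℝ) 1) :
    0 < tailMass B k μ s := by
  rw [← tailMass_one (B := B) (k := k) (μ := μ)]
  exact strictAntiOn_tailMass hB hk hμ (Ico_subset_Icc_self hs) (by norm_num) hs.2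

theorem tailMassInv_tailMass (hB : 0 < B) (hk : 0 < k) (hμ : 0 < μ) (hs : s ∈ Icc (-1 : ℝ) 1) :
    tailMassInv B k μ (tailMass B k μ s) = s :=
  (strictAntiOn_tailMass hB hk hμ).injOn.leftInvOn_invFunOn hs

theorem hasDerivAt_tailMassInv (hB : 0 < B) (hk : 0 < k) (hμ : 0 < μ)
    (hs : s ∈ Ioo (-1 : ℝ) 1) :
    HasDerivAt (tailMassInv B k μ) (-tailDensity B k μ s)⁻¹ (tailMass B k μ s) := by
  refine HasStrictDerivAt.hasDerivAt ((hasStrictDerivAt_tailMass hμ s).to_local_left_inverse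
    (neg_ne_zero.2 (tailDensity_pos hB hk hμ hs).ne') ?_)
  filter_upwards [Ioo_mem_nhds hs.1 hs.2] with x hx
  exact tailMassInv_tailMass hB hk hμ (Ioo_subset_Icc_self hx)

/-- The soliton amplitude at logarithmic slope `s`, raised to the power `2 μ`. -/
def ampPow (B s : ℝ) : ℝ := B * (1 - s ^ 2)

theorem ampPow_pos (hB : 0 < B) (hs : s ∈ Ioo (-1 : ℝ) 1) : 0 < ampPow B s :=
  mul_pos hB (one_sub_sq_pos hs)

end TailMass

section PowerGap

/-- The gap in the weighted Young inequality
`(μ + 1) r ^ (2 μ) ≤ b + μ r ^ (2 μ + 2) / b ^ (1 / μ)`. -/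
def powerGap (μ b r : ℝ) : ℝ := b + μ * r ^ (2 * μ + 2) / b ^ (1 / μ) - (μ + 1) * r ^ (2 * μ)

variable {μ b r : ℝ}

theorem powerGap_eq (hμ : 0 < μ) (hb : 0 < b) (hr : 0 ≤ r) :
    powerGap μ b r =
      b * (1 + μ * (r ^ (2 * μ) / b) ^ (1 + 1 / μ) - (μ + 1) * (r ^ (2 * μ) / b)) := by
  have hpow : (r ^ (2 * μ)) ^ (1 + 1 / μ) = r ^ (2 * μ + 2) := by
    rw [← Real.rpow_mul hr]
    congr 1
    field_simp
  rw [powerGap, Real.div_rpow (by positivity) hb.le, hpow,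
    Real.rpow_add hb, Real.rpow_one]
  field_simp

theorem powerGap_pos (hμ : 0 < μ) (hb : 0 < b) (hr : 0 ≤ r) (hne : r ^ (2 * μ) ≠ b) :
    0 < powerGap μ b r := by
  rw [powerGap_eq hμ hb hr]
  set w := r ^ (2 * μ) / b
  have hw : 0 ≤ w := by positivity
  have hw1 : w - 1 ≠ 0 := sub_ne_zero.2 fun h => hne ((div_eq_one_iff_eq hb.ne').1 h)
  have hbern := one_add_mul_self_lt_rpow_one_add (by linarith : -1 ≤ w - 1) hw1
    (by linarith [one_div_pos.2 hμ] : 1 < 1 + 1 / μ)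
  rw [add_sub_cancel] at hbern
  have hmul := mul_lt_mul_of_pos_left hbern hμ
  have hid : μ * (1 + (1 + 1 / μ) * (w - 1)) = (μ + 1) * w - 1 := by
    field_simp
    ring
  exact mul_pos hb (by linarith)

theorem powerGap_nonneg (hμ : 0 < μ) (hb : 0 < b) (hr : 0 ≤ r) : 0 ≤ powerGap μ b r := by
  rcases eq_or_ne (r ^ (2 * μ)) b with he | hne
  · rw [powerGap_eq hμ hb hr, he, div_self hb.ne', Real.one_rpow]
    exact mul_nonneg hb.le (by linarith)
  · exact (powerGap_pos hμ hb hr hne).le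

end PowerGap

section RemMass

variable {E : Type*} [NormedAddCommGroup E] {f : ℝ → E} {μ : ℝ}

/-- The part of the power norm of `f` on `(0, ∞)` that lies beyond `x`. -/
def remMass (μ : ℝ) (f : ℝ → E) (x : ℝ) : ℝ :=
  (∫ y in Ioi (0 : ℝ), ‖f y‖ ^ (2 * μ + 2)) - ∫ y in (0 : ℝ)..x, ‖f y‖ ^ (2 * μ + 2)

theorem continuous_norm_rpow (hf : Continuous f) {q : ℝ} (hq : 0 ≤ q) :
    Continuous fun x => ‖f x‖ ^ q :=
  hf.norm.rpow_const fun _ => Or.inr hq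

theorem hasDerivAt_remMass (hf : Continuous f) (hμ : 0 < μ) (x : ℝ) :
    HasDerivAt (remMass μ f) (-‖f x‖ ^ (2 * μ + 2)) x :=
  have hc : Continuous fun x => ‖f x‖ ^ (2 * μ + 2) := continuous_norm_rpow hf (by linarith)
  (intervalIntegral.integral_hasDerivAt_right (hc.intervalIntegrable _ _)
    (hc.stronglyMeasurableAtFilter _ _) hc.continuousAt).const_sub _

theorem continuous_remMass (hf : Continuous f) (hμ : 0 < μ) : Continuous (remMass μ f) :=
  continuous_iff_continuousAt.2 fun x => (hasDerivAt_remMass hf hμ x).continuousAt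

theorem antitone_remMass (hf : Continuous f) (hμ : 0 < μ) : Antitone (remMass μ f) :=
  antitone_of_hasDerivAt_nonpos (hasDerivAt_remMass hf hμ) fun _ =>
    neg_nonpos.2 (Real.rpow_nonneg (norm_nonneg _) _)

theorem remMass_zero : remMass μ f 0 = ∫ y in Ioi (0 : ℝ), ‖f y‖ ^ (2 * μ + 2) := by
  rw [remMass, intervalIntegral.integral_same, sub_zero]

theorem exists_remMass_eq (hf : Continuous f) (hμ : 0 < μ)
    (hint : IntegrableOn (fun x => ‖f x‖ ^ (2 * μ + 2)) (Ioi 0)) {X ε : ℝ} (hε : 0 < ε)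
    (hεX : ε ≤ remMass μ f X) : ∃ Y, X ≤ Y ∧ remMass μ f Y = ε := by
  have hlim : Tendsto (remMass μ f) atTop (𝓝 0) := by
    rw [← sub_self (∫ y in Ioi (0 : ℝ), ‖f y‖ ^ (2 * μ + 2))]
    exact (intervalIntegral_tendsto_integral_Ioi 0 hint tendsto_id).const_sub _
  obtain ⟨Z, hZ, hXZ⟩ := ((hlim.eventually (gt_mem_nhds hε)).and (eventually_ge_atTop X)).exists
  obtain ⟨Y, hY, hYε⟩ := intermediate_value_Icc' hXZ (continuous_remMass hf hμ).continuousOn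
    ⟨hZ.le, hεX⟩
  exact ⟨Y, hY.1, hYε⟩

end RemMass

section TailSlope

variable {E : Type*} [NormedAddCommGroup E] {f : ℝ → E} {B k μ t x : ℝ}

/-- The logarithmic slope of the soliton tail whose power norm equals the part of the power norm
of `f` lying beyond `x`. -/
def tailSlope (B k μ : ℝ) (f : ℝ → E) (x : ℝ) : ℝ := tailMassInv B k μ (remMass μ f x)

theorem tailSlope_spec (hB : 0 < B) (hk : 0 < k) (hμ : 0 < μ) (hf : Continuous f)
    (ht : t ∈ Ioo (-1 : ℝ) 1) (hm : remMass μ f 0 = tailMass B k μ t) (hx : 0 ≤ x)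
    (hpos : 0 < remMass μ f x) :
    tailSlope B k μ f x ∈ Ioo (-1 : ℝ) 1 ∧
      tailMass B k μ (tailSlope B k μ f x) = remMass μ f x := by
  have hle : remMass μ f x ≤ tailMass B k μ t := hm ▸ antitone_remMass hf hμ hx
  obtain ⟨s, hs, hsx⟩ := intermediate_value_Icc' ht.2.le
    (continuous_tailMass (B := B) (k := k) hμ).continuousOn ⟨tailMass_one.trans_le hpos.le, hle⟩
  have hs1 : s ≠ 1 := by
    rintro rfl
    exact hpos.ne' (hsx ▸ tailMass_one)
  have heq : tailSlope B k μ f x = s := by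
    rw [tailSlope, ← hsx]
    exact tailMassInv_tailMass hB hk hμ ⟨ht.1.le.trans hs.1, hs.2⟩
  rw [heq]
  exact ⟨⟨ht.1.trans_le hs.1, hs.2.lt_of_ne hs1⟩, hsx⟩

theorem Icc_subset_remMass_pos (hμ : 0 < μ) (hf : Continuous f) {X : ℝ}
    (hpos : 0 < remMass μ f X) : Icc 0 X ⊆ {x | 0 ≤ x ∧ 0 < remMass μ f x} := fun _ hx =>
  ⟨hx.1, hpos.trans_le (antitone_remMass hf hμ hx.2)⟩

theorem tailSlope_zero (hB : 0 < B) (hk : 0 < k) (hμ : 0 < μ) (ht : t ∈ Ioo (-1 : ℝ) 1)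
    (hm : remMass μ f 0 = tailMass B k μ t) : tailSlope B k μ f 0 = t := by
  rw [tailSlope, hm, tailMassInv_tailMass hB hk hμ (Ioo_subset_Icc_self ht)]

theorem hasDerivAt_tailSlope (hB : 0 < B) (hk : 0 < k) (hμ : 0 < μ) (hf : Continuous f)
    (ht : t ∈ Ioo (-1 : ℝ) 1) (hm : remMass μ f 0 = tailMass B k μ t) (hx : 0 ≤ x)
    (hpos : 0 < remMass μ f x) :
    HasDerivAt (tailSlope B k μ f)
      (‖f x‖ ^ (2 * μ + 2) / tailDensity B k μ (tailSlope B k μ f x)) x := by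
  obtain ⟨hs, hsx⟩ := tailSlope_spec hB hk hμ hf ht hm hx hpos
  have hinv := hasDerivAt_tailMassInv hB hk hμ hs
  rw [hsx] at hinv
  convert! hinv.comp x (hasDerivAt_remMass hf hμ x) using 1
  rw [inv_neg, neg_mul_neg, div_eq_mul_inv, mul_comm]

theorem continuousOn_tailSlope (hB : 0 < B) (hk : 0 < k) (hμ : 0 < μ) (hf : Continuous f)
    (ht : t ∈ Ioo (-1 : ℝ) 1) (hm : remMass μ f 0 = tailMass B k μ t) :
    ContinuousOn (tailSlope B k μ f) {x | 0 ≤ x ∧ 0 < remMass μ f x} := fun _ hx =>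
  (hasDerivAt_tailSlope hB hk hμ hf ht hm hx.1 hx.2).continuousAt.continuousWithinAt

theorem continuousOn_rpow_div_tailDensity (hB : 0 < B) (hk : 0 < k) (hμ : 0 < μ)
    (hf : Continuous f) (ht : t ∈ Ioo (-1 : ℝ) 1) (hm : remMass μ f 0 = tailMass B k μ t) :
    ContinuousOn (fun x => ‖f x‖ ^ (2 * μ + 2) / tailDensity B k μ (tailSlope B k μ f x))
      {x | 0 ≤ x ∧ 0 < remMass μ f x} := by
  refine (continuous_norm_rpow hf (by linarith)).continuousOn.div
    ((continuous_tailDensity hμ).comp_continuousOn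
      (continuousOn_tailSlope hB hk hμ hf ht hm)) fun x hx => ?_
  exact (tailDensity_pos hB hk hμ (tailSlope_spec hB hk hμ hf ht hm hx.1 hx.2).1).ne'

/-- The calibrating potential: its value at `0` is the claimed lower bound of the action on the
half-line, and its derivative is bounded below by minus the action density. -/
def potential (B k μ : ℝ) (f : ℝ → E) (x : ℝ) : ℝ :=
  k * tailSlope B k μ f x * ‖f x‖ ^ 2 + (μ + 1) * k ^ 2 / B * remMass μ f x

theorem potential_zero (hB : 0 < B) (hk : 0 < k) (hμ : 0 < μ) (ht : t ∈ Ioo (-1 : ℝ) 1)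
    (hm : remMass μ f 0 = tailMass B k μ t) :
    potential B k μ f 0 = k * t * ‖f 0‖ ^ 2 + (μ + 1) * k ^ 2 / B * tailMass B k μ t := by
  rw [potential, tailSlope_zero hB hk hμ ht hm, hm]

end TailSlope

section Calibration

variable {E : Type*} [NormedAddCommGroup E] [InnerProductSpace ℝ E] {f g : ℝ → E}
  {B k μ t X : ℝ}

/-- The derivative of `potential`, for `f` with derivative `g`. -/
def potentialDeriv (B k μ : ℝ) (f g : ℝ → E) (x : ℝ) : ℝ :=
  k * (‖f x‖ ^ (2 * μ + 2) / tailDensity B k μ (tailSlope B k μ f x)) * ‖f x‖ ^ 2 +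
    k * tailSlope B k μ f x * (2 * inner ℝ (f x) (g x)) +
    (μ + 1) * k ^ 2 / B * -‖f x‖ ^ (2 * μ + 2)

/-- The deficit density in the calibration of the action: the sum of the action density and the
derivative of the calibrating potential, written in manifestly non-negative form. -/
def deficit (B k μ : ℝ) (f g : ℝ → E) (x : ℝ) : ℝ :=
  ‖g x + (k * tailSlope B k μ f x) • f x‖ ^ 2 +
    k ^ 2 / B * ‖f x‖ ^ 2 * powerGap μ (ampPow B (tailSlope B k μ f x)) ‖f x‖

theorem deficit_nonneg (hB : 0 < B) (hμ : 0 < μ) {x : ℝ}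
    (hs : tailSlope B k μ f x ∈ Ioo (-1 : ℝ) 1) : 0 ≤ deficit B k μ f g x := by
  have := powerGap_nonneg hμ (ampPow_pos hB hs) (norm_nonneg (f x))
  unfold deficit
  positivity

theorem deficit_eq (hB : 0 < B) (hμ : 0 < μ) {x : ℝ}
    (hs : tailSlope B k μ f x ∈ Ioo (-1 : ℝ) 1) :
    deficit B k μ f g x = ‖g x‖ ^ 2 + k ^ 2 * ‖f x‖ ^ 2 + potentialDeriv B k μ f g x := by
  have hpow : ‖f x‖ ^ (2 * μ + 2) = ‖f x‖ ^ (2 * μ) * ‖f x‖ ^ 2 := by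
    rw [Real.rpow_add_of_nonneg (norm_nonneg _) (by positivity) zero_le_two, Real.rpow_two]
  have hb := ampPow_pos hB hs
  rw [deficit, potentialDeriv, powerGap, tailDensity, ← ampPow, hpow, norm_add_sq_real,
    inner_smul_right, norm_smul, mul_pow, Real.norm_eq_abs, sq_abs, real_inner_comm]
  generalize ‖f x‖ ^ (2 * μ) = W
  have hbE : 0 < ampPow B (tailSlope B k μ f x) ^ (1 / μ) := by positivity
  generalize ampPow B (tailSlope B k μ f x) ^ (1 / μ) = A at hbE
  rw [ampPow]
  field_simp
  ring

variable [CompleteSpace E]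

theorem HalfLineH1.integral_potentialDeriv (h : HalfLineH1 f g) (hB : 0 < B) (hk : 0 < k)
    (hμ : 0 < μ) (ht : t ∈ Ioo (-1 : ℝ) 1) (hm : remMass μ f 0 = tailMass B k μ t) (hX : 0 ≤ X)
    (hpos : 0 < remMass μ f X) :
    IntervalIntegrable (potentialDeriv B k μ f g) volume 0 X ∧
      ∫ x in (0 : ℝ)..X, potentialDeriv B k μ f g x =
        potential B k μ f X - potential B k μ f 0 := by
  have hf := h.continuous
  have hsub := Icc_subset_remMass_pos hμ hf hpos
  have hq : Continuous fun x => ‖f x‖ ^ (2 * μ + 2) := continuous_norm_rpow hf (by linarith)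
  have hs' := (continuousOn_rpow_div_tailDensity hB hk hμ hf ht hm).mono hsub
  have hs : AbsolutelyContinuousOnInterval (tailSlope B k μ f) 0 X :=
    absolutelyContinuousOnInterval_of_hasDerivAt hX
      (fun x hx => hasDerivAt_tailSlope hB hk hμ hf ht hm hx.1 (hsub hx).2) hs'
  have hrem : AbsolutelyContinuousOnInterval (remMass μ f) 0 X :=
    absolutelyContinuousOnInterval_of_hasDerivAt hX (fun x _ => hasDerivAt_remMass hf hμ x)
      hq.neg.continuousOn
  have hint : IntervalIntegrable (potentialDeriv B k μ f g) volume 0 X := by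
    rw [← uIcc_of_le hX] at hs'
    refine (IntervalIntegrable.add ?_ ?_).add
      ((continuous_const.mul hq.neg).intervalIntegrable 0 X)
    · exact ((continuousOn_const.mul hs').mul (hf.norm.pow 2).continuousOn).intervalIntegrable
    · refine IntervalIntegrable.continuousOn_mul ?_ (continuousOn_const.mul hs.continuousOn)
      rw [intervalIntegrable_iff_integrableOn_Ioc_of_le hX]
      exact h.integrableOn_inner.mono_set Ioc_subset_Ioi_self
  refine ⟨hint, integral_eq_sub_of_ae_hasDerivAt (((hs.const_mul k).fun_mul
    (h.absolutelyContinuous_norm_sq hX)).fun_add (hrem.const_mul _)) hint ?_⟩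
  filter_upwards [h.ae_hasDerivAt_of_mem_uIcc hX] with x hx hxI
  have hxI' := uIcc_of_le hX ▸ hxI
  exact (((hasDerivAt_tailSlope hB hk hμ hf ht hm hxI'.1 (hsub hxI').2).const_mul k).mul
    (hx hxI).norm_sq).add ((hasDerivAt_remMass hf hμ x).const_mul _)

theorem HalfLineH1.integral_deficit_add_potential_le (h : HalfLineH1 f g) (hB : 0 < B) (hk : 0 < k)
    (hμ : 0 < μ) (ht : t ∈ Ioo (-1 : ℝ) 1) (hm : remMass μ f 0 = tailMass B k μ t) (hX : 0 ≤ X)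
    (hpos : 0 < remMass μ f X) :
    IntervalIntegrable (deficit B k μ f g) volume 0 X ∧
    (∫ x in (0 : ℝ)..X, deficit B k μ f g x) + potential B k μ f 0 ≤
      (∫ x in Ioi (0 : ℝ), (‖g x‖ ^ 2 + k ^ 2 * ‖f x‖ ^ 2)) +
        (μ + 1) * k ^ 2 / B * remMass μ f X := by
  obtain ⟨hP, hPX⟩ := h.integral_potentialDeriv hB hk hμ ht hm hX hpos
  have hs := fun x hx => (tailSlope_spec hB hk hμ h.continuous ht hm (x := x)
    (Icc_subset_remMass_pos hμ h.continuous hpos hx).1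
    (Icc_subset_remMass_pos hμ h.continuous hpos hx).2).1
  have hI : IntegrableOn (fun x => ‖g x‖ ^ 2 + k ^ 2 * ‖f x‖ ^ 2) (Ioi 0) :=
    h.integrableOn_sq_deriv.add (h.integrableOn_sq.const_mul _)
  have hIX : IntervalIntegrable (fun x => ‖g x‖ ^ 2 + k ^ 2 * ‖f x‖ ^ 2) volume 0 X := by
    rw [intervalIntegrable_iff_integrableOn_Ioc_of_le hX]
    exact hI.mono_set Ioc_subset_Ioi_self
  have hD : ∀ x ∈ uIcc 0 X, deficit B k μ f g x =
      ‖g x‖ ^ 2 + k ^ 2 * ‖f x‖ ^ 2 + potentialDeriv B k μ f g x := fun x hx =>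
    deficit_eq hB hμ (hs x (uIcc_of_le hX ▸ hx))
  refine ⟨(hIX.add hP).congr fun x hx => (hD x (uIoc_subset_uIcc hx)).symm, ?_⟩
  have htrace : k * tailSlope B k μ f X * ‖f X‖ ^ 2 ≤
      ∫ x in Ioi X, (‖g x‖ ^ 2 + k ^ 2 * ‖f x‖ ^ 2) := by
    refine le_trans ?_ (h.mul_norm_sq_le k hX)
    have := (hs X (right_mem_Icc.2 hX)).2.le
    gcongr
    exact mul_le_of_le_one_right hk.le this
  have hsplit := intervalIntegral.integral_interval_add_Ioi hI (hI.mono_set (Ioi_subset_Ioi hX))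
  rw [intervalIntegral.integral_congr hD, intervalIntegral.integral_add hIX hP, hPX, ← hsplit]
  simp only [potential]
  linarith

/- Moving the end point further out costs nothing because the deficit is non-negative, and it makes
the remaining power norm as small as we please. -/
theorem HalfLineH1.integral_deficit_le (h : HalfLineH1 f g) (hB : 0 < B) (hk : 0 < k)
    (hμ : 0 < μ) (ht : t ∈ Ioo (-1 : ℝ) 1) (hm : remMass μ f 0 = tailMass B k μ t) (hX : 0 ≤ X)
    (hpos : 0 < remMass μ f X) :
    (∫ x in (0 : ℝ)..X, deficit B k μ f g x) + potential B k μ f 0 ≤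
      ∫ x in Ioi (0 : ℝ), (‖g x‖ ^ 2 + k ^ 2 * ‖f x‖ ^ 2) := by
  have hc : 0 < (μ + 1) * k ^ 2 / B := by positivity
  refine le_of_forall_pos_le_add fun ε hε => ?_
  obtain ⟨Y, hXY, hY⟩ := exists_remMass_eq h.continuous hμ (h.integrableOn_rpow (by linarith))
    (lt_min (div_pos hε hc) hpos) (min_le_right _ _)
  have hYpos : 0 < remMass μ f Y := hY ▸ lt_min (div_pos hε hc) hpos
  obtain ⟨hint, hle⟩ := h.integral_deficit_add_potential_le hB hk hμ ht hm (hX.trans hXY) hYpos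
  have hmono : ∫ x in (0 : ℝ)..X, deficit B k μ f g x ≤ ∫ x in (0 : ℝ)..Y, deficit B k μ f g x :=
    intervalIntegral.integral_mono_interval le_rfl hX hXY
      (ae_restrict_of_forall_mem measurableSet_Ioc fun x hx => deficit_nonneg hB hμ
        (tailSlope_spec hB hk hμ h.continuous ht hm hx.1.le
          (hYpos.trans_le (antitone_remMass h.continuous hμ hx.2))).1) hint
  have hrem : (μ + 1) * k ^ 2 / B * remMass μ f Y ≤ ε := by
    rw [hY, mul_comm, ← le_div_iff₀ hc]
    exact min_le_left _ _
  linarith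

theorem HalfLineH1.potential_le_action (h : HalfLineH1 f g) (hB : 0 < B) (hk : 0 < k)
    (hμ : 0 < μ) (ht : t ∈ Ioo (-1 : ℝ) 1) (hm : remMass μ f 0 = tailMass B k μ t) :
    potential B k μ f 0 ≤ ∫ x in Ioi (0 : ℝ), (‖g x‖ ^ 2 + k ^ 2 * ‖f x‖ ^ 2) := by
  simpa only [intervalIntegral.integral_same, zero_add] using
    h.integral_deficit_le hB hk hμ ht hm le_rfl
      (hm ▸ tailMass_pos hB hk hμ (Ioo_subset_Ico_self ht))

end Calibration

section Tanh

theorem hasDerivAt_tanh (x : ℝ) : HasDerivAt Real.tanh (1 - Real.tanh x ^ 2) x := by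
  have hc := (Real.cosh_pos x).ne'
  rw [funext Real.tanh_eq_sinh_div_cosh]
  refine ((Real.hasDerivAt_sinh x).fun_div (Real.hasDerivAt_cosh x) hc).congr_deriv ?_
  field_simp

theorem strictMono_tanh : StrictMono Real.tanh :=
  strictMono_of_hasDerivAt_pos hasDerivAt_tanh fun x =>
    one_sub_sq_pos ⟨Real.neg_one_lt_tanh x, Real.tanh_lt_one x⟩

theorem tendsto_tanh_atTop : Tendsto Real.tanh atTop (𝓝 1) := by
  refine tendsto_order.2 ⟨fun a ha => ?_, fun a ha =>
    Eventually.of_forall fun x => (Real.tanh_lt_one x).trans ha⟩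
  rcases le_or_gt a (-1) with h | h
  · exact Eventually.of_forall fun x => h.trans_lt (Real.neg_one_lt_tanh x)
  · filter_upwards [eventually_gt_atTop (Real.artanh a)] with x hx
    rw [← Real.artanh_tanh x] at hx
    exact (Real.artanh_lt_artanh_iff ⟨h, ha⟩
      ⟨Real.neg_one_lt_tanh x, Real.tanh_lt_one x⟩).1 hx

theorem one_sub_tanh_sq (x : ℝ) : 1 - Real.tanh x ^ 2 = (Real.cosh x)⁻¹ ^ 2 := by
  have hc := (Real.cosh_pos x).ne'
  have := Real.cosh_sq x
  rw [Real.tanh_eq_sinh_div_cosh]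
  field_simp
  linarith

end Tanh

section TailProfile

/-- The normalized logarithmic slope of the soliton tail centred at `-y`. -/
def profileSlope (k μ y x : ℝ) : ℝ := Real.tanh (μ * k * (x + y))

/-- The soliton tail centred at `-y`. -/
def tailProfile (B k μ y x : ℝ) : ℝ :=
  B ^ (1 / (2 * μ)) * (Real.cosh (μ * k * (x + y)))⁻¹ ^ (1 / μ)

variable {B k μ : ℝ}

theorem profileSlope_mem_Ioo (y x : ℝ) : profileSlope k μ y x ∈ Ioo (-1 : ℝ) 1 :=
  ⟨Real.neg_one_lt_tanh _, Real.tanh_lt_one _⟩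

theorem hasDerivAt_profileSlope (y x : ℝ) :
    HasDerivAt (profileSlope k μ y) (μ * k * (1 - profileSlope k μ y x ^ 2)) x := by
  have h : HasDerivAt (fun x => μ * k * (x + y)) (μ * k) x := by
    simpa only [mul_one] using ((hasDerivAt_id' x).add_const y).const_mul (μ * k)
  exact ((hasDerivAt_tanh _).comp x h).congr_deriv (mul_comm _ _)

theorem continuous_profileSlope (y : ℝ) : Continuous (profileSlope k μ y) :=
  continuous_iff_continuousAt.2 fun x => (hasDerivAt_profileSlope y x).continuousAt

theorem tendsto_profileSlope_atTop (hk : 0 < k) (hμ : 0 < μ) (y : ℝ) :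
    Tendsto (profileSlope k μ y) atTop (𝓝 1) :=
  tendsto_tanh_atTop.comp
    ((tendsto_atTop_add_const_right _ y tendsto_id).const_mul_atTop (by positivity))

theorem tailProfile_pos (hB : 0 < B) (y x : ℝ) : 0 < tailProfile B k μ y x := by
  have := Real.cosh_pos (μ * k * (x + y))
  unfold tailProfile
  positivity

theorem tailProfile_rpow (hB : 0 < B) (y x q : ℝ) :
    tailProfile B k μ y x ^ q = ampPow B (profileSlope k μ y x) ^ (q / (2 * μ)) := by
  have hc := inv_pos.2 (Real.cosh_pos (μ * k * (x + y)))
  rw [ampPow, profileSlope, one_sub_tanh_sq, Real.mul_rpow hB.le (by positivity), tailProfile,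
    Real.mul_rpow (by positivity) (by positivity), ← Real.rpow_mul hB.le, ← Real.rpow_mul hc.le,
    ← Real.rpow_natCast, ← Real.rpow_mul hc.le]
  congr 2
  · ring
  · push_cast
    ring

theorem tailProfile_rpow_two_mul (hB : 0 < B) (hμ : 0 < μ) (y x : ℝ) :
    tailProfile B k μ y x ^ (2 * μ) = ampPow B (profileSlope k μ y x) := by
  rw [tailProfile_rpow hB, div_self (by positivity), Real.rpow_one]

theorem tailProfile_sq (hB : 0 < B) (y x : ℝ) :
    tailProfile B k μ y x ^ 2 = ampPow B (profileSlope k μ y x) ^ (1 / μ) := by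
  rw [← Real.rpow_natCast, tailProfile_rpow hB, Nat.cast_ofNat,
    div_mul_cancel_left₀ two_ne_zero, one_div]

theorem tailProfile_rpow_add_two (hB : 0 < B) (hμ : 0 < μ) (y x : ℝ) :
    tailProfile B k μ y x ^ (2 * μ + 2) =
      ampPow B (profileSlope k μ y x) * tailProfile B k μ y x ^ 2 := by
  rw [Real.rpow_add (tailProfile_pos hB y x), tailProfile_rpow_two_mul hB hμ, Real.rpow_two]

theorem hasDerivAt_tailProfile (hμ : 0 < μ) (y x : ℝ) :
    HasDerivAt (tailProfile B k μ y)
      (-(k * profileSlope k μ y x) * tailProfile B k μ y x) x := by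
  have hc := Real.cosh_pos (μ * k * (x + y))
  have h : HasDerivAt (fun x => μ * k * (x + y)) (μ * k) x := by
    simpa only [mul_one] using ((hasDerivAt_id' x).add_const y).const_mul (μ * k)
  refine (((((Real.hasDerivAt_cosh _).comp x h).inv hc.ne').rpow_const (p := 1 / μ)
    (Or.inl (inv_pos.2 hc).ne')).const_mul (B ^ (1 / (2 * μ)))).congr_deriv ?_
  simp only [Pi.inv_apply, Function.comp_apply]
  rw [Real.rpow_sub_one (inv_pos.2 hc).ne', profileSlope, Real.tanh_eq_sinh_div_cosh, tailProfile]
  field_simp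

theorem continuous_tailProfile (hμ : 0 < μ) (y : ℝ) : Continuous (tailProfile B k μ y) :=
  continuous_iff_continuousAt.2 fun x => (hasDerivAt_tailProfile hμ y x).continuousAt

theorem hasDerivAt_tailMass_profileSlope (hB : 0 < B) (hk : 0 < k) (hμ : 0 < μ) (y x : ℝ) :
    HasDerivAt (fun x => tailMass B k μ (profileSlope k μ y x))
      (-tailProfile B k μ y x ^ (2 * μ + 2)) x := by
  refine ((hasStrictDerivAt_tailMass hμ (profileSlope k μ y x)).hasDerivAt.comp x
    (hasDerivAt_profileSlope y x)).congr_deriv ?_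
  rw [tailProfile_rpow_add_two hB hμ, tailProfile_sq hB, tailDensity, ← ampPow]
  nth_rewrite 2 [ampPow]
  field_simp

theorem integral_tailProfile_rpow (hB : 0 < B) (hk : 0 < k) (hμ : 0 < μ) (y : ℝ) :
    ∫ x in Ioi (0 : ℝ), tailProfile B k μ y x ^ (2 * μ + 2) =
      tailMass B k μ (profileSlope k μ y 0) := by
  have hlim : Tendsto (fun x => tailMass B k μ (profileSlope k μ y x)) atTop (𝓝 0) := by
    rw [← tailMass_one (B := B) (k := k) (μ := μ)]
    exact ((continuous_tailMass hμ).tendsto 1).comp (tendsto_profileSlope_atTop hk hμ y)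
  have h := integral_Ioi_of_hasDerivAt_of_nonpos' (a := 0)
    (fun x _ => hasDerivAt_tailMass_profileSlope hB hk hμ y x)
    (fun x _ => neg_nonpos.2 (Real.rpow_nonneg (tailProfile_pos hB y x).le _)) hlim
  rwa [integral_neg, zero_sub, neg_inj] at h

/-- The calibrating potential evaluated along a soliton tail. -/
def profilePotential (B k μ y x : ℝ) : ℝ :=
  k * profileSlope k μ y x * tailProfile B k μ y x ^ 2 +
    (μ + 1) * k ^ 2 / B * tailMass B k μ (profileSlope k μ y x)

/-- The action density of a soliton tail. -/
def profileDensity (B k μ y x : ℝ) : ℝ :=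
  k ^ 2 * (1 + profileSlope k μ y x ^ 2) * tailProfile B k μ y x ^ 2

theorem profileDensity_nonneg (y x : ℝ) : 0 ≤ profileDensity B k μ y x := by
  unfold profileDensity
  positivity

theorem hasDerivAt_profilePotential (hB : 0 < B) (hk : 0 < k) (hμ : 0 < μ) (y x : ℝ) :
    HasDerivAt (profilePotential B k μ y) (-profileDensity B k μ y x) x := by
  refine ((((hasDerivAt_profileSlope y x).const_mul k).mul
    ((hasDerivAt_tailProfile hμ y x).pow 2)).add
    ((hasDerivAt_tailMass_profileSlope hB hk hμ y x).const_mul _)).congr_deriv ?_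
  rw [tailProfile_rpow_add_two hB hμ, ampPow, profileDensity]
  simp only [Pi.pow_apply]
  push_cast
  field_simp
  ring

theorem tendsto_profilePotential_atTop (hB : 0 < B) (hk : 0 < k) (hμ : 0 < μ) (y : ℝ) :
    Tendsto (profilePotential B k μ y) atTop (𝓝 0) := by
  have hμ' : 0 < 1 / μ := one_div_pos.2 hμ
  have hamp : Continuous fun σ => ampPow B σ ^ (1 / μ) := by
    unfold ampPow
    exact Continuous.rpow_const (by fun_prop) fun _ => Or.inr hμ'.le
  have hmass := continuous_tailMass (B := B) (k := k) hμ
  have hc : Continuous fun σ => k * σ * ampPow B σ ^ (1 / μ) +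
      (μ + 1) * k ^ 2 / B * tailMass B k μ σ := by fun_prop
  have hlim := (hc.tendsto 1).comp (tendsto_profileSlope_atTop hk hμ y)
  simp only [tailMass_one, ampPow, one_pow, sub_self, mul_zero, Real.zero_rpow hμ'.ne',
    add_zero] at hlim
  refine hlim.congr fun x => ?_
  rw [profilePotential, tailProfile_sq hB, Function.comp_apply, ampPow]

theorem integrableOn_profileDensity (hB : 0 < B) (hk : 0 < k) (hμ : 0 < μ) (y : ℝ) :
    IntegrableOn (profileDensity B k μ y) (Ioi 0) := by
  have h := integrableOn_Ioi_deriv_of_nonpos' (a := 0)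
    (fun x _ => hasDerivAt_profilePotential hB hk hμ y x)
    (fun x _ => neg_nonpos.2 (profileDensity_nonneg y x))
    (tendsto_profilePotential_atTop hB hk hμ y)
  simpa only [Pi.neg_def, neg_neg] using h.neg

theorem integral_profileDensity (hB : 0 < B) (hk : 0 < k) (hμ : 0 < μ) (y : ℝ) :
    ∫ x in Ioi (0 : ℝ), profileDensity B k μ y x = profilePotential B k μ y 0 := by
  have h := integral_Ioi_of_hasDerivAt_of_nonpos' (a := 0)
    (fun x _ => hasDerivAt_profilePotential hB hk hμ y x)
    (fun x _ => neg_nonpos.2 (profileDensity_nonneg y x))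
    (tendsto_profilePotential_atTop hB hk hμ y)
  rwa [integral_neg, zero_sub, neg_inj] at h

theorem sq_deriv_tailProfile_add (y x : ℝ) :
    (-(k * profileSlope k μ y x) * tailProfile B k μ y x) ^ 2 +
      k ^ 2 * tailProfile B k μ y x ^ 2 = profileDensity B k μ y x := by
  rw [profileDensity]
  ring

theorem memLp_tailProfile (hB : 0 < B) (hk : 0 < k) (hμ : 0 < μ) (y : ℝ) :
    MemLp (tailProfile B k μ y) 2 (volume.restrict (Ioi 0)) := by
  have hc := continuous_tailProfile (B := B) (k := k) hμ y
  rw [memLp_two_iff_integrable_sq hc.aestronglyMeasurable]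
  refine ((integrableOn_profileDensity hB hk hμ y).const_mul (k ^ 2)⁻¹).mono'
    (hc.pow 2).aestronglyMeasurable (Eventually.of_forall fun x => ?_)
  rw [Real.norm_of_nonneg (sq_nonneg _), ← sq_deriv_tailProfile_add, mul_add,
    inv_mul_cancel_left₀ (by positivity)]
  exact le_add_of_nonneg_left (by positivity)

theorem memLp_deriv_tailProfile (hB : 0 < B) (hk : 0 < k) (hμ : 0 < μ) (y : ℝ) :
    MemLp (fun x => -(k * profileSlope k μ y x) * tailProfile B k μ y x) 2
      (volume.restrict (Ioi 0)) := by
  have hc : Continuous fun x => -(k * profileSlope k μ y x) * tailProfile B k μ y x :=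
    ((continuous_profileSlope y).const_mul k).neg.mul (continuous_tailProfile hμ y)
  rw [memLp_two_iff_integrable_sq hc.aestronglyMeasurable]
  refine (integrableOn_profileDensity hB hk hμ y).mono'
    (hc.pow 2).aestronglyMeasurable (Eventually.of_forall fun x => ?_)
  rw [Real.norm_of_nonneg (sq_nonneg _), ← sq_deriv_tailProfile_add]
  exact le_add_of_nonneg_right (by positivity)

variable {E : Type*} [NormedAddCommGroup E] {u : E}

theorem halfLineH1_tailProfile [NormedSpace ℝ E] [CompleteSpace E] (hB : 0 < B) (hk : 0 < k)
    (hμ : 0 < μ) (y : ℝ) (u : E) :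
    HalfLineH1 (fun x => tailProfile B k μ y x • u)
      (fun x => (-(k * profileSlope k μ y x) * tailProfile B k μ y x) • u) where
  continuous := (continuous_tailProfile hμ y).smul continuous_const
  memLp_deriv := (memLp_top_const u).smul (memLp_deriv_tailProfile hB hk hμ y)
  memLp := (memLp_top_const u).smul (memLp_tailProfile hB hk hμ y)
  eq_add_integral x _ := by
    have hc : Continuous fun x => (-(k * profileSlope k μ y x) * tailProfile B k μ y x) • u :=
      (((continuous_profileSlope y).const_mul k).neg.mul (continuous_tailProfile hμ y)).smul
        continuous_const
    rw [intervalIntegral.integral_eq_sub_of_hasDerivAt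
      (fun x _ => (hasDerivAt_tailProfile hμ y x).smul_const u) (hc.intervalIntegrable _ _),
      add_sub_cancel]

theorem norm_smul_of_norm_eq_one [NormedSpace ℝ E] (hu : ‖u‖ = 1) (r : ℝ) : ‖r • u‖ = |r| := by
  rw [norm_smul, hu, mul_one, Real.norm_eq_abs]

theorem integral_action_tailProfile [NormedSpace ℝ E] (hB : 0 < B) (hk : 0 < k) (hμ : 0 < μ)
    (y : ℝ) (hu : ‖u‖ = 1) :
    ∫ x in Ioi (0 : ℝ),
      (‖(-(k * profileSlope k μ y x) * tailProfile B k μ y x) • u‖ ^ 2 +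
        k ^ 2 * ‖tailProfile B k μ y x • u‖ ^ 2) = profilePotential B k μ y 0 := by
  simp only [norm_smul_of_norm_eq_one hu, sq_abs, sq_deriv_tailProfile_add,
    integral_profileDensity hB hk hμ]

theorem integral_norm_tailProfile_rpow [NormedSpace ℝ E] (hB : 0 < B) (hk : 0 < k) (hμ : 0 < μ)
    (y : ℝ) (hu : ‖u‖ = 1) :
    ∫ x in Ioi (0 : ℝ), ‖tailProfile B k μ y x • u‖ ^ (2 * μ + 2) =
      tailMass B k μ (profileSlope k μ y 0) := by
  simp only [norm_smul_of_norm_eq_one hu, abs_of_pos (tailProfile_pos hB _ _),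
    integral_tailProfile_rpow hB hk hμ]

end TailProfile

section Artanh

theorem hasDerivAt_artanh {s : ℝ} (hs : s ∈ Ioo (-1 : ℝ) 1) :
    HasDerivAt Real.artanh (1 - s ^ 2)⁻¹ s := by
  have h₁ : 1 + s ≠ 0 := by linarith [hs.1]
  have h₂ : 1 - s ≠ 0 := by linarith [hs.2]
  have h : HasDerivAt (fun x => 1 / 2 * (Real.log (1 + x) - Real.log (1 - x)))
      (1 / 2 * (1 / (1 + s) - -1 / (1 - s))) s :=
    ((((hasDerivAt_id' s).const_add 1).log h₁).sub
      (((hasDerivAt_id' s).const_sub 1).log h₂)).const_mul _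
  refine (h.congr_of_eventuallyEq ?_).congr_deriv ?_
  · filter_upwards [Ioo_mem_nhds hs.1 hs.2] with x hx
    rw [Real.artanh_eq_half_log (Ioo_subset_Icc_self hx), Real.log_div (by linarith [hx.1])
      (by linarith [hx.2])]
  · rw [show 1 - s ^ 2 = (1 + s) * (1 - s) by ring]
    field_simp
    ring

theorem artanh_eq_of_hasDerivAt {s : ℝ → ℝ} {X c : ℝ} (hX : 0 ≤ X)
    (hs : ∀ x ∈ Icc 0 X, s x ∈ Ioo (-1 : ℝ) 1)
    (hd : ∀ x ∈ Icc 0 X, HasDerivAt s (c * (1 - s x ^ 2)) x) :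
    Real.artanh (s X) = Real.artanh (s 0) + c * X := by
  have hd' : ∀ x ∈ Icc 0 X, HasDerivAt (fun x => Real.artanh (s x) - c * x) 0 x := by
    intro x hx
    refine (((hasDerivAt_artanh (hs x hx)).comp x (hd x hx)).sub
      ((hasDerivAt_id' x).const_mul c)).congr_deriv ?_
    have := (one_sub_sq_pos (hs x hx)).ne'
    field_simp
    ring
  have hconst := constant_of_has_deriv_right_zero
    (fun x hx => (hd' x hx).continuousAt.continuousWithinAt)
    (fun x hx => (hd' x (Ico_subset_Icc_self hx)).hasDerivWithinAt) X (right_mem_Icc.2 hX)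
  rw [mul_zero, sub_zero] at hconst
  linarith

end Artanh

theorem HalfLinePrimitive.smul_eq_of_ae_eq_smul {E : Type*} [NormedAddCommGroup E]
    [NormedSpace ℝ E] [CompleteSpace E] {f g : ℝ → E} (h : HalfLinePrimitive f g)
    {P c : ℝ → ℝ} {X : ℝ} (hX : 0 ≤ X) (hP : ∀ x ∈ Icc 0 X, HasDerivAt P (c x * P x) x)
    (hc : ContinuousOn c (Icc 0 X)) (hg : ∀ᵐ x, x ∈ Icc 0 X → g x = -c x • f x) :
    P X • f X = P 0 • f 0 := by
  have hPc : ContinuousOn P (Icc 0 X) := fun x hx => (hP x hx).continuousAt.continuousWithinAt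
  have hac : AbsolutelyContinuousOnInterval (P • f) 0 X :=
    (absolutelyContinuousOnInterval_of_hasDerivAt hX hP (hc.mul hPc)).smul
      (h.absolutelyContinuous hX)
  have hzero : ∀ᵐ x, x ∈ uIcc 0 X → HasDerivAt (P • f) 0 x := by
    filter_upwards [h.ae_hasDerivAt_of_mem_uIcc hX, hg] with x hfx hgx hx
    have hx' := uIcc_of_le hX ▸ hx
    refine ((hP x hx').smul (hfx hx)).congr_deriv ?_
    rw [hgx hx', smul_smul, ← add_smul]
    ring_nf
    exact zero_smul ℝ _
  obtain ⟨C, hC⟩ := hac.const_of_ae_hasDerivAt_zero hzero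
  exact (hC X right_mem_uIcc).trans (hC 0 left_mem_uIcc).symm

section Rigidity

variable {E : Type*} [NormedAddCommGroup E] [InnerProductSpace ℝ E] {f g : ℝ → E}
  {B k μ t x y X : ℝ}

theorem eq_of_deficit_eq_zero (hB : 0 < B) (hk : 0 < k) (hμ : 0 < μ)
    (hs : tailSlope B k μ f x ∈ Ioo (-1 : ℝ) 1) (h : deficit B k μ f g x = 0) :
    g x = -(k * tailSlope B k μ f x) • f x ∧
      (f x = 0 ∨ ‖f x‖ ^ (2 * μ) = ampPow B (tailSlope B k μ f x)) := by
  have hgap := powerGap_nonneg hμ (ampPow_pos hB hs) (norm_nonneg (f x))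
  obtain ⟨h₁, h₂⟩ := (add_eq_zero_iff_of_nonneg (by positivity) (by positivity)).1 h
  constructor
  · rw [neg_smul]
    exact eq_neg_of_add_eq_zero_left (by simpa using h₁)
  · by_contra! hne
    have hfx := norm_pos_iff.2 hne.1
    have := powerGap_pos hμ (ampPow_pos hB hs) (norm_nonneg (f x)) hne.2
    exact absurd h₂ (by positivity)

variable [CompleteSpace E]

theorem HalfLineH1.deficit_ae_eq_zero (h : HalfLineH1 f g) (hB : 0 < B) (hk : 0 < k)
    (hμ : 0 < μ) (ht : t ∈ Ioo (-1 : ℝ) 1) (hm : remMass μ f 0 = tailMass B k μ t)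
    (he : ∫ x in Ioi (0 : ℝ), (‖g x‖ ^ 2 + k ^ 2 * ‖f x‖ ^ 2) ≤ potential B k μ f 0)
    (hX : 0 ≤ X) (hpos : 0 < remMass μ f X) :
    ∀ᵐ x ∂volume.restrict (Icc 0 X), deficit B k μ f g x = 0 := by
  have hnn : ∀ x ∈ Icc 0 X, 0 ≤ deficit B k μ f g x := fun x hx =>
    have hx' := Icc_subset_remMass_pos hμ h.continuous hpos hx
    deficit_nonneg hB hμ (tailSlope_spec hB hk hμ h.continuous ht hm hx'.1 hx'.2).1
  have hzero : ∫ x in (0 : ℝ)..X, deficit B k μ f g x = 0 := by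
    have := h.integral_deficit_le hB hk hμ ht hm hX hpos
    exact le_antisymm (by linarith) (intervalIntegral.integral_nonneg hX hnn)
  rw [intervalIntegral.integral_of_le hX, ← integral_Icc_eq_integral_Ioc] at hzero
  refine (setIntegral_eq_zero_iff_of_nonneg_ae
    (ae_restrict_of_forall_mem measurableSet_Icc hnn) ?_).1 hzero
  rw [integrableOn_Icc_iff_integrableOn_Ioc,
    ← intervalIntegrable_iff_integrableOn_Ioc_of_le hX]
  exact (h.integral_deficit_add_potential_le hB hk hμ ht hm hX hpos).1

theorem HalfLineH1.eqOn_zero_or_forall_rpow_eq (h : HalfLineH1 f g) (hB : 0 < B) (hk : 0 < k)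
    (hμ : 0 < μ) (ht : t ∈ Ioo (-1 : ℝ) 1) (hm : remMass μ f 0 = tailMass B k μ t)
    (he : ∫ x in Ioi (0 : ℝ), (‖g x‖ ^ 2 + k ^ 2 * ‖f x‖ ^ 2) ≤ potential B k μ f 0)
    (hX : 0 < X) (hpos : 0 < remMass μ f X) :
    EqOn f 0 (Icc 0 X) ∨
      ∀ x ∈ Icc 0 X, ‖f x‖ ^ (2 * μ) = ampPow B (tailSlope B k μ f x) := by
  have hsub := Icc_subset_remMass_pos hμ h.continuous hpos
  have hs : ∀ x ∈ Icc 0 X, tailSlope B k μ f x ∈ Ioo (-1 : ℝ) 1 := fun x hx =>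
    (tailSlope_spec hB hk hμ h.continuous ht hm (hsub hx).1 (hsub hx).2).1
  have hb : ∀ x ∈ Icc 0 X, ampPow B (tailSlope B k μ f x) ≠ 0 := fun x hx =>
    (ampPow_pos hB (hs x hx)).ne'
  set w : ℝ → ℝ := fun x => 2 * (‖f x‖ ^ (2 * μ) / ampPow B (tailSlope B k μ f x)) - 1
  have hw : ContinuousOn w (Icc 0 X) := by
    have hsc := (continuousOn_tailSlope hB hk hμ h.continuous ht hm).mono hsub
    have hamp : Continuous (ampPow B) := by unfold ampPow; fun_prop
    exact (((continuous_norm_rpow h.continuous (by positivity)).continuousOn.div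
      (hamp.comp_continuousOn hsc) hb).const_mul 2).sub continuousOn_const
  have hw2 : EqOn (w ^ 2) 1 (Icc 0 X) := by
    refine Measure.eqOn_Icc_of_ae_eq volume hX.ne ?_ (hw.pow 2) continuousOn_const
    filter_upwards [h.deficit_ae_eq_zero hB hk hμ ht hm he hX.le hpos,
      ae_restrict_mem measurableSet_Icc] with x hx hxI
    rcases (eq_of_deficit_eq_zero hB hk hμ (hs x hxI) hx).2 with hfx | hfx
    · simp [w, hfx, hμ.ne']
    · norm_num [w, hfx, div_self (hb x hxI)]
  refine (isPreconnected_Icc.eq_one_or_eq_neg_one_of_sq_eq hw hw2).symm.imp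
    (fun hw0 x hx => ?_) fun hw1 x hx => ?_
  · have hfx : ‖f x‖ ^ (2 * μ) = 0 := by simpa [w, hb x hx] using hw0 hx
    exact norm_eq_zero.1 ((Real.rpow_eq_zero (norm_nonneg _) (by positivity)).1 hfx)
  · refine (div_eq_one_iff_eq (hb x hx)).1 ?_
    have := hw1 hx
    simp only [w, Pi.one_apply] at this
    linarith

theorem HalfLineH1.norm_rpow_eq_ampPow (h : HalfLineH1 f g) (hB : 0 < B) (hk : 0 < k)
    (hμ : 0 < μ) (ht : t ∈ Ioo (-1 : ℝ) 1) (hm : remMass μ f 0 = tailMass B k μ t)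
    (he : ∫ x in Ioi (0 : ℝ), (‖g x‖ ^ 2 + k ^ 2 * ‖f x‖ ^ 2) ≤ potential B k μ f 0)
    (hx : 0 ≤ x) (hpos : 0 < remMass μ f x) :
    ‖f x‖ ^ (2 * μ) = ampPow B (tailSlope B k μ f x) := by
  have hm0 : 0 < remMass μ f 0 := hm ▸ tailMass_pos hB hk hμ (Ioo_subset_Ico_self ht)
  obtain ⟨X, hxX, hX⟩ := exists_remMass_eq h.continuous hμ (h.integrableOn_rpow (by linarith))
    (lt_min hpos (half_pos hm0)) (min_le_left _ _)
  have hXpos : 0 < remMass μ f X := hX ▸ lt_min hpos (half_pos hm0)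
  have hXlt : remMass μ f X < remMass μ f 0 :=
    (hX.trans_le (min_le_right _ _)).trans_lt (half_lt_self hm0)
  have hX0 : 0 < X := (hx.trans hxX).lt_of_ne fun h0 => hXlt.ne (h0 ▸ rfl)
  refine (h.eqOn_zero_or_forall_rpow_eq hB hk hμ ht hm he hX0 hXpos).resolve_left
    (fun hzero => hXlt.ne ?_) x ⟨hx, hxX⟩
  have hint : ∫ z in (0 : ℝ)..X, ‖f z‖ ^ (2 * μ + 2) = 0 := by
    refine intervalIntegral.integral_zero_ae (.of_forall fun z hz => ?_)
    rw [uIoc_of_le hX0.le] at hz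
    simp only [hzero (Ioc_subset_Icc_self hz), Pi.zero_apply, norm_zero]
    exact Real.zero_rpow (by positivity)
  rw [remMass_zero, remMass, hint, sub_zero]

theorem HalfLineH1.hasDerivAt_tailSlope_of_le (h : HalfLineH1 f g) (hB : 0 < B) (hk : 0 < k)
    (hμ : 0 < μ) (ht : t ∈ Ioo (-1 : ℝ) 1) (hm : remMass μ f 0 = tailMass B k μ t)
    (he : ∫ x in Ioi (0 : ℝ), (‖g x‖ ^ 2 + k ^ 2 * ‖f x‖ ^ 2) ≤ potential B k μ f 0)
    (hx : 0 ≤ x) (hpos : 0 < remMass μ f x) :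
    HasDerivAt (tailSlope B k μ f) (μ * k * (1 - tailSlope B k μ f x ^ 2)) x := by
  have hb := ampPow_pos hB (tailSlope_spec hB hk hμ h.continuous ht hm hx hpos).1
  have hamp := h.norm_rpow_eq_ampPow hB hk hμ ht hm he hx hpos
  have hsq : ‖f x‖ ^ (2 : ℝ) = ampPow B (tailSlope B k μ f x) ^ (1 / μ) := by
    rw [← hamp, ← Real.rpow_mul (norm_nonneg _)]
    congr 1
    field_simp
  refine (hasDerivAt_tailSlope hB hk hμ h.continuous ht hm hx hpos).congr_deriv ?_
  rw [Real.rpow_add_of_nonneg (norm_nonneg _) (by positivity) zero_le_two, hamp, hsq,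
    tailDensity, ← ampPow]
  nth_rewrite 1 [ampPow]
  field_simp

theorem HalfLineH1.tailSlope_eq_profileSlope (h : HalfLineH1 f g) (hB : 0 < B) (hk : 0 < k)
    (hμ : 0 < μ) (hm : remMass μ f 0 = tailMass B k μ (profileSlope k μ y 0))
    (he : ∫ x in Ioi (0 : ℝ), (‖g x‖ ^ 2 + k ^ 2 * ‖f x‖ ^ 2) ≤ potential B k μ f 0)
    (hx : 0 ≤ x) (hpos : 0 < remMass μ f x) :
    tailSlope B k μ f x = profileSlope k μ y x := by
  have ht := profileSlope_mem_Ioo (k := k) (μ := μ) y 0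
  have hsub := Icc_subset_remMass_pos hμ h.continuous hpos
  have hs : ∀ z ∈ Icc 0 x, tailSlope B k μ f z ∈ Ioo (-1 : ℝ) 1 := fun z hz =>
    (tailSlope_spec hB hk hμ h.continuous ht hm (hsub hz).1 (hsub hz).2).1
  have hA := artanh_eq_of_hasDerivAt hx hs fun z hz =>
    h.hasDerivAt_tailSlope_of_le hB hk hμ ht hm he (hsub hz).1 (hsub hz).2
  rw [tailSlope_zero hB hk hμ ht hm, profileSlope, Real.artanh_tanh] at hA
  rw [← Real.tanh_artanh (hs x (right_mem_Icc.2 hx)), hA, profileSlope]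
  ring_nf

theorem strictMono_profileSlope (hk : 0 < k) (hμ : 0 < μ) (y : ℝ) :
    StrictMono (profileSlope k μ y) := fun _ _ h => strictMono_tanh (by gcongr)

theorem HalfLineH1.remMass_pos (h : HalfLineH1 f g) (hB : 0 < B) (hk : 0 < k)
    (hμ : 0 < μ) (hm : remMass μ f 0 = tailMass B k μ (profileSlope k μ y 0))
    (he : ∫ x in Ioi (0 : ℝ), (‖g x‖ ^ 2 + k ^ 2 * ‖f x‖ ^ 2) ≤ potential B k μ f 0)
    (hx : 0 ≤ x) : 0 < remMass μ f x := by
  have hmem := fun z => profileSlope_mem_Ioo (k := k) (μ := μ) y z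
  have hle : tailMass B k μ (profileSlope k μ y x) ≤ remMass μ f 0 := hm ▸
    (strictAntiOn_tailMass hB hk hμ).antitoneOn (Ioo_subset_Icc_self (hmem 0))
      (Ioo_subset_Icc_self (hmem x)) ((strictMono_profileSlope hk hμ y).monotone hx)
  have hpos := tailMass_pos hB hk hμ (Ioo_subset_Ico_self (hmem x))
  obtain ⟨Y, hY, hYx⟩ := exists_remMass_eq h.continuous hμ (h.integrableOn_rpow (by linarith))
    hpos hle
  have hslope := h.tailSlope_eq_profileSlope hB hk hμ hm he hY (hYx ▸ hpos)
  rw [tailSlope, hYx, tailMassInv_tailMass hB hk hμ (Ioo_subset_Icc_self (hmem x))] at hslope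
  rw [(strictMono_profileSlope hk hμ y).injective hslope, hYx]
  exact hslope ▸ hpos

theorem HalfLineH1.exists_eq_tailProfile (h : HalfLineH1 f g) (hB : 0 < B) (hk : 0 < k)
    (hμ : 0 < μ) (hm : remMass μ f 0 = tailMass B k μ (profileSlope k μ y 0))
    (he : ∫ x in Ioi (0 : ℝ), (‖g x‖ ^ 2 + k ^ 2 * ‖f x‖ ^ 2) ≤ potential B k μ f 0) :
    ∃ u : E, ‖u‖ = 1 ∧ ∀ x, 0 ≤ x → f x = tailProfile B k μ y x • u := by
  have hpos := fun x => h.remMass_pos hB hk hμ hm he (x := x)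
  have ht := profileSlope_mem_Ioo (k := k) (μ := μ) y 0
  have hP := fun x => tailProfile_pos (k := k) (μ := μ) hB y x
  have hslope : ∀ x, 0 ≤ x → tailSlope B k μ f x = profileSlope k μ y x := fun x hx =>
    h.tailSlope_eq_profileSlope hB hk hμ hm he hx (hpos x hx)
  have hnorm : ‖f 0‖ = tailProfile B k μ y 0 := by
    have hamp := h.norm_rpow_eq_ampPow hB hk hμ ht hm he le_rfl (hpos 0 le_rfl)
    rw [hslope 0 le_rfl, ← tailProfile_rpow_two_mul hB hμ] at hamp
    exact (Real.rpow_left_inj (norm_nonneg _) (hP 0).le (by positivity)).1 hamp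
  refine ⟨(tailProfile B k μ y 0)⁻¹ • f 0, ?_, fun x hx => ?_⟩
  · rw [norm_smul, hnorm, Real.norm_of_nonneg (inv_nonneg.2 (hP 0).le),
      inv_mul_cancel₀ (hP 0).ne']
  have hinv : ∀ z ∈ Icc 0 x, HasDerivAt (fun z => (tailProfile B k μ y z)⁻¹)
      (k * profileSlope k μ y z * (tailProfile B k μ y z)⁻¹) z := fun z _ =>
    ((hasDerivAt_tailProfile hμ y z).inv (hP z).ne').congr_deriv (by
      have := (hP z).ne'
      field_simp)
  have hg : ∀ᵐ z, z ∈ Icc 0 x → g z = -(k * profileSlope k μ y z) • f z := by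
    rw [← ae_restrict_iff' measurableSet_Icc]
    filter_upwards [h.deficit_ae_eq_zero hB hk hμ ht hm he hx (hpos x hx),
      ae_restrict_mem measurableSet_Icc] with z hz hzI
    have hs := (tailSlope_spec hB hk hμ h.continuous ht hm hzI.1 (hpos z hzI.1)).1
    rw [← hslope z hzI.1]
    exact (eq_of_deficit_eq_zero hB hk hμ hs hz).1
  rw [← h.smul_eq_of_ae_eq_smul hx hinv
    ((continuous_profileSlope y).const_mul k).continuousOn hg, smul_inv_smul₀ (hP x).ne']

end Rigidity

section Splitting

variable {μ A d : ℝ}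

/-- The function whose values at the two slopes agree for a bound state. -/
def matching (μ t : ℝ) : ℝ := t ^ (2 * μ) - t ^ (2 * μ + 2)

/-- The logarithm of the ratio of `matching μ` at `(A + d)⁻¹` and at `(A - d)⁻¹`, written so that it
can be differentiated term by term. -/
def logRatio (μ A d : ℝ) : ℝ :=
  (Real.log (A - 1 + d) - Real.log (A - 1 - d)) + (Real.log (A + 1 + d) - Real.log (A + 1 - d)) -
    (2 * μ + 2) * (Real.log (A + d) - Real.log (A - d))

/-- The derivative of `logRatio` at `d`, up to the factor `(A² - d²) / 2`, as a function of
`z = d²`. -/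
def logRatioRate (μ A z : ℝ) : ℝ :=
  2 * A + (A - 1) * (2 * A - 1) / ((A - 1) ^ 2 - z) - (A + 1) * (2 * A + 1) / ((A + 1) ^ 2 - z) -
    2 * (μ + 1) * A

theorem matching_inv {u : ℝ} (hu : 0 < u) :
    matching μ u⁻¹ = (u - 1) * (u + 1) * u ^ (-(2 * μ + 2)) := by
  have hpow : u ^ (-(2 * μ)) = u ^ (-(2 * μ + 2)) * u ^ 2 := by
    rw [← Real.rpow_natCast u 2, ← Real.rpow_add hu]
    congr 1
    push_cast
    ring
  rw [matching, Real.inv_rpow hu.le, Real.inv_rpow hu.le, ← Real.rpow_neg hu.le,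
    ← Real.rpow_neg hu.le, hpow]
  ring

theorem matching_inv_pos {u : ℝ} (hu : 1 < u) : 0 < matching μ u⁻¹ := by
  have hu₀ : 0 < u := by linarith
  have hu₁ : 0 < u - 1 := by linarith
  rw [matching_inv hu₀]
  exact mul_pos (mul_pos hu₁ (by positivity)) (Real.rpow_pos_of_pos hu₀ _)

theorem log_matching_inv {u : ℝ} (hu : 1 < u) :
    Real.log (matching μ u⁻¹) =
      Real.log (u - 1) + Real.log (u + 1) - (2 * μ + 2) * Real.log u := by
  have hu₀ : 0 < u := by linarith
  have hu₁ : u - 1 ≠ 0 := by linarith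
  rw [matching_inv hu₀, Real.log_mul (by positivity) (Real.rpow_pos_of_pos hu₀ _).ne',
    Real.log_mul hu₁ (by positivity), Real.log_rpow hu₀]
  ring

theorem logRatio_eq (h₁ : 1 < A + d) (h₂ : 1 < A - d) :
    logRatio μ A d = Real.log (matching μ (A + d)⁻¹) - Real.log (matching μ (A - d)⁻¹) := by
  rw [log_matching_inv h₁, log_matching_inv h₂, logRatio]
  ring_nf

theorem logRatio_zero : logRatio μ A 0 = 0 := by simp [logRatio]

theorem logRatio_pos_iff (h₁ : 1 < A + d) (h₂ : 1 < A - d) :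
    0 < logRatio μ A d ↔ matching μ (A - d)⁻¹ < matching μ (A + d)⁻¹ := by
  rw [logRatio_eq h₁ h₂, sub_pos,
    Real.log_lt_log_iff (matching_inv_pos h₂) (matching_inv_pos h₁)]

theorem logRatio_neg_iff (h₁ : 1 < A + d) (h₂ : 1 < A - d) :
    logRatio μ A d < 0 ↔ matching μ (A + d)⁻¹ < matching μ (A - d)⁻¹ := by
  rw [logRatio_eq h₁ h₂, sub_neg,
    Real.log_lt_log_iff (matching_inv_pos h₁) (matching_inv_pos h₂)]

theorem logRatio_eq_zero_iff (h₁ : 1 < A + d) (h₂ : 1 < A - d) :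
    logRatio μ A d = 0 ↔ matching μ (A + d)⁻¹ = matching μ (A - d)⁻¹ := by
  rw [logRatio_eq h₁ h₂, sub_eq_zero]
  exact Real.log_injOn_pos.eq_iff (matching_inv_pos h₁) (matching_inv_pos h₂)

theorem hasDerivAt_logRatio (h₁ : 1 < A + d) (h₂ : 1 < A - d) :
    HasDerivAt (logRatio μ A) (2 / (A ^ 2 - d ^ 2) * logRatioRate μ A (d ^ 2)) d := by
  have hlog : ∀ a : ℝ, 0 < a + d → 0 < a - d →
      HasDerivAt (fun d => Real.log (a + d) - Real.log (a - d)) (1 / (a + d) - -1 / (a - d)) d :=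
    fun a ha hb => (((hasDerivAt_id' d).const_add a).log ha.ne').sub
      (((hasDerivAt_id' d).const_sub a).log hb.ne')
  have h := ((hlog (A - 1) (by linarith) (by linarith)).add
    (hlog (A + 1) (by linarith) (by linarith))).sub
    ((hlog A (by linarith) (by linarith)).const_mul (2 * μ + 2))
  refine h.congr_deriv ?_
  have p₁ : A - 1 + d ≠ 0 := by linarith
  have p₂ : A - 1 - d ≠ 0 := by linarith
  have p₃ : A + 1 + d ≠ 0 := by linarith
  have p₄ : A + 1 - d ≠ 0 := by linarith
  have p₅ : A + d ≠ 0 := by linarith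
  have p₆ : A - d ≠ 0 := by linarith
  rw [logRatioRate, show (A - 1) ^ 2 - d ^ 2 = (A - 1 + d) * (A - 1 - d) by ring,
    show (A + 1) ^ 2 - d ^ 2 = (A + 1 + d) * (A + 1 - d) by ring,
    show A ^ 2 - d ^ 2 = (A + d) * (A - d) by ring]
  field_simp
  ring

theorem continuousOn_logRatio : ContinuousOn (logRatio μ A) (Ico 0 (A - 1)) := fun d hd =>
  (hasDerivAt_logRatio (by linarith [hd.1, hd.2])
    (by linarith [hd.2])).continuousAt.continuousWithinAt

theorem logRatioRate_zero (hA : 1 < A) :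
    logRatioRate μ A 0 = 2 * A / (A ^ 2 - 1) * (1 - μ * (A ^ 2 - 1)) := by
  have p₁ : A - 1 ≠ 0 := by linarith
  have p₂ : A + 1 ≠ 0 := by linarith
  rw [logRatioRate, sub_zero, sub_zero, show A ^ 2 - 1 = (A + 1) * (A - 1) by ring]
  field_simp
  ring

theorem hasDerivAt_logRatioRate {z : ℝ} (hA : 1 < A) (hz : z < (A - 1) ^ 2) :
    HasDerivAt (logRatioRate μ A)
      ((A - 1) * (2 * A - 1) / ((A - 1) ^ 2 - z) ^ 2 -
        (A + 1) * (2 * A + 1) / ((A + 1) ^ 2 - z) ^ 2) z := by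
  have hdiv : ∀ a c : ℝ, a ^ 2 - z ≠ 0 →
      HasDerivAt (fun z => c / (a ^ 2 - z)) (c / (a ^ 2 - z) ^ 2) z := fun a c ha =>
    ((hasDerivAt_const z c).fun_div ((hasDerivAt_id' z).const_sub (a ^ 2)) ha).congr_deriv
      (by ring)
  exact (((hdiv (A - 1) _ (by linarith)).const_add (2 * A)).sub
    (hdiv (A + 1) _ (by nlinarith))).sub_const _

theorem strictMonoOn_logRatioRate (hA : 1 < A) :
    StrictMonoOn (logRatioRate μ A) (Ico 0 ((A - 1) ^ 2)) := by
  refine strictMonoOn_of_deriv_pos (convex_Ico _ _) (fun z hz =>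
    (hasDerivAt_logRatioRate hA hz.2).continuousAt.continuousWithinAt) fun z hz => ?_
  rw [interior_Ico] at hz
  rw [(hasDerivAt_logRatioRate hA hz.2).deriv, sub_pos]
  have ha : 0 < A - 1 := by linarith
  have hb : 0 < A + 1 := by linarith
  have hza : 0 < (A - 1) ^ 2 - z := by linarith [hz.2]
  have hzb : 0 < (A + 1) ^ 2 - z := by nlinarith
  have hcross : ((A - 1) ^ 2 - z) * (A + 1) ^ 2 ≤ ((A + 1) ^ 2 - z) * (A - 1) ^ 2 := by
    nlinarith [mul_pos hz.1 (by linarith : 0 < 4 * A)]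
  have hcube : (2 * A + 1) * (A - 1) ^ 3 < (2 * A - 1) * (A + 1) ^ 3 := by
    nlinarith [mul_pos ha ha, mul_pos ha (mul_pos ha ha)]
  rw [div_lt_div_iff₀ (by positivity) (by positivity)]
  refine lt_of_mul_lt_mul_right ?_ (pow_pos hb 4).le
  calc (A + 1) * (2 * A + 1) * ((A - 1) ^ 2 - z) ^ 2 * (A + 1) ^ 4
      = (A + 1) * (2 * A + 1) * (((A - 1) ^ 2 - z) * (A + 1) ^ 2) ^ 2 := by ring
    _ ≤ (A + 1) * (2 * A + 1) * (((A + 1) ^ 2 - z) * (A - 1) ^ 2) ^ 2 := by gcongr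
    _ = (2 * A + 1) * (A - 1) ^ 3 * ((A + 1) * (A - 1) * ((A + 1) ^ 2 - z) ^ 2) := by ring
    _ < (2 * A - 1) * (A + 1) ^ 3 * ((A + 1) * (A - 1) * ((A + 1) ^ 2 - z) ^ 2) := by gcongr
    _ = (A - 1) * (2 * A - 1) * ((A + 1) ^ 2 - z) ^ 2 * (A + 1) ^ 4 := by ring

theorem logRatioRate_sq_lt {c : ℝ} (hA : 1 < A) (hc : 0 ≤ c) (hcd : c < d) (hd : d < A - 1) :
    logRatioRate μ A (c ^ 2) < logRatioRate μ A (d ^ 2) :=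
  strictMonoOn_logRatioRate hA ⟨by positivity, by nlinarith⟩ ⟨by positivity, by nlinarith⟩
    (by nlinarith)

theorem two_div_sq_sub_sq_pos (hd₀ : 0 ≤ d) (hd : d < A - 1) : 0 < 2 / (A ^ 2 - d ^ 2) := by
  have : 0 < A ^ 2 - d ^ 2 := by nlinarith
  positivity

theorem strictMonoOn_logRatio {c : ℝ} (hA : 1 < A) (hc : 0 ≤ c)
    (h : 0 ≤ logRatioRate μ A (c ^ 2)) : StrictMonoOn (logRatio μ A) (Ico c (A - 1)) := by
  refine strictMonoOn_of_deriv_pos (convex_Ico _ _)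
    (continuousOn_logRatio.mono (Ico_subset_Ico_left hc)) fun d hd => ?_
  rw [interior_Ico] at hd
  have hd₀ := hc.trans_lt hd.1
  rw [(hasDerivAt_logRatio (by linarith [hd.2]) (by linarith [hd.2])).deriv]
  exact mul_pos (two_div_sq_sub_sq_pos hd₀.le hd.2)
    (h.trans_lt (logRatioRate_sq_lt hA hc hd.1 hd.2))

theorem strictAntiOn_logRatio {c : ℝ} (hA : 1 < A) (hc : c < A - 1)
    (h : logRatioRate μ A (c ^ 2) ≤ 0) : StrictAntiOn (logRatio μ A) (Icc 0 c) := by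
  refine strictAntiOn_of_deriv_neg (convex_Icc _ _)
    (continuousOn_logRatio.mono (Icc_subset_Ico_right hc)) fun d hd => ?_
  rw [interior_Icc] at hd
  rw [(hasDerivAt_logRatio (by linarith [hd.1, hd.2]) (by linarith [hd.2])).deriv]
  exact mul_neg_of_pos_of_neg (two_div_sq_sub_sq_pos hd.1.le (hd.2.trans hc))
    ((logRatioRate_sq_lt hA hd.1.le hd.2 hc).trans_le h)

theorem logRatio_pos (hA : 1 < A) (h : μ * (A ^ 2 - 1) ≤ 1) (hd : d ∈ Ioo 0 (A - 1)) :
    0 < logRatio μ A d := by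
  have hrate : 0 ≤ logRatioRate μ A (0 ^ 2) := by
    rw [zero_pow two_ne_zero, logRatioRate_zero hA]
    have : 0 < A ^ 2 - 1 := by nlinarith
    have : 0 ≤ 1 - μ * (A ^ 2 - 1) := by linarith
    positivity
  simpa only [logRatio_zero] using strictMonoOn_logRatio hA le_rfl hrate
    ⟨le_rfl, hd.1.trans hd.2⟩ (Ioo_subset_Ico_self hd) hd.1

-- By Rolle, `logRatio` has a critical point `c` in `(0, d₀)`; as `logRatioRate` increases, it
-- decreases before `c` and increases after `c`.
theorem logRatio_neg_and_pos_of_eq_zero {d₀ : ℝ} (hA : 1 < A) (hd₀ : d₀ ∈ Ioo 0 (A - 1))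
    (hz : logRatio μ A d₀ = 0) :
    (∀ d ∈ Ioo 0 d₀, logRatio μ A d < 0) ∧ ∀ d ∈ Ioo d₀ (A - 1), 0 < logRatio μ A d := by
  obtain ⟨c, hc, hc₀⟩ := exists_hasDerivAt_eq_zero hd₀.1
    (continuousOn_logRatio.mono (Icc_subset_Ico_right hd₀.2)) (by rw [logRatio_zero, hz])
    (fun x hx => hasDerivAt_logRatio (μ := μ) (A := A) (by linarith [hx.1, hx.2, hd₀.2])
      (by linarith [hx.2, hd₀.2]))
  have hcA : c < A - 1 := hc.2.trans hd₀.2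
  have hrate : logRatioRate μ A (c ^ 2) = 0 :=
    (mul_eq_zero.1 hc₀).resolve_left (two_div_sq_sub_sq_pos hc.1.le hcA).ne'
  have hanti := strictAntiOn_logRatio hA hcA hrate.le
  have hmono := strictMonoOn_logRatio hA hc.1.le hrate.ge
  refine ⟨fun d hd => ?_, fun d hd => ?_⟩
  · rcases le_or_gt d c with hdc | hdc
    · exact (hanti ⟨le_rfl, hc.1.le⟩ ⟨hd.1.le, hdc⟩ hd.1).trans_eq logRatio_zero
    · exact (hmono ⟨hdc.le, hd.2.trans hd₀.2⟩ ⟨hc.2.le, hd₀.2⟩ hd.2).trans_eq hz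
  · exact hz.symm.trans_lt (hmono ⟨hc.2.le, hd₀.2⟩ ⟨(hc.2.trans hd.1).le, hd.2⟩ hd.1)

theorem exists_logRatio_neg (hA : 1 < A) (h : 1 < μ * (A ^ 2 - 1)) :
    ∃ d ∈ Ioo 0 (A - 1), logRatio μ A d < 0 := by
  have hA₁ : 0 < A - 1 := by linarith
  have hrate : logRatioRate μ A (0 ^ 2) < 0 := by
    rw [zero_pow two_ne_zero, logRatioRate_zero hA]
    have : 0 < A ^ 2 - 1 := by nlinarith
    exact mul_neg_of_pos_of_neg (by positivity) (by linarith)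
  have hcont : ContinuousAt (fun d => logRatioRate μ A (d ^ 2)) 0 :=
    (hasDerivAt_logRatioRate hA (by nlinarith)).continuousAt.comp (by fun_prop)
  obtain ⟨d, hd, hdA⟩ := (((hcont.eventually_lt_const hrate).filter_mono
    nhdsWithin_le_nhds).and (Ioo_mem_nhdsGT hA₁)).exists
  exact ⟨d, hdA, (strictAntiOn_logRatio hA hdA.2 hd.le ⟨le_rfl, hdA.1.le⟩ ⟨hdA.1.le, le_rfl⟩
    hdA.1).trans_eq logRatio_zero⟩

theorem tendsto_logRatio_atTop (hA : 1 < A) :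
    Tendsto (logRatio μ A) (𝓝[<] (A - 1)) atTop := by
  have hsub : Tendsto (fun d => A - 1 - d) (𝓝[<] (A - 1)) (𝓝[≠] 0) := by
    refine tendsto_nhdsWithin_iff.2 ⟨?_, ?_⟩
    · exact ((by fun_prop : Continuous fun d => A - 1 - d).tendsto' _ _ (sub_self _)).mono_left
        nhdsWithin_le_nhds
    · filter_upwards [self_mem_nhdsWithin] with x hx using (sub_pos.2 hx).ne'
  have hsing : Tendsto (fun d => -Real.log (A - 1 - d)) (𝓝[<] (A - 1)) atTop :=
    tendsto_neg_atBot_atTop.comp (Real.tendsto_log_nhdsNE_zero.comp hsub)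
  have hreg : ContinuousAt (fun d => Real.log (A - 1 + d) +
      (Real.log (A + 1 + d) - Real.log (A + 1 - d)) -
      (2 * μ + 2) * (Real.log (A + d) - Real.log (A - d))) (A - 1) := by
    fun_prop (disch := grind)
  refine (hsing.atTop_add (hreg.tendsto.mono_left nhdsWithin_le_nhds)).congr fun d => ?_
  rw [logRatio]
  ring

theorem exists_logRatio_eq_zero (hA : 1 < A) (h : 1 < μ * (A ^ 2 - 1)) :
    ∃ d ∈ Ioo 0 (A - 1), logRatio μ A d = 0 := by
  obtain ⟨a, ha, ha₀⟩ := exists_logRatio_neg hA h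
  obtain ⟨b, hb₀, hb⟩ := (((tendsto_logRatio_atTop (μ := μ) hA).eventually_gt_atTop 0).and
    (Ioo_mem_nhdsLT ha.2)).exists
  obtain ⟨d, hd, hd₀⟩ := intermediate_value_Icc hb.1.le
    (continuousOn_logRatio.mono fun x hx => ⟨ha.1.le.trans hx.1, hx.2.trans_lt hb.2⟩)
    ⟨ha₀.le, hb₀.le⟩
  exact ⟨d, ⟨ha.1.trans_le hd.1, hd.2.trans_lt hb.2⟩, hd₀⟩

theorem eq_of_logRatio_eq_zero {d₁ d₂ : ℝ} (hA : 1 < A) (h₁ : d₁ ∈ Ioo 0 (A - 1))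
    (h₂ : d₂ ∈ Ioo 0 (A - 1)) (hz₁ : logRatio μ A d₁ = 0) (hz₂ : logRatio μ A d₂ = 0) :
    d₁ = d₂ := by
  have hsign := logRatio_neg_and_pos_of_eq_zero hA h₁ hz₁
  rcases lt_trichotomy d₁ d₂ with h | h | h
  · exact absurd hz₂ (hsign.2 d₂ ⟨h, h₂.2⟩).ne'
  · exact h
  · exact absurd hz₂ (hsign.1 d₂ ⟨h₂.1, h⟩).ne

end Splitting

section SplitMass

variable {B k μ A c d : ℝ}

/-- The total power norm of a pair of tail profiles with slopes `(A + d)⁻¹` and `(A - d)⁻¹`. -/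
def splitMass (B k μ A d : ℝ) : ℝ := tailMass B k μ (A + d)⁻¹ + tailMass B k μ (A - d)⁻¹

theorem continuousOn_splitMass (hμ : 0 < μ) :
    ContinuousOn (splitMass B k μ A) (Icc (-(A - 1)) (A - 1)) := by
  have hM := continuous_tailMass (B := B) (k := k) hμ
  refine (hM.comp_continuousOn (ContinuousOn.inv₀ (by fun_prop) fun d hd => ?_)).add
    (hM.comp_continuousOn (ContinuousOn.inv₀ (by fun_prop) fun d hd => ?_))
  · linarith [hd.1]
  · linarith [hd.2]

theorem splitMass_neg (d : ℝ) : splitMass B k μ A (-d) = splitMass B k μ A d := by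
  rw [splitMass, splitMass, sub_neg_eq_add, ← sub_eq_add_neg, add_comm]

theorem splitMass_abs (d : ℝ) : splitMass B k μ A |d| = splitMass B k μ A d := by
  rcases abs_choice d with h | h <;> rw [h]
  exact splitMass_neg d

theorem inv_mem_Ioo_of_one_lt {u : ℝ} (hu : 1 < u) : u⁻¹ ∈ Ioo (-1 : ℝ) 1 :=
  ⟨by linarith [inv_pos.2 (zero_lt_one.trans hu)], inv_lt_one_of_one_lt₀ hu⟩

theorem sq_mul_ampPow_rpow {t : ℝ} (hB : 0 < B) (hμ : 0 < μ) (ht : t ∈ Ioo (0 : ℝ) 1) :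
    t ^ 2 * ampPow B t ^ (1 / μ) = (B * matching μ t) ^ (1 / μ) := by
  have hb := ampPow_pos hB (Ioo_subset_Ioo_left (by norm_num) ht)
  have hmatch : B * matching μ t = (t ^ 2) ^ μ * ampPow B t := by
    rw [matching, ampPow, ← Real.rpow_natCast, ← Real.rpow_mul ht.1.le, Real.rpow_add ht.1]
    push_cast
    rw [Real.rpow_two]
    ring
  rw [hmatch, Real.mul_rpow (by positivity) hb.le, ← Real.rpow_mul (by positivity),
    mul_one_div_cancel hμ.ne', Real.rpow_one]

theorem tailDensity_inv_div_sq {u : ℝ} (hB : 0 < B) (hμ : 0 < μ) (hu : 1 < u) :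
    tailDensity B k μ u⁻¹ / u ^ 2 =
      B / (μ * k) * B ^ (1 / μ) * matching μ u⁻¹ ^ (1 / μ) := by
  have hsq := sq_mul_ampPow_rpow hB hμ
    ⟨inv_pos.2 (zero_lt_one.trans hu), inv_lt_one_of_one_lt₀ hu⟩
  rw [mul_assoc, ← Real.mul_rpow hB.le (matching_inv_pos hu).le, ← hsq, tailDensity, ampPow]
  ring

theorem hasDerivAt_splitMass (hB : 0 < B) (hμ : 0 < μ) (h₁ : 1 < A + d) (h₂ : 1 < A - d) :
    HasDerivAt (splitMass B k μ A) (B / (μ * k) * B ^ (1 / μ) *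
      (matching μ (A + d)⁻¹ ^ (1 / μ) - matching μ (A - d)⁻¹ ^ (1 / μ))) d := by
  have hinv₁ := ((hasDerivAt_id' d).const_add A).fun_inv (by linarith)
  have hinv₂ := ((hasDerivAt_id' d).const_sub A).fun_inv (by linarith)
  have h := ((hasStrictDerivAt_tailMass (B := B) (k := k) hμ (A + d)⁻¹).hasDerivAt.comp d
    hinv₁).add ((hasStrictDerivAt_tailMass (B := B) (k := k) hμ (A - d)⁻¹).hasDerivAt.comp d hinv₂)
  refine h.congr_deriv ?_
  rw [mul_sub, ← tailDensity_inv_div_sq hB hμ h₁, ← tailDensity_inv_div_sq hB hμ h₂]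
  ring

theorem strictMonoOn_splitMass (hB : 0 < B) (hk : 0 < k) (hμ : 0 < μ) (hA : 1 < A) (hc : 0 ≤ c)
    (h : ∀ d ∈ Ioo c (A - 1), 0 < logRatio μ A d) :
    StrictMonoOn (splitMass B k μ A) (Icc c (A - 1)) := by
  refine strictMonoOn_of_deriv_pos (convex_Icc _ _)
    ((continuousOn_splitMass hμ).mono (Icc_subset_Icc_left (by linarith))) fun d hd => ?_
  rw [interior_Icc] at hd
  have h₁ : 1 < A + d := by linarith [hd.1]
  have h₂ : 1 < A - d := by linarith [hd.2]
  rw [(hasDerivAt_splitMass hB hμ h₁ h₂).deriv]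
  exact mul_pos (by positivity) (sub_pos.2 (Real.rpow_lt_rpow (matching_inv_pos h₂).le
    ((logRatio_pos_iff h₁ h₂).1 (h d hd)) (by positivity)))

theorem strictAntiOn_splitMass (hB : 0 < B) (hk : 0 < k) (hμ : 0 < μ) (hA : 1 < A)
    (hc : c ≤ A - 1) (h : ∀ d ∈ Ioo 0 c, logRatio μ A d < 0) :
    StrictAntiOn (splitMass B k μ A) (Icc 0 c) := by
  refine strictAntiOn_of_deriv_neg (convex_Icc _ _)
    ((continuousOn_splitMass hμ).mono (Icc_subset_Icc (by linarith) hc)) fun d hd => ?_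
  rw [interior_Icc] at hd
  have h₁ : 1 < A + d := by linarith [hd.1]
  have h₂ : 1 < A - d := by linarith [hd.2]
  rw [(hasDerivAt_splitMass hB hμ h₁ h₂).deriv]
  exact mul_neg_of_pos_of_neg (by positivity) (sub_neg.2 (Real.rpow_lt_rpow
    (matching_inv_pos h₁).le ((logRatio_neg_iff h₁ h₂).1 (h d hd)) (by positivity)))

theorem splitMass_zero_lt (hB : 0 < B) (hk : 0 < k) (hμ : 0 < μ) (hA : 1 < A)
    (h : μ * (A ^ 2 - 1) ≤ 1) (hd : |d| ≤ A - 1) (hd₀ : d ≠ 0) :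
    splitMass B k μ A 0 < splitMass B k μ A d := by
  rw [← splitMass_abs d]
  exact strictMonoOn_splitMass hB hk hμ hA le_rfl (fun d hd => logRatio_pos hA h hd)
    ⟨le_rfl, by linarith⟩ ⟨abs_nonneg d, hd⟩ (abs_pos.2 hd₀)

theorem splitMass_lt_of_logRatio_eq_zero {d₀ : ℝ} (hB : 0 < B) (hk : 0 < k) (hμ : 0 < μ)
    (hA : 1 < A) (hd₀ : d₀ ∈ Ioo 0 (A - 1)) (hz : logRatio μ A d₀ = 0) (hd : |d| ≤ A - 1)
    (hne : |d| ≠ d₀) : splitMass B k μ A d₀ < splitMass B k μ A d := by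
  obtain ⟨hneg, hpos⟩ := logRatio_neg_and_pos_of_eq_zero hA hd₀ hz
  rw [← splitMass_abs d]
  rcases lt_or_gt_of_ne hne with h | h
  · exact strictAntiOn_splitMass hB hk hμ hA hd₀.2.le hneg ⟨abs_nonneg d, h.le⟩
      ⟨hd₀.1.le, le_rfl⟩ h
  · exact strictMonoOn_splitMass hB hk hμ hA hd₀.1.le hpos ⟨le_rfl, hd₀.2.le⟩ ⟨h.le, hd⟩ h

end SplitMass

section HalfLineBound

variable {E : Type*} [NormedAddCommGroup E] {f g : ℝ → E} {B k μ t r : ℝ}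

theorem tailMass_nonneg (hB : 0 < B) (hk : 0 < k) (hμ : 0 < μ) (ht : t ∈ Icc (-1 : ℝ) 1) :
    0 ≤ tailMass B k μ t :=
  tailMass_one.symm.trans_le <|
    (strictAntiOn_tailMass hB hk hμ).antitoneOn ht ⟨by norm_num, le_rfl⟩ ht.2

theorem HalfLineH1.const_smul [NormedSpace ℝ E] (h : HalfLineH1 f g) (c : ℝ) :
    HalfLineH1 (fun x => c • f x) (fun x => c • g x) where
  continuous := h.continuous.const_smul c
  memLp_deriv := h.memLp_deriv.const_smul c
  eq_add_integral x hx := by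
    rw [intervalIntegral.integral_smul, h.eq_add_integral x hx, smul_add]
  memLp := h.memLp.const_smul c

variable [InnerProductSpace ℝ E] [CompleteSpace E]

theorem HalfLineH1.tailMass_le_action (h : HalfLineH1 f g) (hB : 0 < B) (hk : 0 < k) (hμ : 0 < μ)
    (ht : t ∈ Ioc (-1 : ℝ) 1)
    (hm : ∫ x in Ioi (0 : ℝ), ‖f x‖ ^ (2 * μ + 2) = tailMass B k μ t) :
    k * t * ‖f 0‖ ^ 2 + (μ + 1) * k ^ 2 / B * tailMass B k μ t ≤
      ∫ x in Ioi (0 : ℝ), (‖g x‖ ^ 2 + k ^ 2 * ‖f x‖ ^ 2) := by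
  rw [← remMass_zero] at hm
  rcases ht.2.eq_or_lt with rfl | ht₁
  · simpa [tailMass_one] using h.mul_norm_sq_le k le_rfl
  · rw [← potential_zero hB hk hμ ⟨ht.1, ht₁⟩ hm]
    exact h.potential_le_action hB hk hμ ⟨ht.1, ht₁⟩ hm

theorem HalfLineH1.scaled_tailMass_le_action (h : HalfLineH1 f g) (hB : 0 < B) (hk : 0 < k)
    (hμ : 0 < μ) (ht : t ∈ Ioc (-1 : ℝ) 1) (hr : 0 < r)
    (hm : ∫ x in Ioi (0 : ℝ), ‖f x‖ ^ (2 * μ + 2) = r ^ (2 * μ + 2) * tailMass B k μ t) :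
    k * t * ‖f 0‖ ^ 2 + r ^ 2 * ((μ + 1) * k ^ 2 / B * tailMass B k μ t) ≤
      ∫ x in Ioi (0 : ℝ), (‖g x‖ ^ 2 + k ^ 2 * ‖f x‖ ^ 2) := by
  have hn (z : E) : ‖r⁻¹ • z‖ = r⁻¹ * ‖z‖ := by
    rw [norm_smul, Real.norm_of_nonneg (inv_nonneg.2 hr.le)]
  have hm' : ∫ x in Ioi (0 : ℝ), ‖r⁻¹ • f x‖ ^ (2 * μ + 2) = tailMass B k μ t := by
    simp only [hn, Real.mul_rpow (inv_nonneg.2 hr.le) (norm_nonneg _), Real.inv_rpow hr.le]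
    rw [integral_const_mul, hm, inv_mul_cancel_left₀ (Real.rpow_pos_of_pos hr _).ne']
  have hle := (h.const_smul r⁻¹).tailMass_le_action hB hk hμ ht hm'
  have hscale : ∫ x in Ioi (0 : ℝ), (‖r⁻¹ • g x‖ ^ 2 + k ^ 2 * ‖r⁻¹ • f x‖ ^ 2) =
      (r ^ 2)⁻¹ * ∫ x in Ioi (0 : ℝ), (‖g x‖ ^ 2 + k ^ 2 * ‖f x‖ ^ 2) := by
    rw [← integral_const_mul]
    congr with x
    rw [hn, hn]
    ring
  rw [hscale, hn, le_inv_mul_iff₀ (by positivity)] at hle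
  calc _ = r ^ 2 * (k * t * (r⁻¹ * ‖f 0‖) ^ 2 + (μ + 1) * k ^ 2 / B * tailMass B k μ t) := by
        field_simp
    _ ≤ _ := hle

end HalfLineBound

section BoundaryPairing

variable {E : Type*} [NormedAddCommGroup E] {k A d : ℝ}

theorem mul_add_norm_sq_le (hk : 0 < k) (hd : |d| < A) (a b : E) :
    k / (2 * A) * (‖a‖ + ‖b‖) ^ 2 ≤ k * (A + d)⁻¹ * ‖a‖ ^ 2 + k * (A - d)⁻¹ * ‖b‖ ^ 2 := by
  obtain ⟨hd₁, hd₂⟩ := abs_lt.1 hd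
  have : 0 < A + d := by linarith
  have : 0 < A - d := by linarith
  have : 0 < A := by linarith
  rw [← sub_nonneg]
  calc 0 ≤ k / (2 * A) * (((A - d) * ‖a‖ - (A + d) * ‖b‖) ^ 2 / ((A + d) * (A - d))) := by
        positivity
    _ = _ := by
        field_simp
        ring

theorem mul_norm_sub_sq_le (hk : 0 < k) (hd : |d| < A) (a b : E) :
    k / (2 * A) * ‖a - b‖ ^ 2 ≤ k * (A + d)⁻¹ * ‖a‖ ^ 2 + k * (A - d)⁻¹ * ‖b‖ ^ 2 := by
  have hA : 0 < A := (abs_nonneg d).trans_lt hd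
  refine le_trans ?_ (mul_add_norm_sq_le hk hd a b)
  gcongr
  exact norm_sub_le a b

theorem norm_sub_eq_of_le_mul_norm_sub_sq (hk : 0 < k) (hd : |d| < A) {a b : E}
    (h : k * (A + d)⁻¹ * ‖a‖ ^ 2 + k * (A - d)⁻¹ * ‖b‖ ^ 2 ≤ k / (2 * A) * ‖a - b‖ ^ 2) :
    ‖a - b‖ = ‖a‖ + ‖b‖ := by
  have hA : 0 < A := (abs_nonneg d).trans_lt hd
  refine (norm_sub_le a b).antisymm <| (sq_le_sq₀ (by positivity) (norm_nonneg _)).1 ?_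
  exact le_of_mul_le_mul_left ((mul_add_norm_sq_le hk hd a b).trans h) (by positivity)

theorem eq_neg_of_norm_smul_sub_smul_eq [NormedSpace ℝ E] [StrictConvexSpace ℝ E] {u v : E}
    {p q : ℝ} (hu : ‖u‖ = 1) (hv : ‖v‖ = 1) (hp : 0 < p) (hq : 0 < q)
    (h : ‖p • u - q • v‖ = ‖p • u‖ + ‖q • v‖) : v = -u := by
  have hray : SameRay ℝ (p • u) (q • -v) := by
    rw [sameRay_iff_norm_add, smul_neg, norm_neg, ← sub_eq_add_neg, h]
  have hray' : SameRay ℝ u (-v) := by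
    simpa only [inv_smul_smul₀ hp.ne', inv_smul_smul₀ hq.ne'] using
      (hray.pos_smul_left (inv_pos.2 hp)).pos_smul_right (inv_pos.2 hq)
  rw [hray'.eq_of_norm_eq (by rw [norm_neg, hu, hv]), neg_neg]

end BoundaryPairing

section MassSplitting

variable {B k μ A d r m₁ m₂ : ℝ}

theorem inv_mem_Ioc_of_one_le {u : ℝ} (hu : 1 ≤ u) : u⁻¹ ∈ Ioc (0 : ℝ) 1 :=
  ⟨inv_pos.2 (zero_lt_one.trans_le hu), inv_le_one_of_one_le₀ hu⟩

theorem one_le_add_sub_of_abs_le (hd : |d| ≤ A - 1) : 1 ≤ A + d ∧ 1 ≤ A - d :=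
  ⟨by linarith [(abs_le.1 hd).1], by linarith [(abs_le.1 hd).2]⟩

theorem one_lt_add_sub_of_abs_lt (hd : |d| < A - 1) : 1 < A + d ∧ 1 < A - d :=
  ⟨by linarith [(abs_lt.1 hd).1], by linarith [(abs_lt.1 hd).2]⟩

theorem tailMass_inv_nonneg (hB : 0 < B) (hk : 0 < k) (hμ : 0 < μ) {u : ℝ} (hu : 1 ≤ u) :
    0 ≤ tailMass B k μ u⁻¹ :=
  have h := inv_mem_Ioc_of_one_le hu
  tailMass_nonneg hB hk hμ ⟨by linarith [h.1], h.2⟩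

theorem tailMass_inv_pos (hB : 0 < B) (hk : 0 < k) (hμ : 0 < μ) {u : ℝ} (hu : 1 < u) :
    0 < tailMass B k μ u⁻¹ :=
  tailMass_pos hB hk hμ (Ioo_subset_Ico_self (inv_mem_Ioo_of_one_lt hu))

theorem splitMass_pos (hB : 0 < B) (hk : 0 < k) (hμ : 0 < μ) (hA : 1 < A) (hd : |d| ≤ A - 1) :
    0 < splitMass B k μ A d := by
  rw [← splitMass_abs]
  exact add_pos_of_pos_of_nonneg (tailMass_inv_pos hB hk hμ (by linarith [abs_nonneg d]))
    (tailMass_inv_nonneg hB hk hμ (by linarith))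

theorem exists_mul_tailMass_eq (hB : 0 < B) (hk : 0 < k) (hμ : 0 < μ) (hA : 1 < A)
    (h₁ : 0 ≤ m₁) (h₂ : 0 ≤ m₂) :
    ∃ d, |d| ≤ A - 1 ∧ m₁ * tailMass B k μ (A - d)⁻¹ = m₂ * tailMass B k μ (A + d)⁻¹ := by
  have hcont : ContinuousOn
      (fun d => m₁ * tailMass B k μ (A - d)⁻¹ - m₂ * tailMass B k μ (A + d)⁻¹)
      (Icc (-(A - 1)) (A - 1)) := by
    refine (continuousOn_const.mul ?_).sub (continuousOn_const.mul ?_) <;>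
      refine (continuous_tailMass hμ).comp_continuousOn
        (ContinuousOn.inv₀ (by fun_prop) fun d hd => ?_)
    · linarith [hd.2]
    · linarith [hd.1]
  have hpos := mul_nonneg h₁ (tailMass_inv_nonneg hB hk hμ (u := A + (A - 1)) (by linarith))
  have hneg := mul_nonneg h₂ (tailMass_inv_nonneg hB hk hμ (u := A + (A - 1)) (by linarith))
  obtain ⟨d, hd, hzero⟩ := intermediate_value_Icc' (by linarith) hcont
    (show (0 : ℝ) ∈ Icc _ _ by
      constructor
      · simpa [tailMass_one] using hneg
      · rw [sub_neg_eq_add, add_neg_eq_iff_eq_add.2 (add_sub_cancel 1 A).symm]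
        simpa [tailMass_one] using hpos)
  exact ⟨d, abs_le.2 hd, sub_eq_zero.1 hzero⟩

theorem exists_split (hB : 0 < B) (hk : 0 < k) (hμ : 0 < μ) (hA : 1 < A)
    (h₁ : 0 ≤ m₁) (h₂ : 0 ≤ m₂) (hm : 0 < m₁ + m₂) :
    ∃ d r, |d| ≤ A - 1 ∧ 0 < r ∧ m₁ = r ^ (2 * μ + 2) * tailMass B k μ (A + d)⁻¹ ∧
      m₂ = r ^ (2 * μ + 2) * tailMass B k μ (A - d)⁻¹ := by
  obtain ⟨d, hd, he⟩ := exists_mul_tailMass_eq hB hk hμ hA h₁ h₂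
  have hS := splitMass_pos hB hk hμ hA hd
  refine ⟨d, ((m₁ + m₂) / splitMass B k μ A d) ^ (2 * μ + 2)⁻¹, hd, by positivity, ?_, ?_⟩ <;>
  · rw [Real.rpow_inv_rpow (by positivity) (by positivity), div_mul_eq_mul_div,
      eq_div_iff hS.ne', splitMass]
    linarith

theorem one_le_of_sq_le_rpow (hμ : 0 < μ) (hr : 0 < r) (h : r ^ 2 ≤ r ^ (2 * μ + 2)) : 1 ≤ r := by
  by_contra! hlt
  have := Real.rpow_lt_rpow_of_exponent_gt hr hlt (by linarith : 2 < 2 * μ + 2)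
  rw [Real.rpow_two] at this
  linarith

end MassSplitting

section TwoHalfLines

variable {E : Type*} [NormedAddCommGroup E] [InnerProductSpace ℝ E] [CompleteSpace E]
  {f₁ g₁ f₂ g₂ : ℝ → E} {B k μ A d r y₁ y₂ : ℝ}

theorem scaled_splitMass_le_action (h₁ : HalfLineH1 f₁ g₁) (h₂ : HalfLineH1 f₂ g₂) (hB : 0 < B)
    (hk : 0 < k) (hμ : 0 < μ) (hd : |d| ≤ A - 1) (hr : 0 < r)
    (hm₁ : ∫ x in Ioi (0 : ℝ), ‖f₁ x‖ ^ (2 * μ + 2) = r ^ (2 * μ + 2) * tailMass B k μ (A + d)⁻¹)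
    (hm₂ : ∫ x in Ioi (0 : ℝ), ‖f₂ x‖ ^ (2 * μ + 2) = r ^ (2 * μ + 2) * tailMass B k μ (A - d)⁻¹) :
    k / (2 * A) * ‖f₁ 0 - f₂ 0‖ ^ 2 + r ^ 2 * ((μ + 1) * k ^ 2 / B * splitMass B k μ A d) ≤
      (∫ x in Ioi (0 : ℝ), (‖g₁ x‖ ^ 2 + k ^ 2 * ‖f₁ x‖ ^ 2)) +
        ∫ x in Ioi (0 : ℝ), (‖g₂ x‖ ^ 2 + k ^ 2 * ‖f₂ x‖ ^ 2) := by
  obtain ⟨hu₁, hu₂⟩ := one_le_add_sub_of_abs_le hd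
  have ht {u : ℝ} (hu : 1 ≤ u) : u⁻¹ ∈ Ioc (-1 : ℝ) 1 :=
    Ioc_subset_Ioc_left (by norm_num) (inv_mem_Ioc_of_one_le hu)
  have hle₁ := h₁.scaled_tailMass_le_action hB hk hμ (ht hu₁) hr hm₁
  have hle₂ := h₂.scaled_tailMass_le_action hB hk hμ (ht hu₂) hr hm₂
  have hjump := mul_norm_sub_sq_le hk (by linarith : |d| < A) (f₁ 0) (f₂ 0)
  rw [splitMass]
  linarith

theorem exists_splitMass_le (h₁ : HalfLineH1 f₁ g₁) (h₂ : HalfLineH1 f₂ g₂) (hB : 0 < B)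
    (hk : 0 < k) (hμ : 0 < μ) (hA : 1 < A) {m₁ m₂ : ℝ}
    (hm₁ : ∫ x in Ioi (0 : ℝ), ‖f₁ x‖ ^ (2 * μ + 2) = m₁)
    (hm₂ : ∫ x in Ioi (0 : ℝ), ‖f₂ x‖ ^ (2 * μ + 2) = m₂) (hm : 0 < m₁ + m₂)
    (hI : (∫ x in Ioi (0 : ℝ), (‖g₁ x‖ ^ 2 + k ^ 2 * ‖f₁ x‖ ^ 2)) +
        (∫ x in Ioi (0 : ℝ), (‖g₂ x‖ ^ 2 + k ^ 2 * ‖f₂ x‖ ^ 2)) ≤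
      k / (2 * A) * ‖f₁ 0 - f₂ 0‖ ^ 2 + (μ + 1) * k ^ 2 / B * (m₁ + m₂)) :
    ∃ d, |d| ≤ A - 1 ∧ splitMass B k μ A d ≤ m₁ + m₂ ∧ (m₁ + m₂ ≤ splitMass B k μ A d →
      m₁ = tailMass B k μ (A + d)⁻¹ ∧ m₂ = tailMass B k μ (A - d)⁻¹) := by
  obtain ⟨d, r, hd, hr, e₁, e₂⟩ := exists_split hB hk hμ hA
    (hm₁ ▸ integral_nonneg fun x => by positivity) (hm₂ ▸ integral_nonneg fun x => by positivity) hm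
  have hS := splitMass_pos hB hk hμ hA hd
  have hsum : m₁ + m₂ = r ^ (2 * μ + 2) * splitMass B k μ A d := by rw [e₁, e₂, splitMass, mul_add]
  have hle := scaled_splitMass_le_action h₁ h₂ hB hk hμ hd hr (hm₁.trans e₁) (hm₂.trans e₂)
  have hr₁ : 1 ≤ r := one_le_of_sq_le_rpow hμ hr <| le_of_mul_le_mul_right
    (a := (μ + 1) * k ^ 2 / B * splitMass B k μ A d) (by rw [hsum] at hI; linarith) (by positivity)
  refine ⟨d, hd, hsum ▸ le_mul_of_one_le_left hS.le (Real.one_le_rpow hr₁ (by positivity)),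
    fun hge => ?_⟩
  have hr₂ : r ≤ 1 := by
    by_contra! hlt
    exact hge.not_gt (hsum ▸ lt_mul_of_one_lt_left hS (Real.one_lt_rpow hlt (by positivity)))
  rw [hr₂.antisymm hr₁, Real.one_rpow, one_mul] at e₁ e₂
  exact ⟨e₁, e₂⟩

theorem exists_eq_tailProfile_pair (h₁ : HalfLineH1 f₁ g₁) (h₂ : HalfLineH1 f₂ g₂) (hB : 0 < B)
    (hk : 0 < k) (hμ : 0 < μ) (hy₁ : profileSlope k μ y₁ 0 = (A + d)⁻¹)
    (hy₂ : profileSlope k μ y₂ 0 = (A - d)⁻¹) (hd : |d| < A - 1)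
    (hm₁ : ∫ x in Ioi (0 : ℝ), ‖f₁ x‖ ^ (2 * μ + 2) = tailMass B k μ (A + d)⁻¹)
    (hm₂ : ∫ x in Ioi (0 : ℝ), ‖f₂ x‖ ^ (2 * μ + 2) = tailMass B k μ (A - d)⁻¹)
    (hI : (∫ x in Ioi (0 : ℝ), (‖g₁ x‖ ^ 2 + k ^ 2 * ‖f₁ x‖ ^ 2)) +
        (∫ x in Ioi (0 : ℝ), (‖g₂ x‖ ^ 2 + k ^ 2 * ‖f₂ x‖ ^ 2)) ≤
      k / (2 * A) * ‖f₁ 0 - f₂ 0‖ ^ 2 + (μ + 1) * k ^ 2 / B * splitMass B k μ A d) :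
    ∃ u : E, ‖u‖ = 1 ∧ (∀ x, 0 ≤ x → f₁ x = tailProfile B k μ y₁ x • u) ∧
      ∀ x, 0 ≤ x → f₂ x = tailProfile B k μ y₂ x • -u := by
  obtain ⟨hu₁, hu₂⟩ := one_lt_add_sub_of_abs_lt hd
  have ht₁ := inv_mem_Ioo_of_one_lt hu₁
  have ht₂ := inv_mem_Ioo_of_one_lt hu₂
  rw [← remMass_zero] at hm₁ hm₂
  have hpot₁ := potential_zero hB hk hμ ht₁ hm₁
  have hpot₂ := potential_zero hB hk hμ ht₂ hm₂
  have hle₁ := h₁.potential_le_action hB hk hμ ht₁ hm₁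
  have hle₂ := h₂.potential_le_action hB hk hμ ht₂ hm₂
  have hjump := mul_norm_sub_sq_le hk (by linarith : |d| < A) (f₁ 0) (f₂ 0)
  rw [splitMass] at hI
  obtain ⟨u, hu, hf₁⟩ := h₁.exists_eq_tailProfile hB hk hμ (y := y₁) (hy₁ ▸ hm₁) (by linarith)
  obtain ⟨v, hv, hf₂⟩ := h₂.exists_eq_tailProfile hB hk hμ (y := y₂) (hy₂ ▸ hm₂) (by linarith)
  have hjump_eq : ‖f₁ 0 - f₂ 0‖ = ‖f₁ 0‖ + ‖f₂ 0‖ :=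
    norm_sub_eq_of_le_mul_norm_sub_sq hk (by linarith : |d| < A) (by linarith)
  rw [hf₁ 0 le_rfl, hf₂ 0 le_rfl] at hjump_eq
  have hopp := eq_neg_of_norm_smul_sub_smul_eq hu hv (tailProfile_pos hB y₁ 0)
    (tailProfile_pos hB y₂ 0) hjump_eq
  exact ⟨u, hu, hf₁, hopp ▸ hf₂⟩

end TwoHalfLines

section PhaseOrbits

variable {γ lam μ ω x₁ x₂ : ℝ} {ψ : ℝ → ℂ}

/-- The `2μ`-th power of the maximum of the soliton. -/
def solitonAmp (lam μ ω : ℝ) : ℝ := (μ + 1) * ω / lam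

theorem solitonAmp_pos (hlam : 0 < lam) (hμ : 0 < μ) (hω : 0 < ω) : 0 < solitonAmp lam μ ω := by
  unfold solitonAmp
  positivity

theorem mul_sqrt_sq_div_solitonAmp (hlam : 0 < lam) (hμ : 0 < μ) (hω : 0 < ω) :
    (μ + 1) * √ω ^ 2 / solitonAmp lam μ ω = lam := by
  rw [solitonAmp, Real.sq_sqrt hω.le]
  field_simp

theorem soliton_eq_tailProfile (hlam : 0 < lam) (hμ : 0 < μ) (hω : 0 < ω) (x₀ x : ℝ) :
    soliton lam μ ω x₀ x = tailProfile (solitonAmp lam μ ω) √ω μ (-x₀) x := by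
  rw [soliton, tailProfile, solitonAmp, Real.div_rpow (by positivity) hlam.le,
    Real.mul_rpow (by positivity) hω.le, Real.rpow_neg hlam.le, ← sub_eq_add_neg]
  ring

theorem soliton_neg (lam μ ω x₀ x : ℝ) : soliton lam μ ω x₀ (-x) = soliton lam μ ω (-x₀) x := by
  rw [soliton, soliton, ← Real.cosh_neg (μ * √ω * (-x - x₀))]
  congr 4
  ring

theorem boundState_neg (lam μ ω y θ : ℝ) {x : ℝ} (hx : x ≠ 0) :
    boundState lam μ ω y (-y) θ (-x) = -boundState lam μ ω y (-y) θ x := by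
  rcases lt_or_gt_of_ne hx with h | h
  · rw [boundState, boundState, if_neg (by linarith), if_pos h, soliton_neg, neg_neg, neg_neg]
  · rw [boundState, boundState, if_pos (by linarith), if_neg (by linarith), soliton_neg]

theorem ae_eq_iff_restrict_Ioi {φ : ℝ → ℂ} :
    ψ =ᵐ[volume] φ ↔ ψ =ᵐ[volume.restrict (Ioi 0)] φ ∧
      (fun x => ψ (-x)) =ᵐ[volume.restrict (Ioi 0)] fun x => φ (-x) := by
  refine ⟨fun h => ⟨ae_restrict_of_ae h, ae_restrict_of_ae
    ((Measure.measurePreserving_neg volume).quasiMeasurePreserving.ae_eq_comp h)⟩, fun h => ?_⟩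
  have hright := (ae_restrict_iff' measurableSet_Ioi).1 h.1
  have hleft := (ae_restrict_iff' measurableSet_Iio).1 (ae_eq_Iio_of_comp_neg h.2)
  filter_upwards [hright, hleft, Measure.ae_ne volume 0] with x hx₁ hx₂ hx₀
  rcases lt_or_gt_of_ne hx₀ with hx | hx
  · simpa only [neg_neg] using hx₂ hx
  · exact hx₁ hx

theorem mem_phaseOrbit_iff (hlam : 0 < lam) (hμ : 0 < μ) (hω : 0 < ω) :
    ψ ∈ phaseOrbit lam μ ω x₁ (-x₂) ↔ ∃ u : ℂ, ‖u‖ = 1 ∧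
      (ψ =ᵐ[volume.restrict (Ioi 0)] fun x => tailProfile (solitonAmp lam μ ω) √ω μ x₂ x • u) ∧
      (fun x => ψ (-x)) =ᵐ[volume.restrict (Ioi 0)]
        fun x => tailProfile (solitonAmp lam μ ω) √ω μ x₁ x • -u := by
  have hright (θ : ℝ) : boundState lam μ ω x₁ (-x₂) θ =ᵐ[volume.restrict (Ioi 0)]
      fun x => tailProfile (solitonAmp lam μ ω) √ω μ x₂ x • Complex.exp (θ * Complex.I) := by
    filter_upwards [ae_restrict_mem measurableSet_Ioi] with x hx
    rw [boundState, if_neg (not_lt_of_gt hx), soliton_eq_tailProfile hlam hμ hω, neg_neg,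
      Complex.real_smul, mul_comm]
  have hleft (θ : ℝ) :
      (fun x => boundState lam μ ω x₁ (-x₂) θ (-x)) =ᵐ[volume.restrict (Ioi 0)]
        fun x => tailProfile (solitonAmp lam μ ω) √ω μ x₁ x • -Complex.exp (θ * Complex.I) := by
    filter_upwards [ae_restrict_mem measurableSet_Ioi] with x hx
    rw [boundState, if_pos (neg_lt_zero.2 hx), soliton_neg, soliton_eq_tailProfile hlam hμ hω,
      neg_neg, smul_neg, Complex.real_smul, mul_comm]
  constructor
  · rintro ⟨θ, hθ⟩
    obtain ⟨h₁, h₂⟩ := ae_eq_iff_restrict_Ioi.1 hθ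
    exact ⟨_, Complex.norm_exp_ofReal_mul_I θ, h₁.trans (hright θ), h₂.trans (hleft θ)⟩
  · rintro ⟨u, hu, h₁, h₂⟩
    obtain ⟨θ, rfl⟩ := (Complex.norm_eq_one_iff u).1 hu
    exact ⟨θ, ae_eq_iff_restrict_Ioi.2 ⟨h₁.trans (hright θ).symm, h₂.trans (hleft θ).symm⟩⟩

theorem exists_energyRep_of_mem_phaseOrbit (hlam : 0 < lam) (hμ : 0 < μ) (hω : 0 < ω)
    (hψ : ψ ∈ phaseOrbit lam μ ω x₁ (-x₂)) : ∃ u : ℂ, ‖u‖ = 1 ∧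
      EnergyRep ψ (fun x => tailProfile (solitonAmp lam μ ω) √ω μ x₂ x • u)
        (fun x => (-(√ω * profileSlope √ω μ x₂ x) *
          tailProfile (solitonAmp lam μ ω) √ω μ x₂ x) • u)
        (fun x => tailProfile (solitonAmp lam μ ω) √ω μ x₁ x • -u)
        (fun x => (-(√ω * profileSlope √ω μ x₁ x) *
          tailProfile (solitonAmp lam μ ω) √ω μ x₁ x) • -u) := by
  have hB := solitonAmp_pos hlam hμ hω
  have hk := Real.sqrt_pos.2 hω
  obtain ⟨u, hu, h₁, h₂⟩ := (mem_phaseOrbit_iff hlam hμ hω).1 hψ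
  exact ⟨u, hu, halfLineH1_tailProfile hB hk hμ x₂ u, halfLineH1_tailProfile hB hk hμ x₁ (-u),
    h₁, h₂⟩

theorem powerNorm_of_mem_phaseOrbit (hlam : 0 < lam) (hμ : 0 < μ) (hω : 0 < ω)
    (hψ : ψ ∈ phaseOrbit lam μ ω x₁ (-x₂)) :
    powerNorm μ ψ = tailMass (solitonAmp lam μ ω) √ω μ (profileSlope √ω μ x₂ 0) +
      tailMass (solitonAmp lam μ ω) √ω μ (profileSlope √ω μ x₁ 0) := by
  have hB := solitonAmp_pos hlam hμ hω
  have hk := Real.sqrt_pos.2 hω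
  obtain ⟨u, hu, hrep⟩ := exists_energyRep_of_mem_phaseOrbit hlam hμ hω hψ
  rw [hrep.powerNorm_eq hμ.le, integral_norm_tailProfile_rpow hB hk hμ x₂ hu,
    integral_norm_tailProfile_rpow hB hk hμ x₁ (by rwa [norm_neg])]

theorem nehari_of_mem_phaseOrbit (hlam : 0 < lam) (hμ : 0 < μ) (hω : 0 < ω)
    (hψ : ψ ∈ phaseOrbit lam μ ω x₁ (-x₂)) :
    nehari γ lam μ ω ψ =
      √ω * profileSlope √ω μ x₂ 0 * tailProfile (solitonAmp lam μ ω) √ω μ x₂ 0 ^ 2 +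
        √ω * profileSlope √ω μ x₁ 0 * tailProfile (solitonAmp lam μ ω) √ω μ x₁ 0 ^ 2 -
      γ⁻¹ * (tailProfile (solitonAmp lam μ ω) √ω μ x₂ 0 +
        tailProfile (solitonAmp lam μ ω) √ω μ x₁ 0) ^ 2 := by
  have hB := solitonAmp_pos hlam hμ hω
  have hk := Real.sqrt_pos.2 hω
  obtain ⟨u, hu, hrep⟩ := exists_energyRep_of_mem_phaseOrbit hlam hμ hω hψ
  have hu' : ‖-u‖ = 1 := by rwa [norm_neg]
  rw [hrep.nehari_eq γ lam μ hω.le, integral_action_tailProfile hB hk hμ x₂ hu,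
    integral_action_tailProfile hB hk hμ x₁ hu', powerNorm_of_mem_phaseOrbit hlam hμ hω hψ,
    smul_neg, sub_neg_eq_add, ← add_smul, norm_smul_of_norm_eq_one hu, sq_abs, profilePotential,
    profilePotential, mul_sqrt_sq_div_solitonAmp hlam hμ hω]
  ring

theorem disjoint_phaseOrbit (hlam : 0 < lam) (hμ : 0 < μ) (hω : 0 < ω) (h₁ : 0 < x₁)
    (h : x₁ < x₂) :
    Disjoint (phaseOrbit lam μ ω x₁ (-x₂)) (phaseOrbit lam μ ω x₂ (-x₁)) := by
  have hB := solitonAmp_pos hlam hμ hω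
  rw [Set.disjoint_left]
  intro ψ hψ hψ'
  obtain ⟨u, hu, hr, -⟩ := (mem_phaseOrbit_iff hlam hμ hω).1 hψ
  obtain ⟨v, hv, hr', -⟩ := (mem_phaseOrbit_iff hlam hμ hω).1 hψ'
  have : (ae (volume.restrict (Ioi (0 : ℝ)))).NeBot :=
    ae_neBot.2 (by rw [Ne, Measure.restrict_eq_zero, Real.volume_Ioi]; exact ENNReal.top_ne_zero)
  obtain ⟨x, hx, hx₀⟩ := ((hr.symm.trans hr').and (ae_restrict_mem measurableSet_Ioi)).exists
  rw [mem_Ioi] at hx₀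
  have hnorm := congrArg norm hx
  rw [norm_smul_of_norm_eq_one hu, norm_smul_of_norm_eq_one hv, abs_of_pos (tailProfile_pos hB _ _),
    abs_of_pos (tailProfile_pos hB _ _)] at hnorm
  have hamp : ampPow (solitonAmp lam μ ω) (profileSlope √ω μ x₂ x) =
      ampPow (solitonAmp lam μ ω) (profileSlope √ω μ x₁ x) := by
    rw [← tailProfile_rpow_two_mul hB hμ, ← tailProfile_rpow_two_mul hB hμ, hnorm]
  have hσ₁ : 0 < profileSlope √ω μ x₁ x := Real.tanh_zero ▸ strictMono_tanh (by positivity)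
  have hσ : profileSlope √ω μ x₁ x < profileSlope √ω μ x₂ x := strictMono_tanh (by gcongr)
  have hsq := mul_left_cancel₀ hB.ne' hamp
  nlinarith

end PhaseOrbits

section Centre

variable {μ ω t : ℝ}

theorem centre_eq_artanh (ht : t ∈ Ioo (-1 : ℝ) 1) :
    centre μ ω t = Real.artanh t / (μ * √ω) := by
  have h : 0 < (1 + t) / (1 - t) := div_pos (by linarith [ht.1]) (by linarith [ht.2])
  rw [centre, abs_of_pos h, Real.artanh_eq_half_log (Ioo_subset_Icc_self ht)]
  ring

theorem profileSlope_centre (hμ : 0 < μ) (hω : 0 < ω) (ht : t ∈ Ioo (-1 : ℝ) 1) :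
    profileSlope √ω μ (centre μ ω t) 0 = t := by
  rw [profileSlope, zero_add, centre_eq_artanh ht, mul_div_cancel₀ _ (by positivity),
    Real.tanh_artanh ht]

theorem strictMonoOn_centre (hμ : 0 < μ) (hω : 0 < ω) :
    StrictMonoOn (centre μ ω) (Ioo (-1) 1) := fun s hs t ht hst => by
  rw [centre_eq_artanh hs, centre_eq_artanh ht]
  exact div_lt_div_of_pos_right (Real.strictMonoOn_artanh hs ht hst) (by positivity)

theorem centre_pos (hμ : 0 < μ) (hω : 0 < ω) (ht : t ∈ Ioo (0 : ℝ) 1) : 0 < centre μ ω t := by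
  rw [centre_eq_artanh (Ioo_subset_Ioo_left (by norm_num) ht)]
  exact div_pos (Real.artanh_pos ht) (by positivity)

end Centre

theorem profileSlope_mul_tailProfile_eq {B k μ y₁ y₂ x : ℝ} (hB : 0 < B) (hμ : 0 < μ)
    (h₁ : 0 < profileSlope k μ y₁ x) (h₂ : 0 < profileSlope k μ y₂ x)
    (h : matching μ (profileSlope k μ y₁ x) = matching μ (profileSlope k μ y₂ x)) :
    profileSlope k μ y₁ x * tailProfile B k μ y₁ x =
      profileSlope k μ y₂ x * tailProfile B k μ y₂ x := by
  have hp₁ := tailProfile_pos (k := k) (μ := μ) hB y₁ x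
  have hp₂ := tailProfile_pos (k := k) (μ := μ) hB y₂ x
  refine (sq_eq_sq₀ (by positivity) (by positivity)).1 ?_
  rw [mul_pow, mul_pow, tailProfile_sq hB, tailProfile_sq hB,
    sq_mul_ampPow_rpow hB hμ ⟨h₁, (profileSlope_mem_Ioo y₁ x).2⟩,
    sq_mul_ampPow_rpow hB hμ ⟨h₂, (profileSlope_mem_Ioo y₂ x).2⟩, h]

section SplitOrbit

/-- The phase orbit of the bound state whose tails have the logarithmic slopes `√ω (A - d)⁻¹` and
`√ω (A + d)⁻¹` at `0-` and `0+`. -/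
def splitOrbit (lam μ ω A d : ℝ) : Set (ℝ → ℂ) :=
  phaseOrbit lam μ ω (centre μ ω (A - d)⁻¹) (-centre μ ω (A + d)⁻¹)

variable {γ lam μ ω A d : ℝ} {ψ : ℝ → ℂ}

theorem powerNorm_of_mem_splitOrbit (hlam : 0 < lam) (hμ : 0 < μ) (hω : 0 < ω) (hd : |d| < A - 1)
    (hψ : ψ ∈ splitOrbit lam μ ω A d) :
    powerNorm μ ψ = splitMass (solitonAmp lam μ ω) √ω μ A d := by
  obtain ⟨hu₁, hu₂⟩ := one_lt_add_sub_of_abs_lt hd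
  rw [powerNorm_of_mem_phaseOrbit hlam hμ hω hψ,
    profileSlope_centre hμ hω (inv_mem_Ioo_of_one_lt hu₁),
    profileSlope_centre hμ hω (inv_mem_Ioo_of_one_lt hu₂), splitMass]

theorem nehari_of_mem_splitOrbit (hlam : 0 < lam) (hμ : 0 < μ) (hω : 0 < ω)
    (hA : 2 * A = γ * √ω) (hd : |d| < A - 1)
    (hmatch : matching μ (A + d)⁻¹ = matching μ (A - d)⁻¹) (hψ : ψ ∈ splitOrbit lam μ ω A d) :
    nehari γ lam μ ω ψ = 0 := by
  obtain ⟨hu₁, hu₂⟩ := one_lt_add_sub_of_abs_lt hd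
  have hs₁ := profileSlope_centre hμ hω (inv_mem_Ioo_of_one_lt hu₁)
  have hs₂ := profileSlope_centre hμ hω (inv_mem_Ioo_of_one_lt hu₂)
  have hbalance := profileSlope_mul_tailProfile_eq (x := 0) (k := √ω) (y₁ := centre μ ω (A + d)⁻¹)
    (y₂ := centre μ ω (A - d)⁻¹) (solitonAmp_pos hlam hμ hω) hμ
    (by rw [hs₁]; positivity) (by rw [hs₂]; positivity) (by rw [hs₁, hs₂, hmatch])
  have hγ : γ ≠ 0 := by
    rintro rfl
    linarith
  rw [nehari_of_mem_phaseOrbit hlam hμ hω hψ, hs₁, hs₂]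
  rw [hs₁, hs₂, inv_mul_eq_iff_eq_mul₀ (by positivity)] at hbalance
  rw [hbalance]
  generalize tailProfile (solitonAmp lam μ ω) √ω μ (centre μ ω (A - d)⁻¹) 0 = p
  field_simp
  linear_combination -2 * A * p ^ 2 * hA

theorem splitOrbit_subset_nehariManifold (hlam : 0 < lam) (hμ : 0 < μ) (hω : 0 < ω)
    (hA : 2 * A = γ * √ω) (hd : |d| < A - 1)
    (hmatch : matching μ (A + d)⁻¹ = matching μ (A - d)⁻¹) :
    splitOrbit lam μ ω A d ⊆ nehariManifold γ lam μ ω := by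
  intro ψ hψ
  obtain ⟨u, -, hrep⟩ := exists_energyRep_of_mem_phaseOrbit hlam hμ hω hψ
  refine ⟨hrep.mem_energySpace, fun h₀ => ?_, nehari_of_mem_splitOrbit hlam hμ hω hA hd hmatch hψ⟩
  have hS := splitMass_pos (solitonAmp_pos hlam hμ hω) (Real.sqrt_pos.2 hω) hμ
    (by linarith [abs_nonneg d]) hd.le
  rw [← powerNorm_of_mem_splitOrbit hlam hμ hω hd hψ] at hS
  exact hS.ne' ((hrep.powerNorm_eq_zero_iff hμ.le).2 h₀)

theorem exists_splitMass_le_powerNorm (hlam : 0 < lam) (hμ : 0 < μ) (hω : 0 < ω) (hA₁ : 1 < A)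
    (hA : 2 * A = γ * √ω) (hψ : ψ ∈ nehariManifold γ lam μ ω) :
    ∃ d, |d| ≤ A - 1 ∧ splitMass (solitonAmp lam μ ω) √ω μ A d ≤ powerNorm μ ψ ∧
      (powerNorm μ ψ ≤ splitMass (solitonAmp lam μ ω) √ω μ A d → |d| < A - 1 →
        ψ ∈ splitOrbit lam μ ω A d) := by
  have hB := solitonAmp_pos hlam hμ hω
  have hk := Real.sqrt_pos.2 hω
  obtain ⟨hQ, hne, hI⟩ := hψ
  obtain ⟨f₁, g₁, f₂, g₂, hrep⟩ := exists_energyRep hQ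
  have hN := hrep.powerNorm_eq hμ.le
  have hNpos : 0 < powerNorm μ ψ := (integral_nonneg fun x => by positivity).lt_of_ne'
    fun h₀ => hne ((hrep.powerNorm_eq_zero_iff hμ.le).1 h₀)
  have hγ : γ⁻¹ = √ω / (2 * A) := by
    have : γ ≠ 0 := by
      rintro rfl
      linarith
    rw [hA]
    field_simp
  rw [hrep.nehari_eq γ lam μ hω.le, ← mul_sqrt_sq_div_solitonAmp hlam hμ hω, hγ] at hI
  obtain ⟨d, hd, hle, heq⟩ := exists_splitMass_le hrep.right hrep.left hB hk hμ hA₁ rfl rfl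
    (hN ▸ hNpos) (by rw [← hN]; linarith)
  rw [← hN] at hle heq
  refine ⟨d, hd, hle, fun hge hlt => ?_⟩
  obtain ⟨hu₁, hu₂⟩ := one_lt_add_sub_of_abs_lt hlt
  obtain ⟨u, hu, hf₁, hf₂⟩ := exists_eq_tailProfile_pair hrep.right hrep.left hB hk hμ
    (profileSlope_centre hμ hω (inv_mem_Ioo_of_one_lt hu₁))
    (profileSlope_centre hμ hω (inv_mem_Ioo_of_one_lt hu₂)) hlt (heq hge).1 (heq hge).2
    (by rw [hle.antisymm hge]; linarith)
  refine (mem_phaseOrbit_iff hlam hμ hω).2 ⟨u, hu, ?_, ?_⟩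
  · filter_upwards [hrep.right_ae, ae_restrict_mem measurableSet_Ioi] with x hx hx₀
    rw [hx, hf₁ x (le_of_lt hx₀)]
  · filter_upwards [hrep.left_ae, ae_restrict_mem measurableSet_Ioi] with x hx hx₀
    rw [hx, hf₂ x (le_of_lt hx₀)]

end SplitOrbit

section GroundStates

variable {γ lam μ ω A d d₀ t₁ t₂ : ℝ}

theorem groundStates_eq_powerNorm_minimizers (hlam : 0 < lam) (hμ : 0 < μ) :
    groundStates γ lam μ ω = {ψ | ψ ∈ nehariManifold γ lam μ ω ∧
      ∀ φ ∈ nehariManifold γ lam μ ω, powerNorm μ ψ ≤ powerNorm μ φ} := by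
  have hc : 0 < lam * μ / (2 * μ + 2) := by positivity
  ext ψ
  refine and_congr_right fun hψ => forall₂_congr fun φ hφ => ?_
  rw [action_eq_of_nehari_eq_zero hμ hψ.2.2, action_eq_of_nehari_eq_zero hμ hφ.2.2,
    mul_le_mul_iff_right₀ hc]

theorem groundStates_eq_splitOrbit_union (hlam : 0 < lam) (hμ : 0 < μ) (hω : 0 < ω)
    (hA : 2 * A = γ * √ω) (hd₀ : |d₀| < A - 1)
    (hmatch : matching μ (A + d₀)⁻¹ = matching μ (A - d₀)⁻¹)
    (hmin : ∀ d, |d| ≤ A - 1 → |d| ≠ |d₀| → splitMass (solitonAmp lam μ ω) √ω μ A d₀ <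
      splitMass (solitonAmp lam μ ω) √ω μ A d) :
    groundStates γ lam μ ω = splitOrbit lam μ ω A (-d₀) ∪ splitOrbit lam μ ω A d₀ := by
  have hA₁ : 1 < A := by linarith [abs_nonneg d₀]
  have horbit : ∀ ψ ∈ splitOrbit lam μ ω A (-d₀) ∪ splitOrbit lam μ ω A d₀,
      ψ ∈ nehariManifold γ lam μ ω ∧
        powerNorm μ ψ = splitMass (solitonAmp lam μ ω) √ω μ A d₀ := by
    have hd₀' : |(-d₀)| < A - 1 := by rwa [abs_neg]
    rintro ψ (hψ | hψ)
    · refine ⟨splitOrbit_subset_nehariManifold hlam hμ hω hA hd₀' ?_ hψ, ?_⟩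
      · rw [sub_neg_eq_add, ← sub_eq_add_neg, hmatch]
      · rw [powerNorm_of_mem_splitOrbit hlam hμ hω hd₀' hψ, splitMass_neg]
    · exact ⟨splitOrbit_subset_nehariManifold hlam hμ hω hA hd₀ hmatch hψ,
        powerNorm_of_mem_splitOrbit hlam hμ hω hd₀ hψ⟩
  rw [groundStates_eq_powerNorm_minimizers hlam hμ]
  refine Subset.antisymm (fun ψ ⟨hψ, hψmin⟩ => ?_) fun ψ hψ =>
    ⟨(horbit ψ hψ).1, fun φ hφ => ?_⟩
  · obtain ⟨hφ, hφN⟩ := horbit (boundState lam μ ω _ _ 0) (Or.inr ⟨0, ae_eq_refl _⟩)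
    obtain ⟨d, hd, hle, hmem⟩ := exists_splitMass_le_powerNorm hlam hμ hω hA₁ hA hψ
    have hψle := hφN ▸ hψmin _ hφ
    have habs : |d| = |d₀| := by
      by_contra hne
      exact ((hmin d hd hne).trans_le hle).not_ge hψle
    have hψmem := hmem (by rwa [← splitMass_abs d, habs, splitMass_abs]) (habs ▸ hd₀)
    rcases abs_eq_abs.1 habs with rfl | rfl
    · exact Or.inr hψmem
    · exact Or.inl hψmem
  · obtain ⟨d, hd, hle, -⟩ := exists_splitMass_le_powerNorm hlam hμ hω hA₁ hA hφ
    refine (horbit ψ hψ).2.trans_le (le_trans ?_ hle)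
    by_cases habs : |d| = |d₀|
    · rw [← splitMass_abs d, habs, splitMass_abs]
    · exact (hmin d hd habs).le

theorem SolvesSystem.exists_logRatio_eq_zero (h : SolvesSystem γ μ ω t₁ t₂)
    (hA : 2 * A = γ * √ω) :
    ∃ d ∈ Ioo 0 (A - 1), logRatio μ A d = 0 ∧ t₁ = (A + d)⁻¹ ∧ t₂ = (A - d)⁻¹ := by
  obtain ⟨h₁, h₁₂, h₂, hm, hs⟩ := h
  have h₂₀ := h₁.trans h₁₂
  have hlt : t₂⁻¹ < t₁⁻¹ := inv_strictAnti₀ h₁ h₁₂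
  have hone : 1 < t₂⁻¹ := (one_lt_inv₀ h₂₀).2 h₂
  have hadd : A + (t₁⁻¹ - t₂⁻¹) / 2 = t₁⁻¹ := by linarith
  have hsub : A - (t₁⁻¹ - t₂⁻¹) / 2 = t₂⁻¹ := by linarith
  refine ⟨(t₁⁻¹ - t₂⁻¹) / 2, ⟨by linarith, by linarith⟩, ?_, ?_, ?_⟩
  · rw [logRatio_eq_zero_iff (by linarith) (by linarith), hadd, hsub, inv_inv, inv_inv]
    exact hm
  · rw [hadd, inv_inv]
  · rw [hsub, inv_inv]

theorem solvesSystem_of_logRatio_eq_zero (hA : 2 * A = γ * √ω) (hd : d ∈ Ioo 0 (A - 1))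
    (hz : logRatio μ A d = 0) : SolvesSystem γ μ ω (A + d)⁻¹ (A - d)⁻¹ := by
  have hu₁ : 1 < A + d := by linarith [hd.1, hd.2]
  have hu₂ : 1 < A - d := by linarith [hd.2]
  refine ⟨by positivity, inv_strictAnti₀ (by positivity) (by linarith [hd.1]),
    inv_lt_one_of_one_lt₀ hu₂, (logRatio_eq_zero_iff hu₁ hu₂).1 hz, ?_⟩
  rw [inv_inv, inv_inv]
  linarith

end GroundStates

section Frequencies

variable {γ lam μ ω A t₁ t₂ : ℝ}

theorem four_mul_sq_of_two_mul_eq (hω : 0 ≤ ω) (hA : 2 * A = γ * √ω) :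
    4 * A ^ 2 = γ ^ 2 * ω := by
  rw [← Real.sq_sqrt hω, ← mul_pow, ← hA]
  ring

theorem one_lt_of_four_div_sq_lt (hγ : 0 < γ) (hω : 4 / γ ^ 2 < ω) (hA : 2 * A = γ * √ω) :
    1 < A := by
  have hω₀ : 0 < ω := lt_trans (by positivity) hω
  have hA₀ : 0 < γ * √ω := by positivity
  rw [div_lt_iff₀' (by positivity), ← four_mul_sq_of_two_mul_eq hω₀.le hA] at hω
  nlinarith

theorem le_omegaStar_iff (hγ : 0 < γ) (hμ : 0 < μ) (hω : 0 ≤ ω) (hA : 2 * A = γ * √ω) :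
    ω ≤ omegaStar γ μ ↔ μ * (A ^ 2 - 1) ≤ 1 := by
  have h := four_mul_sq_of_two_mul_eq hω hA
  rw [omegaStar, le_div_iff₀ (by positivity),
    show ω * (γ ^ 2 * μ) = 4 * (μ * A ^ 2) by linear_combination -μ * h]
  constructor <;> intro <;> linarith

theorem four_div_sq_lt_omegaStar (hγ : 0 < γ) (hμ : 0 < μ) : 4 / γ ^ 2 < omegaStar γ μ := by
  rw [omegaStar, div_lt_div_iff₀ (by positivity) (by positivity)]
  nlinarith [pow_pos hγ 2]

theorem centre_inv_half (h : 2 < γ * √ω) :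
    centre μ ω (γ * √ω / 2)⁻¹ =
      1 / (2 * μ * √ω) * Real.log ((γ * √ω + 2) / (γ * √ω - 2)) := by
  have h₀ : γ * √ω ≠ 0 := by linarith
  have hquot : 0 < (γ * √ω + 2) / (γ * √ω - 2) := div_pos (by linarith) (by linarith)
  rw [centre, inv_div, one_add_div h₀, one_sub_div h₀, div_div_div_cancel_right₀ h₀,
    abs_of_pos hquot]

theorem groundStates_of_le_omegaStar (hγ : 0 < γ) (hlam : 0 < lam) (hμ : 0 < μ)
    (hω : 4 / γ ^ 2 < ω) (hωs : ω ≤ omegaStar γ μ) (hA : 2 * A = γ * √ω) :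
    groundStates γ lam μ ω = phaseOrbit lam μ ω (centre μ ω A⁻¹) (-centre μ ω A⁻¹) := by
  have hω₀ : 0 < ω := lt_trans (by positivity) hω
  have hA₁ := one_lt_of_four_div_sq_lt hγ hω hA
  rw [groundStates_eq_splitOrbit_union hlam hμ hω₀ hA (d₀ := 0) (by rw [abs_zero]; linarith)
    (by rw [add_zero, sub_zero]) fun d hd hne => splitMass_zero_lt (solitonAmp_pos hlam hμ hω₀)
      (Real.sqrt_pos.2 hω₀) hμ hA₁ ((le_omegaStar_iff hγ hμ hω₀.le hA).1 hωs) hd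
      (ne_of_apply_ne _ hne), neg_zero, union_self, splitOrbit, add_zero, sub_zero]

theorem existsUnique_solvesSystem (hγ : 0 < γ) (hμ : 0 < μ) (hω : omegaStar γ μ < ω) :
    ∃! t : ℝ × ℝ, SolvesSystem γ μ ω t.1 t.2 := by
  have hω₁ := (four_div_sq_lt_omegaStar hγ hμ).trans hω
  have hω₀ : 0 < ω := lt_trans (by positivity) hω₁
  have hA : 2 * (γ * √ω / 2) = γ * √ω := by ring
  have hA₁ := one_lt_of_four_div_sq_lt hγ hω₁ hA
  obtain ⟨d, hd, hz⟩ := exists_logRatio_eq_zero hA₁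
    (not_le.1 ((le_omegaStar_iff hγ hμ hω₀.le hA).not.1 hω.not_ge))
  refine ⟨⟨_, _⟩, solvesSystem_of_logRatio_eq_zero hA hd hz, fun t ht => ?_⟩
  obtain ⟨d', hd', hz', ht₁, ht₂⟩ := ht.exists_logRatio_eq_zero hA
  rw [eq_of_logRatio_eq_zero hA₁ hd hd' hz hz']
  exact Prod.ext ht₁ ht₂

theorem SolvesSystem.groundStates_eq (h : SolvesSystem γ μ ω t₁ t₂) (hlam : 0 < lam)
    (hμ : 0 < μ) (hω : 0 < ω) :
    groundStates γ lam μ ω = phaseOrbit lam μ ω (centre μ ω t₁) (-centre μ ω t₂) ∪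
      phaseOrbit lam μ ω (centre μ ω t₂) (-centre μ ω t₁) := by
  have hA : 2 * (γ * √ω / 2) = γ * √ω := by ring
  obtain ⟨d, hd, hz, rfl, rfl⟩ := h.exists_logRatio_eq_zero hA
  have habs := abs_of_pos hd.1
  rw [groundStates_eq_splitOrbit_union hlam hμ hω hA (habs.trans_lt hd.2)
    ((logRatio_eq_zero_iff (by linarith [hd.1, hd.2]) (by linarith [hd.2])).1 hz)
    fun d' hd' hne => splitMass_lt_of_logRatio_eq_zero (solitonAmp_pos hlam hμ hω)
      (Real.sqrt_pos.2 hω) hμ (by linarith [hd.1, hd.2]) hd hz hd' (hne.trans_eq habs),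
    splitOrbit, splitOrbit, sub_neg_eq_add, ← sub_eq_add_neg]

theorem SolvesSystem.centre_pos_and_lt (h : SolvesSystem γ μ ω t₁ t₂) (hμ : 0 < μ) (hω : 0 < ω) :
    0 < centre μ ω t₁ ∧ centre μ ω t₁ < centre μ ω t₂ := by
  obtain ⟨h₁, h₁₂, h₂, -⟩ := h
  exact ⟨centre_pos hμ hω ⟨h₁, h₁₂.trans h₂⟩,
    strictMonoOn_centre hμ hω ⟨by linarith, by linarith⟩ ⟨by linarith, h₂⟩ h₁₂⟩

end Frequencies

end DeltaPrimeNLS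

end

theorem theorem5p3 (γ lam μ ω : ℝ) (hγ : 0 < γ) (hlam : 0 < lam) (hμ : 0 < μ) :
    (4 / γ ^ 2 < ω → ω ≤ omegaStar γ μ →
      ∀ y : ℝ, y = 1 / (2 * μ * √ω) * Real.log ((γ * √ω + 2) / (γ * √ω - 2)) →
        groundStates γ lam μ ω = phaseOrbit lam μ ω y (-y) ∧
        ∀ θ x : ℝ, x ≠ 0 →
          boundState lam μ ω y (-y) θ (-x) = -boundState lam μ ω y (-y) θ x) ∧
    (omegaStar γ μ < ω →
      (∃! t : ℝ × ℝ, SolvesSystem γ μ ω t.1 t.2) ∧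
      ∀ t₁ t₂ : ℝ, SolvesSystem γ μ ω t₁ t₂ →
        ∀ y₁ y₂ : ℝ, y₁ = centre μ ω t₁ → y₂ = centre μ ω t₂ →
          0 < y₁ ∧ y₁ < y₂ ∧
          groundStates γ lam μ ω =
            phaseOrbit lam μ ω y₁ (-y₂) ∪ phaseOrbit lam μ ω y₂ (-y₁) ∧
          Disjoint (phaseOrbit lam μ ω y₁ (-y₂)) (phaseOrbit lam μ ω y₂ (-y₁))) := by
  constructor
  · rintro hω hωs y rfl
    have hA : 2 * (γ * √ω / 2) = γ * √ω := by ring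
    rw [← centre_inv_half (by linarith [one_lt_of_four_div_sq_lt hγ hω hA])]
    exact ⟨groundStates_of_le_omegaStar hγ hlam hμ hω hωs hA, fun θ x => boundState_neg lam μ ω _ θ⟩
  · intro hω
    have hω₀ : 0 < ω := lt_trans (by positivity) ((four_div_sq_lt_omegaStar hγ hμ).trans hω)
    refine ⟨existsUnique_solvesSystem hγ hμ hω, ?_⟩
    rintro t₁ t₂ ht _ _ rfl rfl
    obtain ⟨hpos, hlt⟩ := ht.centre_pos_and_lt hμ hω₀
    exact ⟨hpos, hlt, ht.groundStates_eq hlam hμ hω₀, disjoint_phaseOrbit hlam hμ hω₀ hpos hlt⟩
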